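/- **Setting.** An instance of load balanced demand distribution consists of $n$ demand nodes, $k$ service centers, costs $\mathcal{CM}(d,i)$ of assigning demand node $d$ to service center $s_i$, capacities $c_i\in\mathbb N$, and penalty functions $q_i$, where $q_i(m)$ is the extra cost incurred when $s_i$ receives its $m$-th demand node: $q_i(m)=0$ for $m\le c_i$, $q_i(m)>0$ for $m>c_i$, and $q_i$ is (weakly) increasing. All costs and penalties lie in a linearly ordered commutative ring such as $\mathbb Z$ or $\mathbb R$. An allotment $\mathcal A$ maps every demand node to one service center; the occupancy $o_i$ is the number of demand nodes at $s_i$. A *transfer edge* from $s_i$ to $s_j$, $j\ne i$, moves a demand node $d$ of $s_i$ to $s_j$ and costs $\mathcal{CM}(d,j)-\mathcal{CM}(d,i)$; the *penalty transfer edge* from $s_i$ to $s_j$ costs $q_i(o_i+1)-q_j(o_j)$. A *loop* from $s_i$ to $s_j\neq s_i$ is a path of transfer edges from $s_i$ to $s_j$, closed either by a transfer edge or by the penalty transfer edge from $s_j$ to $s_i$; it starts at $s_i$, its cost is the sum of its edge costs, and it is simple if it visits no service center twice. Removing a simple loop means carrying out all its transfers. **Machine.** A random access machine has arrays (with up to three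 indices) of natural numbers, which it can add, subtract and halve, and of ring elements, which it can add, subtract and compare. It reads costs and penalty values in one step, and every executed assignment and every evaluated test is one step. A memory *stores* an allotment if it holds $k$, $n$, the service center of every demand node, the occupancies, and, for every ordered pair $(s_i,s_j)$ with $i\ne j$, a binary min-heap (with the position of each of its elements) of the demand nodes at $s_i$ keyed by their transfer cost to $s_j$. **Theorem.** There are a program and a constant $C$, both independent of the instance, such that the following holds. Let $\mathcal A$ be an allotment of $n$ demand nodes to $k$ service centers that induces no negative cost loop, let a new demand node with its costs be given, and let $s_j$ be any service center. Started in any memory that stores $\mathcal A$ and contains the index $j$, the program halts after at most $C\,(k^3+k^2\lfloor\log_2 n\rfloor)$ steps (with $\lfloor\log_2 0\rfloor$ read as $0$) in a memory that stores an allotment $\mathcal B$ of all $n+1$ demand nodes which induces no negative cost loop. Moreover $\mathcal B$ arises from $\mathcal A$ by the following two-step insertion at $s_j$. 1. Put the new demand node into $s_j$, with $c_j$ increased by one and $q_j$ shifted by one unit to the right (so the penalty transfer weights do not change). If some simple loop that passes through $s_j$ has negative cost, remove one such loop of least cost. 2. Restore the original $c_j$ and $q_j$. If some simple loop that starts at $s_j$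 has negative cost, remove one such loop of least cost. -/

import Mathlib

namespace LBDD

/-! ### Instances, allotments and loops -/

/-- An instance of load balanced demand distribution with `n` demand nodes and `k` service centers.
`pen i m` is the penalty incurred when service center `i` receives its `m`-th demand node: it
vanishes up to the capacity, is positive beyond it, and is increasing. The numbers may be
integers, rationals or reals. -/
structure Problem (R : Type*) [CommRing R] [LinearOrder R] (n k : ℕ) where
  cost : Fin n → Fin k → R
  cap : Fin k → ℕ
  pen : Fin k → ℕ → R
  pen_zero : ∀ i m, m ≤ cap i → pen i m = 0
  pen_pos : ∀ i m, cap i < m → 0 < pen i m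
  pen_mono : ∀ i, Monotone (pen i)

/-- An allotment assigns every demand node to one service center. -/
abbrev Allotment (n k : ℕ) := Fin n → Fin k

/-- The number of demand nodes assigned to the service center `i`. -/
def occ {n k : ℕ} (A : Allotment n k) (i : Fin k) : ℕ :=
  (Finset.univ.filter fun d => A d = i).card

/-- A loop from `start` to `finish`. An entry `(d, w)` of `moves` stands for the edge that
transfers the demand node `d` from its current service center to `w`. The loop is closed by an
edge from `finish` to `start`: the transfer edge of the demand node `d` if `closing = some d`,
the penalty transfer edge if `closing = none`. -/
structure Loop (n k : ℕ) where
  start : Fin k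
  moves : List (Fin n × Fin k)
  finish : Fin k
  closing : Option (Fin n)

/-- The listed moves form a path from `u` to `v` in the allotment subspace multigraph of `A`,
whose edges from `u` to `w ≠ u` are the demand nodes assigned to `u`. -/
def IsPath {n k : ℕ} (A : Allotment n k) : Fin k → List (Fin n × Fin k) → Fin k → Prop
  | u, [], v => u = v
  | u, e :: es, v => A e.1 = u ∧ e.2 ≠ u ∧ IsPath A e.2 es v

namespace Loop

variable {n k : ℕ}

/-- The loop is induced by the allotment `A`. -/
def IsIn (L : Loop n k) (A : Allotment n k) : Prop :=
  IsPath A L.start L.moves L.finish ∧ L.finish ≠ L.start ∧ ∀ d ∈ L.closing, A d = L.finish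

/-- The service centers that the loop visits, in order. -/
def vertices (L : Loop n k) : List (Fin k) :=
  L.start :: L.moves.map Prod.snd

/-- No service center is visited twice. -/
def Simple (L : Loop n k) : Prop :=
  L.vertices.Nodup

/-- All transfers along the loop, including the closing edge if that is a transfer edge. -/
def transfers (L : Loop n k) : List (Fin n × Fin k) :=
  L.moves ++ (L.closing.map fun d => (d, L.start)).toList

/-- The allotment after the removal of the loop: each demand node on the loop is transferred. -/
def remove (L : Loop n k) (A : Allotment n k) : Allotment n k :=
  L.transfers.foldl (fun B e => Function.update B e.1 e.2) A

end Loop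

namespace Problem

variable {R : Type*} [CommRing R] [LinearOrder R] {n k : ℕ}

/-- The cost of the edge that transfers `d` from its service center in `A` to `w`. -/
def transferCost (I : Problem R n k) (A : Allotment n k) (d : Fin n) (w : Fin k) : R :=
  I.cost d w - I.cost d (A d)

/-- The weight of the penalty transfer edge from `i` to `j`: the change of the total penalty when
`i` receives and `j` gives away one demand node. -/
def penaltyTransfer (I : Problem R n k) (A : Allotment n k) (i j : Fin k) : R :=
  I.pen i (occ A i + 1) - I.pen j (occ A j)

/-- The total weight of the edges of a loop. -/
def loopCost (I : Problem R n k) (A : Allotment n k) (L : Loop n k) : R :=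
  (L.moves.map fun e => I.transferCost A e.1 e.2).sum +
    match L.closing with
    | some d => I.transferCost A d L.start
    | none => I.penaltyTransfer A L.finish L.start

/-- `A` induces no negative cost loop, simple or not. -/
def NoNegativeLoop (I : Problem R n k) (A : Allotment n k) : Prop :=
  ∀ L : Loop n k, L.IsIn A → 0 ≤ I.loopCost A L

/-- Among the simple loops induced by `A` that satisfy `P`, a loop of least cost is removed if its
cost is negative; otherwise nothing changes. The result is `B`. -/
def RemovesLeastLoop (I : Problem R n k) (P : Loop n k → Prop) (A B : Allotment n k) : Prop :=
  (∃ L : Loop n k, L.IsIn A ∧ L.Simple ∧ P L ∧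
      (∀ L' : Loop n k, L'.IsIn A → L'.Simple → P L' → I.loopCost A L ≤ I.loopCost A L') ∧
      I.loopCost A L < 0 ∧ B = L.remove A) ∨
    ((∀ L : Loop n k, L.IsIn A → L.Simple → P L → 0 ≤ I.loopCost A L) ∧ B = A)

/-- The instance without its last demand node. -/
def dropLast (I : Problem R (n + 1) k) : Problem R n k where
  cost d := I.cost d.castSucc
  cap := I.cap
  pen := I.pen
  pen_zero := I.pen_zero
  pen_pos := I.pen_pos
  pen_mono := I.pen_mono

/-- The instance in which the capacity of `s` is one larger and the penalty function of `s` is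
shifted by one unit to the right. -/
def raise (I : Problem R n k) (s : Fin k) : Problem R n k where
  cost := I.cost
  cap i := if i = s then I.cap i + 1 else I.cap i
  pen i m := if i = s then I.pen i (m - 1) else I.pen i m
  pen_zero i m h := by
    split_ifs at h ⊢
    · exact I.pen_zero i _ (by omega)
    · exact I.pen_zero i _ h
  pen_pos i m h := by
    split_ifs at h ⊢
    · exact I.pen_pos i _ (by omega)
    · exact I.pen_pos i _ h
  pen_mono i a b h := by
    dsimp only
    split_ifs
    · exact I.pen_mono i (Nat.sub_le_sub_right h 1)
    · exact I.pen_mono i h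

/-- The two-step insertion of the last demand node at the service center `s`. First the new node
is put into `s` while the penalties at `s` stay as if the occupancy of `s` had not changed, and
the least loop through `s` is removed if it is negative; then the occupancy of `s` is increased,
and the least loop that starts at `s` is removed if it is negative. -/
def TwoStepInsertion (I : Problem R (n + 1) k) (s : Fin k) (A : Allotment n k)
    (B : Allotment (n + 1) k) : Prop :=
  ∃ A' : Allotment (n + 1) k,
    (I.raise s).RemovesLeastLoop (fun L => s ∈ L.vertices) (Fin.snoc A s) A' ∧
    I.RemovesLeastLoop (fun L => L.start = s) A' B

end Problem

/-! ### A random access machine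

The memory consists of arrays of natural numbers and of arrays of elements of `R`, each cell being
addressed by the number of its array and three indices. The natural numbers can be added,
subtracted and halved, the elements of `R` added, subtracted and compared. The cost matrix and the
penalty functions are read-only. Every executed assignment and every evaluated test counts as one
step; as a program is fixed, the expressions in it have bounded size. -/

inductive NExp where
  | lit (c : ℕ)
  | get (a : ℕ) (i j l : NExp)
  | add (x y : NExp)
  | sub (x y : NExp)
  | half (x : NExp)

inductive VExp where
  | zero
  | get (a : ℕ) (i j l : NExp)
  | cost (d i : NExp)
  | pen (i m : NExp)
  | add (x y : VExp)
  | sub (x y : VExp)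

inductive BExp where
  | ltN (x y : NExp)
  | ltV (x y : VExp)
  | not (b : BExp)
  | and (b c : BExp)

inductive Cmd where
  | skip
  | setN (a : ℕ) (i j l : NExp) (x : NExp)
  | setV (a : ℕ) (i j l : NExp) (x : VExp)
  | seq (c d : Cmd)
  | cond (b : BExp) (c d : Cmd)
  | loop (b : BExp) (c : Cmd)

structure Mem (R : Type*) where
  nat : ℕ → ℕ → ℕ → ℕ → ℕ
  val : ℕ → ℕ → ℕ → ℕ → R

namespace Mem

variable {R : Type*}

def setNat (σ : Mem R) (a i j l x : ℕ) : Mem R where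
  nat a' i' j' l' := if a' = a ∧ i' = i ∧ j' = j ∧ l' = l then x else σ.nat a' i' j' l'
  val := σ.val

def setVal (σ : Mem R) (a i j l : ℕ) (x : R) : Mem R where
  nat := σ.nat
  val a' i' j' l' := if a' = a ∧ i' = i ∧ j' = j ∧ l' = l then x else σ.val a' i' j' l'

end Mem

section Semantics

variable {R : Type*} [CommRing R] [LinearOrder R] {n k : ℕ}

def NExp.eval (σ : Mem R) : NExp → ℕ
  | lit c => c
  | get a i j l => σ.nat a (i.eval σ) (j.eval σ) (l.eval σ)
  | add x y => x.eval σ + y.eval σ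
  | sub x y => x.eval σ - y.eval σ
  | half x => x.eval σ / 2

/-- The entry of the cost matrix in row `d` and column `i`, zero outside the matrix. -/
def Problem.costAt (I : Problem R n k) (d i : ℕ) : R :=
  if h : d < n ∧ i < k then I.cost ⟨d, h.1⟩ ⟨i, h.2⟩ else 0

/-- The `m`-th penalty of the service center number `i`, zero if there is no such center. -/
def Problem.penAt (I : Problem R n k) (i m : ℕ) : R :=
  if h : i < k then I.pen ⟨i, h⟩ m else 0

def VExp.eval (I : Problem R n k) (σ : Mem R) : VExp → R
  | zero => 0
  | get a i j l => σ.val a (i.eval σ) (j.eval σ) (l.eval σ)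
  | cost d i => I.costAt (d.eval σ) (i.eval σ)
  | pen i m => I.penAt (i.eval σ) (m.eval σ)
  | add x y => x.eval I σ + y.eval I σ
  | sub x y => x.eval I σ - y.eval I σ

def BExp.eval (I : Problem R n k) (σ : Mem R) : BExp → Prop
  | ltN x y => x.eval σ < y.eval σ
  | ltV x y => x.eval I σ < y.eval I σ
  | not b => ¬ b.eval I σ
  | and b c => b.eval I σ ∧ c.eval I σ

/-- `Exec I c σ τ t`: on the input `I`, the program `c` started in the memory `σ` halts after
exactly `t` steps in the memory `τ`. -/
inductive Exec (I : Problem R n k) : Cmd → Mem R → Mem R → ℕ → Prop where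
  | skip (σ : Mem R) : Exec I Cmd.skip σ σ 1
  | setN (σ : Mem R) (a : ℕ) (i j l x : NExp) :
      Exec I (Cmd.setN a i j l x) σ
        (σ.setNat a (i.eval σ) (j.eval σ) (l.eval σ) (x.eval σ)) 1
  | setV (σ : Mem R) (a : ℕ) (i j l : NExp) (x : VExp) :
      Exec I (Cmd.setV a i j l x) σ
        (σ.setVal a (i.eval σ) (j.eval σ) (l.eval σ) (x.eval I σ)) 1
  | seq {c d : Cmd} {σ τ υ : Mem R} {s t : ℕ} :
      Exec I c σ τ s → Exec I d τ υ t → Exec I (Cmd.seq c d) σ υ (s + t)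
  | condTrue {b : BExp} {c d : Cmd} {σ τ : Mem R} {t : ℕ} :
      b.eval I σ → Exec I c σ τ t → Exec I (Cmd.cond b c d) σ τ (t + 1)
  | condFalse {b : BExp} {c d : Cmd} {σ τ : Mem R} {t : ℕ} :
      ¬ b.eval I σ → Exec I d σ τ t → Exec I (Cmd.cond b c d) σ τ (t + 1)
  | loopTrue {b : BExp} {c : Cmd} {σ τ υ : Mem R} {s t : ℕ} :
      b.eval I σ → Exec I c σ τ s → Exec I (Cmd.loop b c) τ υ t →
        Exec I (Cmd.loop b c) σ υ (s + t + 1)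
  | loopFalse {b : BExp} {c : Cmd} {σ : Mem R} :
      ¬ b.eval I σ → Exec I (Cmd.loop b c) σ σ 1

end Semantics

/-! ### The data structure that is maintained -/

section Storage

variable {R : Type*} [CommRing R] [LinearOrder R] {n k : ℕ}

/-- The memory `σ` holds the allotment `A`: the number of service centers (array 0), the number of
demand nodes (array 1), the service center of every demand node (array 2), the occupancies
(array 3), and for every ordered pair of service centers `i ≠ j` a binary min-heap, with root at
position 0, of the demand nodes assigned to `i`, keyed by their transfer costs to `j`. Array 4
gives the demand node at position `p` of the heap of `(i, j)` in the cell `(i, j, p)`; array 5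
gives in the cell `(j, d, 0)` the position of `d` in the heap of `(A d, j)`. All other
cells are arbitrary. -/
structure Stores (I : Problem R n k) (A : Allotment n k) (σ : Mem R) : Prop where
  centers : σ.nat 0 0 0 0 = k
  nodes : σ.nat 1 0 0 0 = n
  assigned : ∀ d : Fin n, σ.nat 2 d 0 0 = A d
  occupancy : ∀ i : Fin k, σ.nat 3 i 0 0 = occ A i
  position : ∀ (d : Fin n) (j : Fin k), j ≠ A d →
    σ.nat 5 j d 0 < occ A (A d) ∧ σ.nat 4 (A d) j (σ.nat 5 j d 0) = d
  ordered : ∀ (d e : Fin n) (j : Fin k), A d = A e → j ≠ A e → 0 < σ.nat 5 j e 0 →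
    σ.nat 5 j d 0 = (σ.nat 5 j e 0 - 1) / 2 → I.transferCost A d j ≤ I.transferCost A e j

end Storage

end LBDD

set_option linter.unusedSectionVars false

/-! Optimality is certified by prices, as in linear programming duality. Prices (`IsPrice`) make
every demand node content with its service center and lie between the penalties of the last and of
the next demand node there. Along a loop prices telescope, so their existence excludes negative
loops (`IsPrice.noNegativeLoop`). Conversely, without negative loops, let the price of `u` be the
least cost of a path of transfers from `u` to some center `f` plus the penalty of one more demand
node at `f`. Closing that path by the penalty transfer edge gives the missing lower bound on the
price (`NoNegativeLoop.exists_isPrice`). To treat both kinds of loops as closed walks in one graph,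
`arc` keeps the cheapest transfer between two centers and routes all penalty edges through an
additional vertex `none`.

Step 1. The raised penalties conceal the new demand node `d₀`, so the old prices still fit, except
that `d₀` may not be content at `s`. Without `d₀` the graph has no negative closed walk; let `π` be
the distances to `s` in it. A shortest closed walk through `s` of weight `c < 0` must begin with
`d₀`, and its other arcs are tight for `π`. Transfers along tight arcs preserve contentment, `d₀`
becomes content by minimality of `c`, and tightness of the arcs at `none` gives the penalty bounds
where the occupancy changes. Hence `π`, shifted by a constant, is a price system for the new
allotment. It also shows that no simple loop costs less than `c`, because a simple loop leaves `s`
at most once (`loopCost_ge`, `removesLeastLoop_of_neg`).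

Step 2. Restoring the penalties at `s` can break a single inequality, the lower bound on the price
of `s`. The distances `g` to `none`, along walks that never leave `none`, satisfy all the others. If
`g s` reaches the penalty of the last demand node at `s`, then `g` is a price system. Otherwise a
shortest walk from `s` to `none`, closed by the penalty edge, is a least loop that starts at `s`;
its removal lowers the occupancy of `s` by one, which puts `g s` into the correct interval
(`exists_outDistance_of_raise`, `removesLeastLoop_start_of_lt`).

Both walks come from the Bellman–Ford algorithm, with intermediate vertices different from `s` and
from the target: the whole graph may have negative closed walks, but those inside the remaining
vertices are nonnegative. A predecessor is recorded only at a strict decrease, so the traced walk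
has as few vertices as its weight allows and is therefore duplicate-free, even if there are cycles
of weight zero (`BellmanFord.traceBack_nodup`).

For the running time, arc weights are read off the heap roots in quadratic time, and `k` rounds over
`(k + 1) ^ 2` arcs are cubic. A walk has at most `k + 1` arcs; each moves at most one demand node,
which changes at most two heaps for each of `k` columns at logarithmic cost. -/

namespace LBDD

/-! ### Walks in weighted graphs -/

section Walk

variable {V M : Type*}

/-- The weight of the walk from `a` to `b` with the intermediate vertices `l`. -/
def walkWeight [Add M] (w : V → V → M) : V → List V → V → M
  | a, [], b => w a b
  | a, x :: l, b => w a x + walkWeight w x l b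

theorem walkWeight_append [AddCommMonoid M] (w : V → V → M) (a b x : V) (l l' : List V) :
    walkWeight w a (l ++ x :: l') b = walkWeight w a l x + walkWeight w x l' b := by
  induction l generalizing a with
  | nil => rfl
  | cons y l ih => simp [walkWeight, ih, add_assoc]

variable [AddCommMonoid M] [LinearOrder M] [IsOrderedAddMonoid M]

/-- Between two visits to the same intermediate vertex lies a closed walk inside `U`, which can be
cut out. The ends `a` and `b` take no part in this, so a negative closed walk from `s` to `s` is
shortened correctly although `s` lies outside `U`. -/
theorem exists_nodup_walk (w : V → V → M) (U : V → Prop)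
    (hU : ∀ x l, U x → (∀ y ∈ l, U y) → 0 ≤ walkWeight w x l x) (a b : V) (l : List V)
    (hl : ∀ y ∈ l, U y) :
    ∃ l', l'.Sublist l ∧ l'.Nodup ∧ walkWeight w a l' b ≤ walkWeight w a l b := by
  induction l generalizing a with
  | nil => exact ⟨[], List.Sublist.refl _, List.nodup_nil, le_rfl⟩
  | cons x l ih =>
    obtain ⟨l', hs, hn, hle⟩ := ih x fun y hy => hl y (List.mem_cons_of_mem _ hy)
    by_cases hx : x ∈ l'
    · obtain ⟨l₁, l₂, rfl⟩ := List.append_of_mem hx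
      refine ⟨x :: l₂, ?_, (List.nodup_append.1 hn).2.1, ?_⟩
      · exact ((List.sublist_append_right _ _).trans hs).trans (List.sublist_cons_self _ _)
      · rw [walkWeight_append] at hle
        refine add_le_add le_rfl (le_trans ?_ hle)
        refine le_add_of_nonneg_left (hU x l₁ (hl x (by simp)) fun y hy => hl y ?_)
        exact List.mem_cons_of_mem _ (hs.subset (List.mem_append_left _ hy))
    · exact ⟨x :: l', hs.cons_cons x, List.nodup_cons.2 ⟨hx, hn⟩, add_le_add le_rfl hle⟩

end Walk

/-! ### Potentials and distances to a target -/

section Distance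

variable {V R : Type*} [CommRing R] [LinearOrder R] [IsStrictOrderedRing R]
  (w : V → V → WithTop R)

/-- The inequalities telescope. They are needed only at vertices that the walk leaves, so a
potential that fails at avoided vertices is still of use. -/
theorem le_walkWeight_add (φ : V → R) (a b : V) (l : List V)
    (h : ∀ u ∈ a :: l, ∀ x, (φ u : WithTop R) ≤ w u x + φ x) :
    (φ a : WithTop R) ≤ walkWeight w a l b + φ b := by
  induction l generalizing a with
  | nil => exact h a (by simp) b
  | cons x l ih =>
    have h₁ := h a (by simp) x
    have h₂ := ih x fun u hu => h u (List.mem_cons_of_mem _ hu)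
    calc (φ a : WithTop R) ≤ w a x + φ x := h₁
      _ ≤ w a x + (walkWeight w x l b + φ b) := add_le_add le_rfl h₂
      _ = _ := by rw [walkWeight, add_assoc]

theorem walkWeight_closed_nonneg (φ : V → R) (a : V) (l : List V)
    (h : ∀ u ∈ a :: l, ∀ x, (φ u : WithTop R) ≤ w u x + φ x) :
    0 ≤ walkWeight w a l a := by
  have := le_walkWeight_add w φ a a l h
  cases hw : walkWeight w a l a with
  | top => exact le_top
  | coe c =>
    rw [hw, ← WithTop.coe_add, WithTop.coe_le_coe] at this
    exact WithTop.coe_nonneg.2 (by linarith)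

/-- A walk whose weight equals the difference of the potentials of its ends consists of arcs with
the same property. -/
theorem tight_of_walkWeight_le (φ : V → R) (a b : V) (l : List V)
    (h : ∀ u ∈ a :: l, ∀ x, (φ u : WithTop R) ≤ w u x + φ x)
    (hl : walkWeight w a l b + φ b ≤ φ a) (u v : V)
    (huv : [u, v] <:+: a :: (l ++ [b])) : w u v + φ v = φ u := by
  induction l generalizing a with
  | nil =>
    have : u = a ∧ v = b := by
      have := huv.eq_of_length (by simp)
      simpa using this
    obtain ⟨rfl, rfl⟩ := this
    exact le_antisymm hl (h u (by simp) v)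
  | cons x l ih =>
    have h₁ := h a (by simp) x
    have h₂ := le_walkWeight_add w φ x b l fun u hu => h u (List.mem_cons_of_mem _ hu)
    rw [walkWeight] at hl
    have hx : w a x ≠ ⊤ := by
      intro h'; rw [h'] at hl; simp at hl
    have hy : walkWeight w x l b ≠ ⊤ := by
      intro h'; rw [h'] at hl; simp at hl
    lift w a x to R using hx with c hc
    lift walkWeight w x l b to R using hy with e he
    norm_cast at h₁ h₂ hl
    rcases List.infix_cons_iff.1 huv with h' | h'
    · obtain ⟨r, hr⟩ := h'
      simp only [List.cons_append, List.nil_append, List.cons.injEq] at hr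
      obtain ⟨rfl, rfl, -⟩ := hr
      rw [← hc]; norm_cast; linarith
    · refine ih x (fun u hu => h u (List.mem_cons_of_mem _ hu)) ?_ h'
      rw [← he]; norm_cast; linarith

/-- Distances to a target that can be reached from everywhere, in a graph without negative closed
walks. -/
theorem exists_distance [Finite V] (t : V) (htt : w t t = 0)
    (hw : ∀ x l, 0 ≤ walkWeight w x l x) (hfin : ∀ v, ∃ l, walkWeight w v l t ≠ ⊤) :
    ∃ φ : V → R, φ t = 0 ∧ (∀ u x, (φ u : WithTop R) ≤ w u x + φ x) ∧
      ∀ v, v ≠ t → ∃ l, t ∉ l ∧ walkWeight w v l t = φ v := by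
  classical
  have := Fintype.ofFinite V
  have : Nonempty {l : List V // l.Nodup} := ⟨⟨[], List.nodup_nil⟩⟩
  have hmin : ∀ v, ∃ l : List V, ∀ l', walkWeight w v l t ≤ walkWeight w v l' t := by
    intro v
    -- There are finitely many duplicate-free lists, and every walk can be shortened to one of them
    -- without becoming heavier.
    obtain ⟨⟨l, hl⟩, h⟩ := Finite.exists_min
      fun l : {l : List V // l.Nodup} => walkWeight w v l.1 t
    refine ⟨l, fun l' => ?_⟩
    obtain ⟨l₁, -, hn, hle⟩ := exists_nodup_walk w (fun _ => True) (fun x l _ _ => hw x l) v t l'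
      (by simp)
    exact (h ⟨l₁, hn⟩).trans hle
  choose L hL using hmin
  have hne : ∀ v, walkWeight w v (L v) t ≠ ⊤ := fun v h => by
    obtain ⟨l, hl⟩ := hfin v
    exact hl (top_le_iff.1 (h ▸ hL v l))
  have hco : ∀ v, ((walkWeight w v (L v) t).untop (hne v) : WithTop R) = walkWeight w v (L v) t :=
    fun v => WithTop.coe_untop _ _
  refine ⟨fun v => (walkWeight w v (L v) t).untop (hne v), ?_, fun u x => ?_, fun v hv => ?_⟩
  · have : walkWeight w t (L t) t = 0 :=
      le_antisymm ((hL t []).trans_eq htt) (hw _ _)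
    rw [← WithTop.coe_inj, hco, this]; rfl
  · rw [hco, hco]
    exact hL u (x :: L x)
  · rw [hco]
    by_cases ht : t ∈ L v
    -- The walk is cut at its first visit to `t`; what follows is a closed walk at `t` of
    -- nonnegative weight.
    · obtain ⟨l₁, l₂, h, hn⟩ := List.eq_append_cons_of_mem ht
      refine ⟨l₁, hn, le_antisymm ?_ (hL v _)⟩
      rw [h, walkWeight_append]
      exact le_add_of_nonneg_right (hw _ _)
    · exact ⟨L v, ht, rfl⟩

end Distance

/-! ### Shortest walks by rounds of relaxations -/

section BellmanFord

variable {V R : Type*} [CommRing R] [LinearOrder R] [IsStrictOrderedRing R]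

/-- `S m v` is computed as the least weight of a walk from `s` to `v` with at most `m`
intermediate vertices, all of them in `U`; if a round of relaxations decreases the value at `v`,
then `Q` holds the last intermediate vertex. -/
structure BellmanFord (w : V → V → WithTop R) (U : V → Prop) (s : V) (N : ℕ) (S : ℕ → V → R)
    (Q : ℕ → V → Option V) : Prop where
  zero : ∀ v, (S 0 v : WithTop R) = w s v
  mono : ∀ m < N, ∀ v, S (m + 1) v ≤ S m v
  relax : ∀ m < N, ∀ v u, U u → (S (m + 1) v : WithTop R) ≤ S m u + w u v
  keep : ∀ m < N, ∀ v, Q (m + 1) v = none → S (m + 1) v = S m v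
  improve : ∀ m < N, ∀ v u, Q (m + 1) v = some u →
    U u ∧ (S (m + 1) v : WithTop R) = S m u + w u v ∧ S (m + 1) v < S m v

/-- The intermediate vertices of the walk that is encoded in the predecessors `Q`. -/
def traceBack (Q : ℕ → V → Option V) : ℕ → V → List V
  | 0, _ => []
  | m + 1, v =>
    match Q (m + 1) v with
    | none => traceBack Q m v
    | some u => traceBack Q m u ++ [u]

namespace BellmanFord

variable {w : V → V → WithTop R} {U : V → Prop} {s : V} {N : ℕ} {S : ℕ → V → R}
  {Q : ℕ → V → Option V}

/-- By induction on the round: the last intermediate vertex of the walk is one of those relaxed, and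
the part before it is covered by the previous round. -/
theorem le_walkWeight (h : BellmanFord w U s N S Q) {m : ℕ} (hm : m ≤ N) (v : V) (l : List V)
    (hl : ∀ y ∈ l, U y) (hlen : l.length ≤ m) : (S m v : WithTop R) ≤ walkWeight w s l v := by
  induction m generalizing v l with
  | zero =>
    obtain rfl := List.eq_nil_of_length_eq_zero (Nat.le_zero.1 hlen)
    exact (h.zero v).le
  | succ m ih =>
    rcases List.eq_nil_or_concat l with rfl | ⟨l', u, rfl⟩
    · exact le_trans (WithTop.coe_le_coe.2 (h.mono m (by omega) v))
        (ih (by omega) v [] (by simp) (by simp))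
    · rw [List.concat_eq_append, walkWeight_append]
      simp only [List.concat_eq_append, List.length_append, List.length_singleton,
        List.mem_append, List.mem_singleton] at hlen hl
      refine (h.relax m (by omega) v u (hl u (Or.inr rfl))).trans (add_le_add ?_ le_rfl)
      exact ih (by omega) u l' (fun y hy => hl y (Or.inl hy)) (by omega)

/-- The last clause is what makes the trace simple later. Since `Q` is set only at a strict
decrease, a walk with fewer intermediate vertices cannot be as light as the traced one. -/
theorem traceBack_spec (h : BellmanFord w U s N S Q) {m : ℕ} (hm : m ≤ N) (v : V) :
    (∀ y ∈ traceBack Q m v, U y) ∧ (traceBack Q m v).length ≤ m ∧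
      walkWeight w s (traceBack Q m v) v = S m v ∧
      ∀ l, (∀ y ∈ l, U y) → walkWeight w s l v ≤ S m v → (traceBack Q m v).length ≤ l.length := by
  induction m generalizing v with
  | zero => simp [traceBack, walkWeight, h.zero]
  | succ m ih =>
    cases hQ : Q (m + 1) v with
    | none =>
      have hS := h.keep m (by omega) v hQ
      simp only [traceBack, hQ, hS]
      obtain ⟨h₁, h₂, h₃, h₄⟩ := ih (by omega) v
      exact ⟨h₁, by omega, h₃, h₄⟩
    | some u =>
      obtain ⟨hu, hS, hlt⟩ := h.improve m (by omega) v u hQ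
      obtain ⟨h₁, h₂, h₃, h₄⟩ := ih (by omega) u
      simp only [traceBack, hQ]
      refine ⟨?_, by simpa using h₂, ?_, fun l hl hle => ?_⟩
      · intro y hy
        rcases List.mem_append.1 hy with hy | hy
        · exact h₁ y hy
        · rw [List.mem_singleton.1 hy]; exact hu
      · rw [walkWeight_append, h₃, hS]; rfl
      -- A walk this short would already have been accounted for in round `m`, contrary to the
      -- strict decrease.
      · have : ¬ l.length ≤ m := fun hlen => by
          have := (h.le_walkWeight (by omega) v l hl hlen).trans hle
          exact absurd (WithTop.coe_le_coe.1 this) (not_le.2 hlt)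
        simp only [List.length_append, List.length_singleton]
        omega

/-- Removing a repetition would give a walk that is no heavier but has fewer vertices, against the
minimal length of the trace. Mere minimality of the weight would not exclude cycles of weight zero.
-/
theorem traceBack_nodup (h : BellmanFord w U s N S Q)
    (hU : ∀ x l, U x → (∀ y ∈ l, U y) → 0 ≤ walkWeight w x l x) (v : V) :
    (traceBack Q N v).Nodup := by
  obtain ⟨h₁, h₂, h₃, h₄⟩ := h.traceBack_spec le_rfl v
  obtain ⟨l', hs, hn, hle⟩ := exists_nodup_walk w U hU s v _ h₁
  have := h₄ l' (fun y hy => h₁ y (hs.subset hy)) (hle.trans_eq h₃)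
  rwa [← hs.eq_of_length_le this]

/-- A duplicate-free list in `U` misses `s`, hence has at most `N` entries: as many rounds suffice
as there are vertices other than `s`. -/
theorem le_walkWeight_of_card [Fintype V] (h : BellmanFord w U s N S Q)
    (hU : ∀ x l, U x → (∀ y ∈ l, U y) → 0 ≤ walkWeight w x l x) (hs : ¬ U s)
    (hN : Fintype.card V ≤ N + 1) (v : V) (l : List V) (hl : ∀ y ∈ l, U y) :
    (S N v : WithTop R) ≤ walkWeight w s l v := by
  obtain ⟨l', hsub, hn, hle⟩ := exists_nodup_walk w U hU s v _ hl
  refine (h.le_walkWeight le_rfl v l' (fun y hy => hl y (hsub.subset hy)) ?_).trans hle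
  have hn' : (s :: l').Nodup :=
    List.nodup_cons.2 ⟨fun hm => hs (hl s (hsub.subset hm)), hn⟩
  have := hn'.length_le_card
  simp only [List.length_cons] at this
  omega

end BellmanFord

end BellmanFord

end LBDD

namespace LBDD

variable {R : Type*} [CommRing R] [LinearOrder R] {n k : ℕ}

/-! ### Paths of transfer edges -/

theorem isPath_append {A : Allotment n k} {u v : Fin k} {l l' : List (Fin n × Fin k)} :
    IsPath A u (l ++ l') v ↔ ∃ w, IsPath A u l w ∧ IsPath A w l' v := by
  induction l generalizing u with
  | nil => simp [IsPath]
  | cons e l ih => simp [IsPath, ih]; tauto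

namespace Problem

/-- The total cost of a list of transfers. -/
def transferSum (I : Problem R n k) (A : Allotment n k) (l : List (Fin n × Fin k)) : R :=
  (l.map fun e => I.transferCost A e.1 e.2).sum

@[simp] theorem transferSum_nil (I : Problem R n k) (A : Allotment n k) :
    I.transferSum A [] = 0 := rfl

@[simp] theorem transferSum_cons (I : Problem R n k) (A : Allotment n k) (e : Fin n × Fin k)
    (l : List (Fin n × Fin k)) :
    I.transferSum A (e :: l) = I.transferCost A e.1 e.2 + I.transferSum A l := by
  simp [transferSum]

@[simp] theorem transferSum_append (I : Problem R n k) (A : Allotment n k)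
    (l l' : List (Fin n × Fin k)) :
    I.transferSum A (l ++ l') = I.transferSum A l + I.transferSum A l' := by
  simp [transferSum]

variable [IsStrictOrderedRing R]

/-- With the prices `p` at the service centers, `d` is assigned to a cheapest one. -/
def Content (I : Problem R n k) (A : Allotment n k) (p : Fin k → R) (d : Fin n) : Prop :=
  ∀ x, I.cost d (A d) + p (A d) ≤ I.cost d x + p x

/-- Equilibrium prices: every demand node is content, and the price of a service center lies
between the penalties of its last and of its next demand node. -/
structure IsPrice (I : Problem R n k) (A : Allotment n k) (p : Fin k → R) : Prop where
  content : ∀ d, I.Content A p d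
  le_price : ∀ u, I.pen u (occ A u) ≤ p u
  price_le : ∀ u, p u ≤ I.pen u (occ A u + 1)

/-- Contentment bounds the cost of each transfer from below by the drop of the price along it, and
the drops telescope. Only the demand nodes on the path have to be content. -/
theorem sub_le_transferSum {I : Problem R n k} {A : Allotment n k} {p : Fin k → R} {u v : Fin k}
    {l : List (Fin n × Fin k)} (hl : IsPath A u l v) (h : ∀ e ∈ l, I.Content A p e.1) :
    p u - p v ≤ I.transferSum A l := by
  induction l generalizing u with
  | nil => obtain rfl : u = v := hl; simp
  | cons e l ih =>
    obtain ⟨rfl, -, hl⟩ := hl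
    have h₁ := ih hl fun e he => h e (List.mem_cons_of_mem _ he)
    have h₂ := h e (by simp) e.2
    simp only [transferSum_cons, transferCost]
    linarith

/-- The easy half of the duality: the path costs at least `p a - p f`, and either kind of closing
edge costs at least `p f - p a`. -/
theorem IsPrice.noNegativeLoop {I : Problem R n k} {A : Allotment n k} {p : Fin k → R}
    (h : I.IsPrice A p) : I.NoNegativeLoop A := by
  rintro ⟨a, l, f, c⟩ ⟨hp, -, hc⟩
  have h₁ := sub_le_transferSum hp fun e _ => h.content e.1
  simp only [loopCost]
  change 0 ≤ I.transferSum A l + _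
  cases c with
  | none =>
    have h₂ := h.le_price a
    have h₃ := h.price_le f
    simp only [penaltyTransfer] at *
    linarith
  | some d =>
    have hd : A d = f := hc d rfl
    have h₂ := h.content d a
    simp only [transferCost, hd] at *
    linarith

/-! ### The graph of cheapest edges

The service centers are the vertices `some i`; a penalty transfer edge is split by the additional
vertex `none`. -/

/-- The least weight of an edge from one vertex to another, where only the demand nodes in `D` may
be transferred. -/
def arc (I : Problem R n k) (A : Allotment n k) (D : Finset (Fin n)) :
    Option (Fin k) → Option (Fin k) → WithTop R
  | none, none => 0
  | none, some x => ((-I.pen x (occ A x) : R) : WithTop R)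
  | some u, none => ((I.pen u (occ A u + 1) : R) : WithTop R)
  | some u, some x =>
    if u = x then 0
    else (D.filter (A · = u)).inf fun d => ((I.transferCost A d x : R) : WithTop R)

theorem arc_self (I : Problem R n k) (A : Allotment n k) (D : Finset (Fin n))
    (u : Option (Fin k)) : I.arc A D u u = 0 := by
  cases u <;> simp [arc]

theorem arc_le {I : Problem R n k} {A : Allotment n k} {D : Finset (Fin n)} {d : Fin n}
    (hd : d ∈ D) (x : Fin k) :
    I.arc A D (some (A d)) (some x) ≤ ((I.transferCost A d x : R) : WithTop R) := by
  simp only [arc]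
  split_ifs with h
  · simp [transferCost, h]
  · exact Finset.inf_le (f := fun d => ((I.transferCost A d x : R) : WithTop R))
      (Finset.mem_filter.2 ⟨hd, rfl⟩)

theorem exists_arc_eq {I : Problem R n k} {A : Allotment n k} {D : Finset (Fin n)} {u x : Fin k}
    (hux : u ≠ x) (h : I.arc A D (some u) (some x) ≠ ⊤) :
    ∃ d ∈ D, A d = u ∧ I.arc A D (some u) (some x) = ((I.transferCost A d x : R) : WithTop R) := by
  simp only [arc, if_neg hux] at h ⊢
  have hne : (D.filter (A · = u)).Nonempty := by
    rw [Finset.nonempty_iff_ne_empty]; rintro h'; simp [h'] at h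
  obtain ⟨d, hd, he⟩ := Finset.exists_mem_eq_inf _ hne
    fun d => ((I.transferCost A d x : R) : WithTop R)
  exact ⟨d, (Finset.mem_filter.1 hd).1, (Finset.mem_filter.1 hd).2, he⟩

theorem arc_anti (I : Problem R n k) (A : Allotment n k) {D D' : Finset (Fin n)} (h : D ⊆ D')
    (u x : Option (Fin k)) : I.arc A D' u x ≤ I.arc A D u x := by
  rcases u with _ | u <;> rcases x with _ | x <;> simp only [arc, le_refl]
  split_ifs
  · exact le_rfl
  · exact Finset.inf_mono (Finset.filter_subset_filter _ h)

/-- Contentment of the demand nodes in `D` at `u` is exactly the potential inequality for the arcs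
from `u` to other centers. It is stated for one tail `u`, since in the applications a single center
may violate it. -/
theorem le_arc_some {I : Problem R n k} {A : Allotment n k} {D : Finset (Fin n)}
    {φ : Option (Fin k) → R} {u : Fin k}
    (hD : ∀ d ∈ D, A d = u → I.Content A (fun v => φ (some v)) d)
    (hu : φ (some u) ≤ I.pen u (occ A u + 1) + φ none) (x : Option (Fin k)) :
    (φ (some u) : WithTop R) ≤ I.arc A D (some u) x + φ x := by
  rcases x with _ | x
  · simp only [arc]; exact_mod_cast hu
  · by_cases hux : u = x
    · subst hux; simp [arc_self]
    by_cases h : I.arc A D (some u) (some x) = ⊤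
    · rw [h]; simp
    · obtain ⟨d, hd, rfl, he⟩ := exists_arc_eq hux h
      rw [he]
      have := hD d hd rfl x
      norm_cast
      simp only [transferCost] at *
      linarith

theorem le_arc_none {I : Problem R n k} {A : Allotment n k} {D : Finset (Fin n)}
    {φ : Option (Fin k) → R} (h : ∀ u, φ none ≤ -I.pen u (occ A u) + φ (some u))
    (x : Option (Fin k)) : (φ none : WithTop R) ≤ I.arc A D none x + φ x := by
  rcases x with _ | x
  · simp [arc]
  · simp only [arc]; exact_mod_cast h x

/-- A potential of the graph yields contentment. -/
theorem content_of_le_arc {I : Problem R n k} {A : Allotment n k} {D : Finset (Fin n)}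
    {φ : Option (Fin k) → R} {d : Fin n} (hd : d ∈ D)
    (h : ∀ x, (φ (some (A d)) : WithTop R) ≤ I.arc A D (some (A d)) x + φ x) :
    I.Content A (fun v => φ (some v)) d := by
  intro x
  have := (h (some x)).trans (add_le_add (arc_le hd x) le_rfl)
  norm_cast at this
  simp only [transferCost] at this
  linarith

/-- The graph without the edges that leave the additional vertex. -/
def innerArc (I : Problem R n k) (A : Allotment n k) :
    Option (Fin k) → Option (Fin k) → WithTop R
  | none, none => 0
  | none, some _ => ⊤
  | some u, x => I.arc A Finset.univ (some u) x

/-- In this graph `none` is a sink: apart from its own loop of weight zero, all arcs out of it are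
infinite. -/
theorem innerArc_walk_none (I : Problem R n k) (A : Allotment n k) (l : List (Option (Fin k)))
    (b : Option (Fin k)) :
    walkWeight (I.innerArc A) none l b = 0 ∨ walkWeight (I.innerArc A) none l b = ⊤ := by
  induction l with
  | nil => cases b <;> simp [walkWeight, innerArc]
  | cons x l ih => cases x <;> simp [walkWeight, innerArc, ih]

theorem innerArc_walk_none_some (I : Problem R n k) (A : Allotment n k)
    (l : List (Option (Fin k))) (b : Fin k) :
    walkWeight (I.innerArc A) none l (some b) = ⊤ := by
  induction l with
  | nil => simp [walkWeight, innerArc]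
  | cons x l ih => cases x <;> simp [walkWeight, innerArc, ih]

/-- A finite walk between centers cannot meet the sink `none`, so each of its arcs is a transfer
edge or a trivial arc of weight zero, which is dropped. -/
theorem exists_path_of_innerArc {I : Problem R n k} {A : Allotment n k} {u v : Fin k}
    {l : List (Option (Fin k))} (h : walkWeight (I.innerArc A) (some u) l (some v) ≠ ⊤) :
    ∃ es, IsPath A u es v ∧
      walkWeight (I.innerArc A) (some u) l (some v) = ((I.transferSum A es : R) : WithTop R) := by
  have key : ∀ u x : Fin k, I.innerArc A (some u) (some x) ≠ ⊤ → ∃ es, IsPath A u es x ∧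
      I.innerArc A (some u) (some x) = ((I.transferSum A es : R) : WithTop R) := by
    intro u x h
    simp only [innerArc] at h ⊢
    by_cases hux : u = x
    · exact ⟨[], hux, by simp [hux, arc_self]⟩
    · obtain ⟨d, -, hd, he⟩ := exists_arc_eq hux h
      exact ⟨[(d, x)], ⟨hd, Ne.symm hux, rfl⟩, by simp [he]⟩
  induction l generalizing u with
  | nil => exact key u v h
  | cons x l ih =>
    rcases x with _ | x
    · simp [walkWeight, innerArc_walk_none_some] at h
    · simp only [walkWeight] at h ⊢
      rw [Ne, WithTop.add_eq_top, not_or] at h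
      obtain ⟨es, hes, he⟩ := key u x h.1
      obtain ⟨es', hes', he'⟩ := ih h.2
      refine ⟨es ++ es', isPath_append.2 ⟨x, hes, hes'⟩, ?_⟩
      rw [he, he', transferSum_append]
      norm_cast

/-- Distances to the additional vertex along paths that do not pass through it. -/
theorem exists_outDistance {I : Problem R n k} {A : Allotment n k}
    (h : ∀ u es, IsPath A u es u → 0 ≤ I.transferSum A es) :
    ∃ g : Fin k → R, (∀ d, I.Content A g d) ∧ (∀ u, g u ≤ I.pen u (occ A u + 1)) ∧
      ∀ u, ∃ l, none ∉ l ∧ walkWeight (I.innerArc A) (some u) l none = g u := by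
  obtain ⟨φ, h₀, h₁, h₂⟩ := exists_distance (I.innerArc A) none rfl
    (fun x l => by
      rcases x with _ | x
      · rcases I.innerArc_walk_none A l none with h | h <;> simp [h]
      · by_cases ht : walkWeight (I.innerArc A) (some x) l (some x) = ⊤
        · simp [ht]
        · obtain ⟨es, hes, he⟩ := exists_path_of_innerArc ht
          rw [he]
          exact WithTop.coe_nonneg.2 (h x es hes))
    (fun v => ⟨[], by cases v <;> simp [walkWeight, innerArc, arc]⟩)
  refine ⟨fun u => φ (some u), fun d => ?_, fun u => ?_, fun u => h₂ (some u) (by simp)⟩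
  · exact content_of_le_arc (D := Finset.univ) (Finset.mem_univ d) fun x => h₁ (some (A d)) x
  · have := h₁ (some u) none
    simp only [innerArc, arc, h₀] at this
    norm_cast at this
    simpa using this

/-- The last edge of a nonempty closed path serves as the closing transfer edge of a loop. -/
theorem NoNegativeLoop.transferSum_nonneg {I : Problem R n k} {A : Allotment n k}
    (h : I.NoNegativeLoop A) {u : Fin k} {es : List (Fin n × Fin k)} (hes : IsPath A u es u) :
    0 ≤ I.transferSum A es := by
  rcases List.eq_nil_or_concat es with rfl | ⟨l, e, rfl⟩
  · simp
  · rw [List.concat_eq_append] at *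
    obtain ⟨v, h₁, h₂, h₃, h₄⟩ := isPath_append.1 hes
    have h₄ : e.2 = u := h₄
    have := h ⟨u, l, v, some e.1⟩ ⟨h₁, fun h => h₃ (h₄.trans h.symm), by simpa using h₂⟩
    simpa [loopCost, transferSum, h₄] using this

/-- The hard half of the duality. The distances to `none` satisfy all price conditions by
construction except the lower penalty bound. A shortest walk to `none` is a path to some center `f`
followed by a penalty, and closing it by a penalty transfer edge turns the missing bound into
nonnegativity of a loop. -/
theorem NoNegativeLoop.exists_isPrice {I : Problem R n k} {A : Allotment n k}
    (h : I.NoNegativeLoop A) : ∃ p, I.IsPrice A p := by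
  obtain ⟨g, h₁, h₂, h₃⟩ := exists_outDistance (I := I) (A := A) fun u es => h.transferSum_nonneg
  refine ⟨g, h₁, fun u => ?_, h₂⟩
  obtain ⟨l, hl, hw⟩ := h₃ u
  have key : ∃ f es, IsPath A u es f ∧ g u = I.transferSum A es + I.pen f (occ A f + 1) := by
    rcases List.eq_nil_or_concat l with rfl | ⟨l, x, rfl⟩
    · exact ⟨u, [], rfl, by simpa [walkWeight, innerArc, arc, eq_comm] using hw⟩
    · rw [List.concat_eq_append] at *
      rcases x with _ | f
      · simp at hl
      · rw [walkWeight_append] at hw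
        obtain ⟨es, hes, he⟩ := exists_path_of_innerArc
          (fun h : walkWeight (I.innerArc A) (some u) l (some f) = ⊤ => by simp [h] at hw)
        refine ⟨f, es, hes, ?_⟩
        rw [he] at hw
        simp only [walkWeight, innerArc, arc] at hw
        exact_mod_cast hw.symm
  obtain ⟨f, es, hes, hg⟩ := key
  rw [hg]
  -- There is no penalty transfer edge from a center to itself, so for `f = u` monotonicity of the
  -- penalties takes its place.
  by_cases hf : f = u
  · subst hf
    have h₁ := h.transferSum_nonneg hes
    have h₂ := I.pen_mono f (Nat.le_succ (occ A f))
    simp only [Nat.succ_eq_add_one] at h₂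
    linarith
  · have := h ⟨u, es, f, none⟩ ⟨hes, hf, by simp⟩
    simp only [loopCost, penaltyTransfer] at this
    change 0 ≤ I.transferSum A es + _ at this
    linarith

end Problem

end LBDD

namespace LBDD

variable {n k : ℕ}

/-! ### Carrying out transfers -/

/-- The allotment after the listed transfers, the last one being carried out first. -/
def carryOut (T : List (Fin n × Fin k)) (A : Allotment n k) : Allotment n k :=
  T.foldr (fun e B => Function.update B e.1 e.2) A

theorem carryOut_cons (e : Fin n × Fin k) (T : List (Fin n × Fin k)) (A : Allotment n k) :
    carryOut (e :: T) A = Function.update (carryOut T A) e.1 e.2 := rfl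

theorem carryOut_of_notMem {T : List (Fin n × Fin k)} {d : Fin n} (h : d ∉ T.map Prod.fst)
    (A : Allotment n k) : carryOut T A d = A d := by
  induction T with
  | nil => rfl
  | cons e T ih =>
    simp only [List.map_cons, List.mem_cons, not_or] at h
    rw [carryOut_cons, Function.update_of_ne h.1, ih h.2]

theorem carryOut_eq_or (T : List (Fin n × Fin k)) (A : Allotment n k) (d : Fin n) :
    carryOut T A d = A d ∨ (d, carryOut T A d) ∈ T := by
  induction T with
  | nil => exact Or.inl rfl
  | cons e T ih =>
    rw [carryOut_cons]
    by_cases h : d = e.1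
    · subst h; simp
    · rw [Function.update_of_ne h]
      exact ih.imp id (List.mem_cons_of_mem _)

theorem carryOut_perm {T T' : List (Fin n × Fin k)} (h : T.Perm T')
    (hn : (T.map Prod.fst).Nodup) (A : Allotment n k) : carryOut T A = carryOut T' A := by
  refine h.foldr_eq' ?_ A
  intro x hx y hy B
  by_cases hxy : x = y
  · rw [hxy]
  · exact Function.update_comm (fun he => hxy (List.inj_on_of_nodup_map hn hx hy he)) _ _ _

/-- Transfers of distinct demand nodes commute. Therefore the program may use its own order, and the
loop may start at another vertex than the walk. -/
theorem Loop.remove_eq_carryOut (L : Loop n k) {T : List (Fin n × Fin k)}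
    (h : L.transfers.Perm T) (hn : (T.map Prod.fst).Nodup) (A : Allotment n k) :
    L.remove A = carryOut T A := by
  have h' := (List.reverse_perm L.transfers).trans h
  rw [← carryOut_perm h' ((h'.map _).nodup_iff.2 hn), Loop.remove, carryOut, List.foldr_reverse]

theorem occ_eq_sum (A : Allotment n k) (i : Fin k) :
    occ A i = ∑ d, if A d = i then 1 else 0 := by
  simp [occ]

/-- The corrections are added on both sides, which avoids truncated subtraction and covers `A d =
w`. -/
theorem occ_update (A : Allotment n k) (d : Fin n) (w i : Fin k) :
    occ (Function.update A d w) i + (if i = A d then 1 else 0) =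
      occ A i + (if i = w then 1 else 0) := by
  rw [occ_eq_sum, occ_eq_sum, ← Finset.add_sum_erase _ _ (Finset.mem_univ d),
    ← Finset.add_sum_erase Finset.univ (fun e => if A e = i then 1 else 0) (Finset.mem_univ d)]
  have : ∑ e ∈ Finset.univ.erase d, (if Function.update A d w e = i then 1 else 0) =
      ∑ e ∈ Finset.univ.erase d, if A e = i then 1 else 0 :=
    Finset.sum_congr rfl fun e he => by rw [Function.update_of_ne (Finset.ne_of_mem_erase he)]
  simp only [this, Function.update_self, eq_comm (a := i)]
  omega

/-- Gains and losses cancel at the inner vertices of the path. Distinctness ensures that each demand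
node is still at its original center when its turn comes. -/
theorem occ_carryOut {A : Allotment n k} {u v : Fin k} {T : List (Fin n × Fin k)}
    (hT : IsPath A u T v) (hn : (T.map Prod.fst).Nodup) (i : Fin k) :
    occ (carryOut T A) i + (if i = u then 1 else 0) = occ A i + (if i = v then 1 else 0) := by
  induction T generalizing u with
  | nil => obtain rfl : u = v := hT; rfl
  | cons e T ih =>
    obtain ⟨rfl, -, hT⟩ := hT
    rw [List.map_cons, List.nodup_cons] at hn
    have h₁ := occ_update (carryOut T A) e.1 e.2 i
    have h₂ := ih hT hn.2
    rw [carryOut_of_notMem hn.1] at h₁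
    rw [carryOut_cons]
    omega

/-! ### Transfers along a walk -/

/-- The transfer along an arc, none if the arc meets the additional vertex. -/
def arcTransfer (E : Fin k → Fin k → Fin n) :
    Option (Fin k) → Option (Fin k) → List (Fin n × Fin k)
  | some u, some v => [(E u v, v)]
  | _, _ => []

/-- The transfers along the walk with the given vertices. -/
def walkTransfers (E : Fin k → Fin k → Fin n) : List (Option (Fin k)) → List (Fin n × Fin k)
  | a :: b :: l => arcTransfer E a b ++ walkTransfers E (b :: l)
  | _ => []

section Transfers

variable {E : Fin k → Fin k → Fin n}

theorem walkTransfers_append (l l' : List (Option (Fin k))) (x : Option (Fin k)) :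
    walkTransfers E (l ++ x :: l') = walkTransfers E (l ++ [x]) ++ walkTransfers E (x :: l') := by
  induction l with
  | nil => simp [walkTransfers]
  | cons a l ih =>
    cases l with
    | nil => simp [walkTransfers]
    | cons b l => simpa [walkTransfers] using ih

theorem exists_of_mem_walkTransfers {l : List (Option (Fin k))} {e : Fin n × Fin k}
    (h : e ∈ walkTransfers E l) : ∃ u v, [some u, some v] <:+: l ∧ e = (E u v, v) := by
  induction l with
  | nil => simp [walkTransfers] at h
  | cons a l ih =>
    cases l with
    | nil => simp [walkTransfers] at h
    | cons b l =>
      rw [walkTransfers, List.mem_append] at h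
      rcases h with h | h
      · rcases a with _ | u <;> rcases b with _ | v <;> simp [arcTransfer] at h
        exact ⟨u, v, ⟨[], l, rfl⟩, h⟩
      · obtain ⟨u, v, huv, he⟩ := ih h
        exact ⟨u, v, huv.trans (List.suffix_cons _ _).isInfix, he⟩

/-- A demand node determines the center from which it is moved, so a walk that leaves no vertex
twice moves no demand node twice. -/
theorem walkTransfers_sources {A : Allotment n k} {l : List (Option (Fin k))}
    (h : ∀ u v, [some u, some v] <:+: l → A (E u v) = u) :
    ((walkTransfers E l).map fun e => some (A e.1)).Sublist l.dropLast := by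
  induction l with
  | nil => simp [walkTransfers]
  | cons a l ih =>
    cases l with
    | nil => simp [walkTransfers]
    | cons b l =>
      have ih := ih fun u v huv => h u v (huv.trans (List.suffix_cons _ _).isInfix)
      rw [walkTransfers, List.map_append, List.dropLast_cons_cons]
      rcases a with _ | u
      · exact ih.cons _
      rcases b with _ | v
      · exact ih.cons _
      · simp only [arcTransfer, List.map_cons, List.map_nil, h u v ⟨[], l, rfl⟩]
        exact ih.cons_cons _

theorem walkTransfers_fst_nodup {A : Allotment n k} {l : List (Option (Fin k))}
    (h : ∀ u v, [some u, some v] <:+: l → A (E u v) = u) (hl : l.dropLast.Nodup) :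
    ((walkTransfers E l).map Prod.fst).Nodup := by
  have := hl.sublist (walkTransfers_sources h)
  rw [← Function.comp_def (fun d => some (A d)) Prod.fst, ← List.map_map] at this
  exact this.of_map

theorem isPath_walkTransfers {A : Allotment n k} {x : Fin k} {l : List (Fin k)}
    (h : ∀ u v, [some u, some v] <:+: some x :: l.map some → A (E u v) = u)
    (hn : (x :: l).Nodup) :
    IsPath A x (walkTransfers E (some x :: l.map some)) (l.getLastD x) := by
  induction l generalizing x with
  | nil => rfl
  | cons y l ih =>
    refine ⟨h x y ⟨[], l.map some, rfl⟩, ?_, ?_⟩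
    · intro h'; obtain rfl : y = x := h'; simp at hn
    · have := ih (fun u v huv => h u v (huv.trans (List.suffix_cons _ _).isInfix))
        (List.nodup_cons.1 hn).2
      rwa [List.getLastD_cons]

theorem walkTransfers_snd (x : Fin k) (l : List (Fin k)) :
    (walkTransfers E (some x :: l.map some)).map Prod.snd = l := by
  induction l generalizing x with
  | nil => rfl
  | cons y l ih => simpa [walkTransfers, arcTransfer] using ih y

end Transfers

/-! ### Weights of walks as sums of transfer costs -/

section Weights

variable {R : Type*} [CommRing R] [LinearOrder R]

/-- `E u v` is a demand node whose transfer from `u` to `v` is cheapest. -/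
def Problem.Cheapest (I : Problem R n k) (A : Allotment n k) (E : Fin k → Fin k → Fin n) : Prop :=
  ∀ u v, u ≠ v → I.arc A Finset.univ (some u) (some v) ≠ ⊤ → A (E u v) = u ∧
    I.arc A Finset.univ (some u) (some v) = ((I.transferCost A (E u v) v : R) : WithTop R)

theorem arc_ne_top_of_infix [IsStrictOrderedRing R] {V : Type*} {w : V → V → WithTop R} {a b : V}
    {l : List V}
    (h : walkWeight w a l b ≠ ⊤) {u v : V} (huv : [u, v] <:+: a :: (l ++ [b])) : w u v ≠ ⊤ := by
  induction l generalizing a with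
  | nil =>
    have := huv.eq_of_length (by simp)
    simp only [List.nil_append, List.cons.injEq, and_true] at this
    obtain ⟨rfl, rfl⟩ := this
    exact h
  | cons x l ih =>
    rw [walkWeight, Ne, WithTop.add_eq_top, not_or] at h
    rcases List.infix_cons_iff.1 huv with h' | h'
    · obtain ⟨r, hr⟩ := h'
      simp only [List.cons_append, List.nil_append, List.cons.injEq] at hr
      obtain ⟨rfl, rfl, -⟩ := hr
      exact h.1
    · exact ih h.2 h'

theorem Problem.Cheapest.source {I : Problem R n k} {A : Allotment n k} [IsStrictOrderedRing R]
    {E : Fin k → Fin k → Fin n} (hE : I.Cheapest A E) {a b : Option (Fin k)}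
    {l : List (Option (Fin k))}
    (h : walkWeight (I.arc A Finset.univ) a l b ≠ ⊤) (hne : ∀ u, ¬ [u, u] <:+: a :: (l ++ [b]))
    {u v : Fin k} (huv : [some u, some v] <:+: a :: (l ++ [b])) : A (E u v) = u := by
  refine (hE u v ?_ (arc_ne_top_of_infix h huv)).1
  rintro rfl
  exact hne _ huv

/-- The last arc is kept apart because `b` may be `none`, where the arc is a penalty, or the start
of the walk. -/
theorem Problem.Cheapest.walkWeight_eq [IsStrictOrderedRing R] {I : Problem R n k}
    {A : Allotment n k}
    {E : Fin k → Fin k → Fin n} (hE : I.Cheapest A E) {x : Fin k} {l : List (Fin k)}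
    {b : Option (Fin k)} (hn : (x :: l).Nodup)
    (h : walkWeight (I.arc A Finset.univ) (some x) (l.map some) b ≠ ⊤) :
    walkWeight (I.arc A Finset.univ) (some x) (l.map some) b =
      ((I.transferSum A (walkTransfers E (some x :: l.map some)) : R) : WithTop R) +
        I.arc A Finset.univ (some (l.getLastD x)) b := by
  induction l generalizing x with
  | nil => simp [walkWeight, walkTransfers]
  | cons y l ih =>
    have hxy : x ≠ y := by rintro rfl; simp at hn
    rw [List.map_cons, walkWeight] at h ⊢
    rw [Ne, WithTop.add_eq_top, not_or] at h
    rw [ih (List.nodup_cons.1 hn).2 h.2, (hE x y hxy h.1).2]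
    simp only [walkTransfers, arcTransfer, List.singleton_append, Problem.transferSum_cons,
      List.getLastD_cons, WithTop.coe_add, add_assoc]

end Weights

end LBDD

/-! ### Lower bounds on loop costs, and how prices survive transfers -/

namespace LBDD

theorem walkWeight_congr {V M : Type*} [Add M] {w w' : V → V → M} {a b : V} {l : List V}
    (h : ∀ u ∈ a :: l, ∀ x, w u x = w' u x) : walkWeight w a l b = walkWeight w' a l b := by
  induction l generalizing a with
  | nil => exact h a (by simp) b
  | cons x l ih =>
    rw [walkWeight, walkWeight, h a (by simp) x, ih fun u hu => h u (List.mem_cons_of_mem _ hu)]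

theorem walkWeight_mono {V M : Type*} [AddCommMonoid M] [LinearOrder M] [IsOrderedAddMonoid M]
    {w w' : V → V → M} (h : ∀ u x, w u x ≤ w' u x) (a b : V) (l : List V) :
    walkWeight w a l b ≤ walkWeight w' a l b := by
  induction l generalizing a with
  | nil => exact h a b
  | cons x l ih => exact add_le_add (h a x) (ih x)

theorem not_infix_pair_of_nodup {V : Type*} {l : List V} (h : l.Nodup) (u : V) :
    ¬ [u, u] <:+: l := fun h' => by
  have := h.sublist h'.sublist
  simp at this

variable {R : Type*} [CommRing R] [LinearOrder R] [IsStrictOrderedRing R] {n k : ℕ}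

/-- A path that left `v` would have to come back to it at the end, and so would visit it twice. -/
theorem isPath_source_ne {A : Allotment n k} {u v : Fin k} {l : List (Fin n × Fin k)}
    (h : IsPath A u l v) (hn : (u :: l.map Prod.snd).Nodup) : ∀ e ∈ l, A e.1 ≠ v := by
  induction l generalizing u with
  | nil => simp
  | cons e l ih =>
    obtain ⟨h₁, h₂, h₃⟩ := h
    rw [List.map_cons, List.nodup_cons] at hn
    intro e' he'
    rcases List.mem_cons.1 he' with rfl | he'
    · rw [h₁]
      rintro rfl
      apply hn.1
      clear ih hn h₁ he' h₂
      have : ∀ (x : Fin k) (l : List (Fin n × Fin k)), IsPath A x l u → u ∈ x :: l.map Prod.snd := by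
        intro x l
        induction l generalizing x with
        | nil => intro h; obtain rfl : x = u := h; simp
        | cons e l ih => exact fun h => List.mem_cons_of_mem _ (ih _ h.2.2)
      exact this _ _ h₃
    · exact ih h₃ hn.2 e' he'

namespace Problem

/-- Only transfers out of `s` may violate contentment, each of them by at most `-c`. -/
theorem sub_add_le_transferSum {I : Problem R n k} {A : Allotment n k} {p : Fin k → R} {s : Fin k}
    {c : R} (hc : c ≤ 0) (h : ∀ d, A d ≠ s → I.Content A p d)
    (hs : ∀ d x, A d = s → c + p s ≤ I.transferCost A d x + p x) {u v : Fin k}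
    {l : List (Fin n × Fin k)} (hl : IsPath A u l v) (hn : (u :: l.map Prod.snd).Nodup) :
    p u - p v + c ≤ I.transferSum A l := by
  induction l generalizing u with
  | nil => obtain rfl : u = v := hl; simpa using hc
  | cons e l ih =>
    obtain ⟨rfl, -, hl⟩ := hl
    rw [List.map_cons] at hn
    rw [transferSum_cons]
    by_cases hu : A e.1 = s
    · have h₁ := sub_le_transferSum hl (p := p) (I := I) fun e' he' => h e'.1 (by
        rw [← hu]
        rintro h'
        apply (List.nodup_cons.1 hn).1
        have key : ∀ (x : Fin k) (l : List (Fin n × Fin k)), IsPath A x l v → ∀ e ∈ l,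
            A e.1 ∈ x :: l.map Prod.snd := by
          intro x l
          induction l generalizing x with
          | nil => simp
          | cons e l ih =>
            rintro ⟨h₁, h₂, h₃⟩ e' he'
            rcases List.mem_cons.1 he' with rfl | he'
            · simp [h₁]
            · exact List.mem_cons_of_mem _ (ih _ h₃ _ he')
        rw [← h']
        exact key _ _ hl e' he')
      have h₂ := hs e.1 e.2 hu
      rw [hu]
      linarith
    · have h₁ := ih hl (List.nodup_cons.1 hn).2
      have h₂ := h e.1 hu e.2
      simp only [transferCost]
      linarith

/-- The telescoping argument for prices that fail only at transfers out of `s`, and there by at most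
`-c`. A simple loop leaves `s` at most once, so the defect is incurred at most once. -/
theorem loopCost_ge {I : Problem R n k} {A : Allotment n k} {p : Fin k → R} {s : Fin k}
    {c : R} (hc : c ≤ 0) (h : ∀ d, A d ≠ s → I.Content A p d)
    (hs : ∀ d x, A d = s → c + p s ≤ I.transferCost A d x + p x)
    (hle : ∀ u, I.pen u (occ A u) ≤ p u) (hge : ∀ u, p u ≤ I.pen u (occ A u + 1))
    {L : Loop n k} (hL : L.IsIn A) (hS : L.Simple) : c ≤ I.loopCost A L := by
  obtain ⟨a, l, f, o⟩ := L
  obtain ⟨h₁, h₂, h₃⟩ := hL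
  change c ≤ I.transferSum A l + _
  change (a :: l.map Prod.snd).Nodup at hS
  have h₄ := sub_add_le_transferSum hc h hs h₁ hS
  cases o with
  | none =>
    have h₅ := hle a
    have h₆ := hge f
    simp only [penaltyTransfer] at *
    linarith
  | some d =>
    obtain rfl : A d = f := h₃ d rfl
    by_cases hd : A d = s
    -- The closing edge already leaves `s`, so the preceding path does not, and contentment holds
    -- along all of it.
    · have h₅ := sub_le_transferSum h₁ (p := p) (I := I) fun e he => h e.1 (by
        rw [← hd]; exact isPath_source_ne h₁ hS e he)
      have h₆ := hs d a hd
      simp only at *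
      rw [hd] at h₅
      linarith
    · have h₅ := h d hd a
      simp only [transferCost] at *
      linarith

/-- The bounds on the prices after a demand node has been passed on from `y` to `f`. -/
theorem penalty_bounds_of_occ {I : Problem R n k} {A B : Allotment n k} {q : Fin k → R} {y f : Fin k}
    (hyf : y ≠ f)
    (hocc : ∀ i, occ B i + (if i = y then 1 else 0) = occ A i + (if i = f then 1 else 0))
    (hle : ∀ u, u ≠ y → I.pen u (occ A u) ≤ q u) (hge : ∀ u, q u ≤ I.pen u (occ A u + 1))
    (hy : q y ≤ I.pen y (occ A y)) (hy' : I.pen y (occ A y - 1) ≤ q y)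
    (hf : I.pen f (occ A f + 1) ≤ q f) (u : Fin k) :
    I.pen u (occ B u) ≤ q u ∧ q u ≤ I.pen u (occ B u + 1) := by
  have h := hocc u
  by_cases huy : u = y
  · subst huy
    simp only [if_true, hyf, if_false, add_zero] at h
    rw [← h] at hy hy'
    exact ⟨by simpa using hy', hy⟩
  by_cases huf : u = f
  · subst huf
    simp only [if_true, huy, if_false, add_zero] at h
    rw [h]
    exact ⟨hf, (hge u).trans (I.pen_mono u (by omega))⟩
  · simp only [huf, huy, if_false, add_zero] at h
    rw [h]
    exact ⟨hle u huy, hge u⟩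

/-- Contentment after transfers along tight edges. -/
theorem Content.of_tight {I : Problem R n k} {A B : Allotment n k} {q : Fin k → R} {d : Fin n}
    (h : I.Content A q d) (hB : I.transferCost A d (B d) + q (B d) = q (A d)) :
    I.Content B q d := by
  intro x
  have := h x
  simp only [transferCost] at hB
  linarith

theorem arc_congr_of_source (I : Problem R n k) {A : Allotment n k} {D D' : Finset (Fin n)}
    {s : Fin k} (h : ∀ d, A d ≠ s → (d ∈ D ↔ d ∈ D')) {u : Option (Fin k)} (hu : u ≠ some s)
    (x : Option (Fin k)) : I.arc A D u x = I.arc A D' u x := by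
  rcases u with _ | u <;> rcases x with _ | x <;> simp only [arc]
  split_ifs
  · rfl
  · have : D.filter (A · = u) = D'.filter (A · = u) := by
      ext d
      simp only [Finset.mem_filter, and_congr_left_iff]
      rintro rfl
      exact h d fun h' => hu (congrArg some h')
    rw [this]

end Problem

end LBDD

/-! ### The first step: removal of a least loop through `s` -/

namespace LBDD

variable {R : Type*} [CommRing R] [LinearOrder R] [IsStrictOrderedRing R] {n k : ℕ}

theorem carryOut_of_mem {T : List (Fin n × Fin k)} {e : Fin n × Fin k} (he : e ∈ T)
    (hn : (T.map Prod.fst).Nodup) (A : Allotment n k) : carryOut T A e.1 = e.2 := by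
  induction T with
  | nil => simp at he
  | cons a T ih =>
    rw [List.map_cons, List.nodup_cons] at hn
    rw [carryOut_cons]
    rcases List.mem_cons.1 he with rfl | he
    · simp
    · rw [Function.update_of_ne, ih he hn.2]
      intro h
      exact hn.1 (h ▸ List.mem_map_of_mem he)

theorem exists_eq_map_some {V : Type*} {l : List (Option V)} (h : none ∉ l) :
    ∃ l' : List V, l = l'.map some := by
  induction l with
  | nil => exact ⟨[], rfl⟩
  | cons a l ih =>
    obtain ⟨l', rfl⟩ := ih fun h' => h (List.mem_cons_of_mem _ h')
    rcases a with _ | a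
    · simp at h
    · exact ⟨a :: l', rfl⟩

theorem mem_of_pair_infix {V : Type*} {l : List V} {u v b : V} (h : [u, v] <:+: l ++ [b]) :
    u ∈ l := by
  obtain ⟨l₁, l₂, h⟩ := h
  rcases List.eq_nil_or_concat l₂ with rfl | ⟨l₂, x, rfl⟩
  · have : (l₁ ++ [u]) ++ [v] = l ++ [b] := by simpa using h
    rw [← (List.append_inj' this rfl).1]; simp
  · have : (l₁ ++ [u, v] ++ l₂) ++ [x] = l ++ [b] := by simpa using h
    rw [← (List.append_inj' this rfl).1]; simp

theorem walkTransfers_concat {E : Fin k → Fin k → Fin n} (x : Fin k) (l : List (Fin k))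
    (b : Option (Fin k)) :
    walkTransfers E (some x :: (l.map some ++ [b])) =
      walkTransfers E (some x :: l.map some) ++ arcTransfer E (some (l.getLastD x)) b := by
  induction l generalizing x with
  | nil => simp [walkTransfers]
  | cons y l ih =>
    have := ih y
    rw [List.getLastD_cons]
    simp only [List.map_cons, List.cons_append, walkTransfers] at this ⊢
    rw [this, List.append_assoc]

theorem getLastD_mem_cons {V : Type*} (x : V) (l : List V) : l.getLastD x ∈ x :: l := by
  induction l generalizing x with
  | nil => simp
  | cons y l ih => rw [List.getLastD_cons]; exact List.mem_cons_of_mem _ (ih y)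

namespace Problem

theorem Content.sub_const {I : Problem R n k} {A : Allotment n k} {p : Fin k → R} {d : Fin n}
    (h : I.Content A p d) (c : R) : I.Content A (fun u => p u - c) d := fun x => by
  have := h x
  simp only
  linarith

theorem Content.congr {I : Problem R n k} {A B : Allotment n k} {p : Fin k → R} {d : Fin n}
    (h : I.Content A p d) (hd : B d = A d) : I.Content B p d := fun x => by
  rw [hd]; exact h x

theorem Cheapest.walkWeight_eq_transferSum {I : Problem R n k} {A : Allotment n k}
    {E : Fin k → Fin k → Fin n} (hE : I.Cheapest A E) {x b : Fin k} {l : List (Fin k)}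
    (hn : (x :: l).Nodup) (hb : l.getLastD x ≠ b)
    (h : walkWeight (I.arc A Finset.univ) (some x) (l.map some) (some b) ≠ ⊤) :
    walkWeight (I.arc A Finset.univ) (some x) (l.map some) (some b) =
      ((I.transferSum A (walkTransfers E (some x :: (l.map some ++ [some b]))) : R) :
        WithTop R) := by
  have h₁ := hE.walkWeight_eq hn h
  have h₂ : I.arc A Finset.univ (some (l.getLastD x)) (some b) ≠ ⊤ := fun h' => by
    rw [h₁, h'] at h; simp at h
  rw [h₁, walkTransfers_concat, transferSum_append, (hE _ _ hb h₂).2]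
  simp [arcTransfer]

theorem Cheapest.walkWeight_none_eq {I : Problem R n k} {A : Allotment n k}
    {E : Fin k → Fin k → Fin n} (hE : I.Cheapest A E) {s y : Fin k} {l l' : List (Fin k)}
    (hl : l ++ [s] = y :: l') (hn : (l ++ [s]).Nodup)
    (h : walkWeight (I.arc A Finset.univ) none (l.map some) (some s) ≠ ⊤) :
    walkWeight (I.arc A Finset.univ) none (l.map some) (some s) =
      ((-I.pen y (occ A y) + I.transferSum A (walkTransfers E (some y :: l'.map some)) : R) :
        WithTop R) := by
  rcases l with _ | ⟨z, l⟩
  · obtain ⟨rfl, rfl⟩ : s = y ∧ [] = l' := by simpa using hl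
    simp [walkWeight, arc, walkTransfers]
  · obtain ⟨rfl, rfl⟩ : z = y ∧ l ++ [s] = l' := by simpa using hl
    rw [List.map_cons, walkWeight, Ne, WithTop.add_eq_top, not_or] at h
    rw [List.nodup_append] at hn
    rw [List.map_cons, walkWeight, hE.walkWeight_eq_transferSum hn.1
      (hn.2.2 _ (getLastD_mem_cons z l) s (by simp)) h.2, WithTop.coe_add]
    simp [arc]

section FirstRemoval

variable {J : Problem R n k} {A : Allotment n k} {s : Fin k} {d₀ : Fin n} {p : Fin k → R}

/-- The distances to `s` in the graph without the demand node `d₀`. -/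
theorem exists_inDistance (hd₀ : A d₀ = s) (hp : ∀ d, d ≠ d₀ → J.Content A p d)
    (hle : ∀ u, J.pen u (occ A u) ≤ p u) (hge : ∀ u, p u ≤ J.pen u (occ A u + 1)) {c : R}
    (hc : c ≤ 0)
    (hmin : ∀ l, some s ∉ l →
      (c : WithTop R) ≤ walkWeight (J.arc A Finset.univ) (some s) l (some s)) :
    ∃ π : Option (Fin k) → R, π (some s) = 0 ∧
      (∀ u x, (π u : WithTop R) ≤ J.arc A (Finset.univ.erase d₀) u x + π x) ∧
      ∀ x, c ≤ J.transferCost A d₀ x + π (some x) := by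
  obtain ⟨π, h₀, h₁, h₂⟩ := exists_distance (J.arc A (Finset.univ.erase d₀)) (some s)
    (arc_self _ _ _ _)
    (fun x l => by
      -- The old prices, extended by zero to `none`, are a potential of the graph without `d₀`.
      refine walkWeight_closed_nonneg _ (fun v => v.elim 0 p) x l fun u _ y => ?_
      rcases u with _ | u
      · exact le_arc_none (φ := fun v => v.elim 0 p) (fun u => by simpa using hle u) y
      · exact le_arc_some (φ := fun v => v.elim 0 p)
          (fun d hd _ => hp d (Finset.ne_of_mem_erase hd)) (by simpa using hge u) y)
    (fun v => by
      rcases v with _ | v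
      · exact ⟨[], by simp [walkWeight, arc]⟩
      · exact ⟨[none], by simp [walkWeight, arc]⟩)
  refine ⟨π, h₀, h₁, fun x => ?_⟩
  by_cases hx : x = s
  · simp [hx, h₀, transferCost, hd₀, hc]
  -- Transferring `d₀` to `x` and following a shortest walk back to `s` gives a closed walk to which
  -- `hmin` applies.
  · obtain ⟨l, hl, hw⟩ := h₂ (some x) (by simpa using hx)
    have h₃ := hmin (some x :: l) (by simp [hl, Ne.symm hx])
    rw [walkWeight] at h₃
    have h₄ := walkWeight_mono (J.arc_anti A (Finset.erase_subset d₀ Finset.univ)) (some x)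
      (some s) l
    have h₅ := arc_le (I := J) (A := A) (Finset.mem_univ d₀) x
    rw [hd₀] at h₅
    have h₆ := h₃.trans (add_le_add h₅ (h₄.trans_eq hw))
    exact_mod_cast h₆

/-- The distances to `s` make `d₀` content as well, so after normalization at `none` they are prices
for all demand nodes. -/
theorem removesLeastLoop_of_nonneg (hd₀ : A d₀ = s) (hp : ∀ d, d ≠ d₀ → J.Content A p d)
    (hle : ∀ u, J.pen u (occ A u) ≤ p u) (hge : ∀ u, p u ≤ J.pen u (occ A u + 1))
    (hmin : ∀ l, some s ∉ l → 0 ≤ walkWeight (J.arc A Finset.univ) (some s) l (some s)) :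
    J.RemovesLeastLoop (fun L => s ∈ L.vertices) A A ∧ ∃ q, J.IsPrice A q := by
  obtain ⟨π, h₀, h₁, h₂⟩ := exists_inDistance hd₀ hp hle hge le_rfl hmin
  have hq : J.IsPrice A fun u => π (some u) - π none := by
    refine ⟨fun d => ?_, fun u => ?_, fun u => ?_⟩
    · refine Content.sub_const (p := fun u => π (some u)) ?_ _
      by_cases hd : d = d₀
      · subst hd
        intro x
        have := h₂ x
        rw [transferCost] at this
        rw [hd₀] at this ⊢
        simp only [h₀]
        linarith
      · exact content_of_le_arc (Finset.mem_erase.2 ⟨hd, Finset.mem_univ _⟩) fun x => h₁ _ x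
    · have := h₁ none (some u)
      simp only [arc] at this
      norm_cast at this
      linarith
    · have := h₁ (some u) none
      simp only [arc] at this
      norm_cast at this
      linarith
  exact ⟨Or.inr ⟨fun L hL _ _ => hq.noNegativeLoop L hL, rfl⟩, _, hq⟩

/-- The distances `π` to `s` without `d₀` serve twice. In `A` they bound every simple loop by `c`,
and after the transfers they are, up to a constant, prices. Leastness is thus shown among all simple
loops and not only among those through `s`. -/
theorem removesLeastLoop_of_neg (hd₀ : A d₀ = s) (hp : ∀ d, d ≠ d₀ → J.Content A p d)
    (hle : ∀ u, J.pen u (occ A u) ≤ p u) (hge : ∀ u, p u ≤ J.pen u (occ A u + 1))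
    {E : Fin k → Fin k → Fin n} (hE : J.Cheapest A E) {c : R} (hc : c < 0)
    {l : List (Option (Fin k))} (hl : l.Nodup) (hs : some s ∉ l)
    (hw : walkWeight (J.arc A Finset.univ) (some s) l (some s) = c)
    (hmin : ∀ l, some s ∉ l →
      (c : WithTop R) ≤ walkWeight (J.arc A Finset.univ) (some s) l (some s)) :
    J.RemovesLeastLoop (fun L => s ∈ L.vertices) A
        (carryOut (walkTransfers E (some s :: (l ++ [some s]))) A) ∧
      ∃ q, J.IsPrice (carryOut (walkTransfers E (some s :: (l ++ [some s]))) A) q := by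
  obtain ⟨π, h₀, h₁, h₂⟩ := exists_inDistance hd₀ hp hle hge hc.le hmin
  have hD : ∀ u x, u ≠ some s →
      J.arc A Finset.univ u x = J.arc A (Finset.univ.erase d₀) u x := fun u x hu =>
    J.arc_congr_of_source (fun d hd => by
      simp only [Finset.mem_univ, Finset.mem_erase, ne_eq, and_true, true_iff]
      rintro rfl; exact hd hd₀) hu x
  -- The first edge transfers `d₀`, the others are tight.
  obtain ⟨x₁, l', rfl, hE₁, hcx, htight⟩ : ∃ x₁ l', l = some x₁ :: l' ∧ E s x₁ = d₀ ∧
      c = J.transferCost A d₀ x₁ + π (some x₁) ∧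
      ∀ u v, [u, v] <:+: some x₁ :: (l' ++ [some s]) →
        J.arc A (Finset.univ.erase d₀) u v + π v = π u := by
    rcases l with _ | ⟨v₁, l'⟩
    · rw [walkWeight, arc_self] at hw
      exact absurd hc (by rw [← WithTop.coe_lt_coe, ← hw]; simp)
    have hw' := hw
    rw [walkWeight, walkWeight_congr (w' := J.arc A (Finset.univ.erase d₀)) fun u hu x => hD u x
      (by rintro rfl; exact hs hu)] at hw
    have h₃ := le_walkWeight_add (J.arc A (Finset.univ.erase d₀)) π v₁ (some s) l' fun u _ x =>
      h₁ u x
    have hne₁ : J.arc A Finset.univ (some s) v₁ ≠ ⊤ := fun h => by simp [h] at hw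
    have hne₂ : walkWeight (J.arc A (Finset.univ.erase d₀)) v₁ l' (some s) ≠ ⊤ := fun h => by
      simp [h] at hw
    -- If the first arc cost no more without `d₀`, the potential `π` would force the closed walk to
    -- have nonnegative weight.
    have hlt : ¬ J.arc A (Finset.univ.erase d₀) (some s) v₁ ≤ J.arc A Finset.univ (some s) v₁ := by
      intro h
      have h₄ := (h₁ (some s) v₁).trans (add_le_add h le_rfl)
      lift J.arc A Finset.univ (some s) v₁ to R using hne₁ with a
      lift walkWeight (J.arc A (Finset.univ.erase d₀)) v₁ l' (some s) to R using hne₂ with b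
      norm_cast at hw h₃ h₄
      linarith
    rcases v₁ with _ | x₁
    -- The arc from `s` to `none` is a penalty and does not depend on `d₀`.
    · exact absurd le_rfl hlt
    have hsx : s ≠ x₁ := by rintro rfl; simp at hs
    obtain ⟨he₁, he₂⟩ := hE s x₁ hsx hne₁
    have hE₁ : E s x₁ = d₀ := by
      by_contra hne
      refine hlt ?_
      have := arc_le (I := J) (A := A) (Finset.mem_erase.2 ⟨hne, Finset.mem_univ _⟩) x₁
      rwa [he₁, ← he₂] at this
    have h₅ := h₂ x₁
    rw [he₂, hE₁] at hw
    have hb := hw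
    lift walkWeight (J.arc A (Finset.univ.erase d₀)) (some x₁) l' (some s) to R using hne₂
      with b hb'
    norm_cast at hw h₃
    refine ⟨x₁, l', rfl, hE₁, by linarith, fun u v huv => ?_⟩
    refine tight_of_walkWeight_le _ π (some x₁) (some s) l' (fun u _ x => h₁ u x) ?_ u v huv
    rw [← hb']
    norm_cast
    linarith
  -- The vertices of the walk are distinct.
  have hne : ∀ u, ¬ [u, u] <:+: some s :: (some x₁ :: l' ++ [some s]) := by
    intro u hu
    rcases List.infix_cons_iff.1 hu with h | h
    · obtain ⟨r, hr⟩ := h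
      simp only [List.cons_append, List.nil_append, List.cons.injEq] at hr
      rw [← hr.1, hr.2.1] at hs
      simp at hs
    · refine not_infix_pair_of_nodup ?_ u h
      rw [List.nodup_append]
      simp only [List.mem_singleton]
      exact ⟨hl, by simp, by rintro a ha b rfl rfl; exact hs ha⟩
  have hfin : walkWeight (J.arc A Finset.univ) (some s) (some x₁ :: l') (some s) ≠ ⊤ := by simp [hw]
  have hsrc : ∀ u v, [some u, some v] <:+: some s :: (some x₁ :: l' ++ [some s]) →
      A (E u v) = u := fun u v huv => hE.source hfin hne huv
  have hfst : ((walkTransfers E (some s :: (some x₁ :: l' ++ [some s]))).map Prod.fst).Nodup := by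
    refine walkTransfers_fst_nodup hsrc ?_
    rw [← List.cons_append, List.dropLast_concat]
    exact List.nodup_cons.2 ⟨hs, hl⟩
  set T := walkTransfers E (some s :: (some x₁ :: l' ++ [some s])) with hT
  have hcontent : ∀ d, J.Content (carryOut T A) (fun u => π (some u) - π none) d := by
    intro d
    refine Content.sub_const (p := fun u => π (some u)) ?_ _
    by_cases hd : d = d₀
    · have hB : carryOut T A d = x₁ := by
        refine carryOut_of_mem (e := (d, x₁)) ?_ hfst A
        rw [hd, ← hE₁, hT]
        simp [walkTransfers, arcTransfer]
      intro x
      rw [hB]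
      have h₃ := h₂ x
      simp only [transferCost, hd] at *
      linarith
    · have hcA : J.Content A (fun u => π (some u)) d :=
        content_of_le_arc (Finset.mem_erase.2 ⟨hd, Finset.mem_univ _⟩) fun x => h₁ _ x
      rcases carryOut_eq_or T A d with h | h
      · exact hcA.congr h
      · obtain ⟨u, v, huv, he⟩ := exists_of_mem_walkTransfers h
        simp only [Prod.mk.injEq] at he
        have hu := hsrc u v huv
        have hm : [some u, some v] <:+: some x₁ :: (l' ++ [some s]) := by
          rcases List.infix_cons_iff.1 huv with h' | h'
          · obtain ⟨r, hr⟩ := h'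
            simp only [List.cons_append, List.nil_append, List.cons.injEq, Option.some.injEq] at hr
            rw [hr.1, hr.2.1, hE₁] at he
            exact absurd he.1 hd
          · exact h'
        have ht := htight _ _ hm
        have hus : some u ≠ some s := by
          rintro h'
          exact hs (h' ▸ mem_of_pair_infix (l := some x₁ :: l') hm)
        rw [← hD _ _ hus, (hE u v (by rintro rfl; exact hne _ huv)
          (arc_ne_top_of_infix hfin huv)).2] at ht
        refine hcA.of_tight ?_
        rw [he.2, he.1, hu]
        exact_mod_cast ht
  have hle' : ∀ u, J.pen u (occ A u) ≤ π (some u) - π none := fun u => by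
    have := h₁ none (some u)
    simp only [arc] at this
    norm_cast at this
    linarith
  have hge' : ∀ u, π (some u) - π none ≤ J.pen u (occ A u + 1) := fun u => by
    have := h₁ (some u) none
    simp only [arc] at this
    norm_cast at this
    linarith
  have hleast : ∀ L : Loop n k, L.IsIn A → L.Simple → c ≤ J.loopCost A L := by
    intro L hL hS
    refine loopCost_ge (p := fun u => π (some u) - π none) (s := s) hc.le (fun d hd => ?_)
      (fun d x hd => ?_) hle' hge' hL hS
    · refine Content.sub_const (p := fun u => π (some u)) ?_ _
      exact content_of_le_arc (Finset.mem_erase.2 ⟨by rintro rfl; exact hd hd₀,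
        Finset.mem_univ _⟩) fun x => h₁ _ x
    · by_cases hdd : d = d₀
      · have := h₂ x
        rw [h₀, hdd]
        linarith
      · have := (content_of_le_arc (Finset.mem_erase.2 ⟨hdd, Finset.mem_univ _⟩) fun x => h₁ _ x) x
        simp only [transferCost, hd] at *
        linarith
  -- Passing through `none` means that the loop is closed by a penalty transfer edge; otherwise it
  -- is closed by a transfer edge into `s`.
  by_cases hnone : none ∈ l'
  · obtain ⟨l₁, l₂, rfl⟩ := List.append_of_mem hnone
    have hl₁₂ := (List.nodup_append.1 (List.nodup_cons.1 hl).2)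
    obtain ⟨l₁, rfl⟩ := exists_eq_map_some (l := l₁) fun h => hl₁₂.2.2 _ h none (by simp) rfl
    obtain ⟨l₂, rfl⟩ := exists_eq_map_some (l := l₂) (List.nodup_cons.1 hl₁₂.2.1).1
    -- `y` is the center entered from `none`, possibly `s` itself. The loop starts there, runs
    -- through `s` to the center `f` before `none`, and closes by the penalty edge: the closed walk
    -- is rotated.
    obtain ⟨y, l₃, hy⟩ : ∃ y l₃, l₂ ++ [s] = y :: l₃ := by
      cases l₂ with
      | nil => exact ⟨s, [], rfl⟩
      | cons y l => exact ⟨y, l ++ [s], rfl⟩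
    have hall : (y :: (l₃ ++ x₁ :: l₁)).Nodup := by
      have h₃ : (some s :: some x₁ :: (l₁.map some ++ none :: l₂.map some)).Nodup :=
        List.nodup_cons.2 ⟨hs, hl⟩
      have h₄ : ((s :: x₁ :: (l₁ ++ l₂)).map some).Nodup := by
        refine h₃.sublist ?_
        simp only [List.map_cons, List.map_append]
        exact ((List.Sublist.refl _).append (List.sublist_cons_self _ _)).cons_cons _ |>.cons_cons _
      have h₅ : (l₂ ++ [s] ++ x₁ :: l₁).Perm (s :: x₁ :: (l₁ ++ l₂)) := by
        rw [List.append_assoc]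
        refine List.perm_append_comm.trans ?_
        simp
      rw [← List.cons_append, ← hy]
      exact h₅.nodup_iff.2 h₄.of_map
    have hsl : s ∈ y :: l₃ := by rw [← hy]; simp
    have hlast : l₃.getLastD y = s := by
      have h₃ : (y :: l₃).getLastD y = s := by rw [← hy]; simp
      rwa [List.getLastD_cons] at h₃
    set f := l₁.getLastD x₁ with hf
    have hfm : f ∈ x₁ :: l₁ := getLastD_mem_cons x₁ l₁
    have hyf : y ≠ f := fun h => (List.nodup_cons.1 hall).1 (List.mem_append_right _ (h ▸ hfm))
    have hsn : (s :: x₁ :: l₁).Nodup := by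
      rw [← List.cons_append, List.nodup_append] at hall
      exact List.nodup_cons.2 ⟨fun h => hall.2.2 s hsl s h rfl, hall.2.1⟩
    have hyn : (y :: l₃).Nodup := by
      rw [← List.cons_append, List.nodup_append] at hall
      exact hall.1
    set T₁ := walkTransfers E (some s :: (x₁ :: l₁).map some) with hT₁
    set T₂ := walkTransfers E (some y :: l₃.map some) with hT₂
    have hwalk : some s :: (some x₁ :: (l₁.map some ++ none :: l₂.map some) ++ [some s]) =
        (some s :: (x₁ :: l₁).map some) ++ none :: (y :: l₃).map some := by
      rw [← hy]; simp
    have hTe : T = T₁ ++ T₂ := by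
      have h₃ := walkTransfers_concat (E := E) s (x₁ :: l₁) none
      rw [hT, hwalk, walkTransfers_append, List.cons_append, h₃]
      simp [arcTransfer, walkTransfers, hT₁, hT₂]
    rw [hwalk] at hsrc
    have hpath₁ : IsPath A s T₁ f := by
      have := isPath_walkTransfers (E := E) (A := A) (x := s) (l := x₁ :: l₁)
        (fun u v huv => hsrc u v (huv.trans ⟨[], _, rfl⟩)) hsn
      rwa [List.getLastD_cons] at this
    have hpath₂ : IsPath A y T₂ s := by
      have := isPath_walkTransfers (E := E) (A := A) (x := y) (l := l₃)
        (fun u v huv => hsrc u v (huv.trans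
          ⟨(some s :: (x₁ :: l₁).map some) ++ [none], [], by simp⟩)) hyn
      rwa [hlast] at this
    have hpath : IsPath A y (T₂ ++ T₁) f := isPath_append.2 ⟨s, hpath₂, hpath₁⟩
    have hperm : (T₂ ++ T₁).Perm T := by rw [hTe]; exact List.perm_append_comm
    have hfst' := (hperm.map Prod.fst).nodup_iff.2 hfst
    have hsnd₁ : T₁.map Prod.snd = x₁ :: l₁ := walkTransfers_snd s (x₁ :: l₁)
    have hsnd₂ : T₂.map Prod.snd = l₃ := walkTransfers_snd y l₃
    have hcost : J.loopCost A ⟨y, T₂ ++ T₁, f, none⟩ = c := by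
      have h₃ : walkWeight (J.arc A Finset.univ) (some s) ((x₁ :: l₁).map some ++
          none :: l₂.map some) (some s) = c := hw
      rw [walkWeight_append] at h₃
      have h₄ : walkWeight (J.arc A Finset.univ) (some s) ((x₁ :: l₁).map some) none ≠ ⊤ ∧
          walkWeight (J.arc A Finset.univ) none (l₂.map some) (some s) ≠ ⊤ := by
        rw [← not_or, ← WithTop.add_eq_top, h₃]; simp
      rw [hE.walkWeight_eq hsn h₄.1, hE.walkWeight_none_eq hy (hy ▸ hyn) h₄.2,
        List.getLastD_cons] at h₃
      simp only [arc] at h₃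
      norm_cast at h₃
      simp only [loopCost, penaltyTransfer]
      change J.transferSum A (T₂ ++ T₁) + _ = c
      rw [transferSum_append, ← h₃]
      ring
    refine ⟨Or.inl ⟨⟨y, T₂ ++ T₁, f, none⟩, ⟨hpath, hyf.symm, by simp⟩, ?_, ?_, ?_, ?_, ?_⟩,
      _, hcontent, fun u => ?_, fun u => ?_⟩
    · rw [Loop.Simple, Loop.vertices, List.map_append, hsnd₁, hsnd₂]
      exact hall
    · change s ∈ y :: (T₂ ++ T₁).map Prod.snd
      rw [List.map_append, hsnd₁, hsnd₂, ← List.cons_append]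
      exact List.mem_append_left _ hsl
    · intro L hL hS _
      rw [hcost]
      exact hleast L hL hS
    · rw [hcost]; exact hc
    · refine (Loop.remove_eq_carryOut _ ?_ hfst A).symm
      simpa [Loop.transfers] using hperm
    all_goals
      have hocc := occ_carryOut hpath hfst'
      rw [carryOut_perm hperm hfst'] at hocc
      have hty : J.pen y (occ A y) = π (some y) - π none := by
        have h₃ := htight none (some y) ⟨some x₁ :: l₁.map some, l₃.map some, by
          have h₄ := congrArg (List.map some) hy
          simp only [List.map_append, List.map_cons, List.map_nil] at h₄
          simp [h₄]⟩
        simp only [arc] at h₃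
        norm_cast at h₃
        linarith
      have htf : J.pen f (occ A f + 1) = π (some f) - π none := by
        obtain ⟨l₄, h₄⟩ : ∃ l₄, x₁ :: l₁ = l₄ ++ [f] := by
          rcases List.eq_nil_or_concat (x₁ :: l₁) with h | ⟨l₄, z, h⟩
          · simp at h
          · rw [List.concat_eq_append] at h
            refine ⟨l₄, ?_⟩
            have h₅ : f = (x₁ :: l₁).getLastD s := by rw [List.getLastD_cons]
            rw [h₅, h]
            simp
        have h₃ := htight (some f) none ⟨l₄.map some, l₂.map some ++ [some s], by
          have h₅ := congrArg (List.map some) h₄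
          simp only [List.map_append, List.map_cons, List.map_nil] at h₅
          have h₆ := congrArg (· ++ (none :: l₂.map some ++ [some s])) h₅
          simpa using h₆.symm⟩
        simp only [arc] at h₃
        norm_cast at h₃
        linarith
      -- Only the occupancies of `y` and `f` change, and the tight arcs at `none` fix the prices of
      -- both at the penalties needed.
      have hb := penalty_bounds_of_occ (I := J) (q := fun u => π (some u) - π none) hyf hocc
        (fun u _ => hle' u) hge' hty.ge (hty ▸ J.pen_mono y (Nat.sub_le _ _)) htf.le u
    · exact hb.1
    · exact hb.2
  · obtain ⟨l₀, rfl⟩ := exists_eq_map_some hnone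
    set f := l₀.getLastD x₁ with hf
    have hfm : f ∈ x₁ :: l₀ := getLastD_mem_cons x₁ l₀
    have hsn : (s :: x₁ :: l₀).Nodup := by
      have h₃ : (some s :: some x₁ :: l₀.map some).Nodup := List.nodup_cons.2 ⟨hs, hl⟩
      exact List.Nodup.of_map some (l := s :: x₁ :: l₀) h₃
    have hfs : f ≠ s := fun h => (List.nodup_cons.1 hsn).1 (h ▸ hfm)
    have hTe : T = walkTransfers E (some s :: (x₁ :: l₀).map some) ++ [(E f s, s)] := by
      have h₃ := walkTransfers_concat (E := E) s (x₁ :: l₀) (some s)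
      rw [List.getLastD_cons] at h₃
      exact h₃
    have hpath : IsPath A s (walkTransfers E (some s :: (x₁ :: l₀).map some)) f := by
      have := isPath_walkTransfers (E := E) (A := A) (x := s) (l := x₁ :: l₀)
        (fun u v huv => hsrc u v (huv.trans ⟨[], [some s], by simp⟩)) hsn
      rwa [List.getLastD_cons] at this
    have hAf : A (E f s) = f := by
      refine (hE f s hfs fun h => ?_).1
      have h₃ := hE.walkWeight_eq hsn (b := some s) hfin
      rw [List.getLastD_cons, h] at h₃
      exact hfin (h₃.trans (by simp))
    have hpath' : IsPath A s T s := by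
      rw [hTe]
      exact isPath_append.2 ⟨f, hpath, hAf, hfs.symm, rfl⟩
    have hcost : J.loopCost A ⟨s, walkTransfers E (some s :: (x₁ :: l₀).map some), f,
        some (E f s)⟩ = c := by
      have h₃ := hE.walkWeight_eq_transferSum hsn (b := s) (by rwa [List.getLastD_cons]) hfin
      have h₄ : ((J.transferSum A T : R) : WithTop R) = c := by
        rw [← hw]; exact h₃.symm
      rw [hTe, transferSum_append, WithTop.coe_inj] at h₄
      simpa [loopCost, transferSum] using h₄
    have hocc : ∀ i, occ (carryOut T A) i = occ A i := fun i => by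
      simpa using occ_carryOut hpath' hfst i
    refine ⟨Or.inl ⟨⟨s, walkTransfers E (some s :: (x₁ :: l₀).map some), f, some (E f s)⟩,
      ⟨hpath, hfs, by simpa using hAf⟩, ?_, by simp [Loop.vertices], ?_, ?_, ?_⟩,
      _, hcontent, fun u => ?_, fun u => ?_⟩
    · rw [Loop.Simple, Loop.vertices, walkTransfers_snd]
      exact hsn
    · intro L hL hS _
      rw [hcost]
      exact hleast L hL hS
    · rw [hcost]; exact hc
    · refine (Loop.remove_eq_carryOut _ ?_ hfst A).symm
      rw [hTe]
      simp [Loop.transfers]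
    · rw [hocc]; exact hle' u
    · rw [hocc]; exact hge' u

end FirstRemoval

end Problem

end LBDD

/-! ### The second step: removal of a least loop that starts at `s` -/

namespace LBDD

theorem exists_last_occurrence {V : Type*} {a : V} {l : List V} (h : a ∈ l) :
    ∃ l₁ l₂, l = l₁ ++ a :: l₂ ∧ a ∉ l₂ := by
  obtain ⟨l₁, l₂, h₁, h₂⟩ := List.eq_append_cons_of_mem (List.mem_reverse.2 h)
  refine ⟨l₂.reverse, l₁.reverse, ?_, by simpa using h₂⟩
  rw [← List.reverse_reverse l, h₁]
  simp

variable {R : Type*} [CommRing R] [LinearOrder R] [IsStrictOrderedRing R] {n k : ℕ}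

namespace Problem

variable {I : Problem R n k} {A : Allotment n k} {s : Fin k}

theorem innerArc_eq_arc {u : Option (Fin k)} (hu : u ≠ none) (x : Option (Fin k)) :
    I.innerArc A u x = I.arc A Finset.univ u x := by
  cases u with
  | none => exact absurd rfl hu
  | some u => rfl

theorem le_innerArc_add {p : Fin k → R} (hp : ∀ d, I.Content A p d)
    (hge : ∀ u, p u ≤ I.pen u (occ A u + 1)) (u x : Option (Fin k)) :
    ((u.elim 0 p : R) : WithTop R) ≤ I.innerArc A u x + ((x.elim 0 p : R) : WithTop R) := by
  rcases u with _ | u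
  · cases x <;> simp [innerArc]
  · exact le_arc_some (φ := fun v : Option (Fin k) => v.elim 0 p) (fun d _ _ => hp d)
      (by simpa using hge u) x

/-- The distances to the additional vertex when only the penalties at `s` have been restored. -/
theorem exists_outDistance_of_raise {p : Fin k → R} (hp : (I.raise s).IsPrice A p) :
    ∃ g : Fin k → R, (∀ d, I.Content A g d) ∧ (∀ u, g u ≤ I.pen u (occ A u + 1)) ∧
      (∀ u, u ≠ s → I.pen u (occ A u) ≤ g u) ∧ I.pen s (occ A s - 1) ≤ g s ∧
      ∃ l, none ∉ l ∧ some s ∉ l ∧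
        walkWeight (I.arc A Finset.univ) (some s) l none = g s := by
  have hc : ∀ d, I.Content A p d := fun d => hp.content d
  have hpge : ∀ u, p u ≤ I.pen u (occ A u + 1) := fun u => by
    refine (hp.price_le u).trans ?_
    simp only [raise]
    split_ifs
    · exact I.pen_mono u (Nat.sub_le _ _)
    · exact le_rfl
  obtain ⟨g, h₁, h₂, h₃⟩ := exists_outDistance (I := I) (A := A) fun u es hes => by
    simpa using sub_le_transferSum hes (p := p) (I := I) fun e _ => hc e.1
  -- The old prices, extended by zero to the target `none`, are a potential, hence bounded by the
  -- distances; the distances inherit their lower bounds.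
  have hpg : ∀ u, p u ≤ g u := fun u => by
    obtain ⟨l, -, hl⟩ := h₃ u
    have := le_walkWeight_add (I.innerArc A) (fun v => v.elim 0 p) (some u) none l
      fun v _ x => le_innerArc_add hc hpge v x
    rw [hl] at this
    simp only [Option.elim_some, Option.elim_none] at this
    norm_cast at this
    simpa using this
  refine ⟨g, h₁, h₂, fun u hu => ?_, ?_, ?_⟩
  · have := hp.le_price u
    simp only [raise, hu, if_false] at this
    exact this.trans (hpg u)
  · have := hp.le_price s
    simp only [raise, if_true] at this
    exact this.trans (hpg s)
  · obtain ⟨l, hl, hw⟩ := h₃ s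
    have harc : ∀ l, none ∉ l → walkWeight (I.innerArc A) (some s) l none =
        walkWeight (I.arc A Finset.univ) (some s) l none := fun l hl =>
      walkWeight_congr fun u hu x => innerArc_eq_arc (by rintro rfl; simp [hl] at hu) x
    by_cases hs : some s ∈ l
    -- Everything before the last visit to `s` is a closed walk of nonnegative weight and can be
    -- dropped.
    · obtain ⟨l₁, l₂, rfl, hn⟩ := exists_last_occurrence hs
      have hl₂ : none ∉ l₂ := fun h => hl (by simp [h])
      refine ⟨l₂, hl₂, hn, le_antisymm ?_ ?_⟩
      · rw [walkWeight_append] at hw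
        rw [← harc _ hl₂, ← hw]
        refine le_add_of_nonneg_left (walkWeight_closed_nonneg _ (fun v => v.elim 0 p) _ _ ?_)
        exact fun v _ x => le_innerArc_add hc hpge v x
      · have := le_walkWeight_add (I.innerArc A) (fun v => v.elim 0 g) (some s) none l₂
          fun v _ x => le_innerArc_add h₁ h₂ v x
        rw [← harc _ hl₂]
        simpa using this
    · exact ⟨l, hl, hs, by rw [← harc l hl, hw]⟩

/-- The only price condition the distances `g` may violate is the lower bound at `s`, and `h`
supplies it. The premise on `occ A s - 1` in `h` is what settles the case of an empty center. -/
theorem removesLeastLoop_start_of_le {p : Fin k → R} (hp : (I.raise s).IsPrice A p)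
    (h : ∀ c : R, (∃ l, none ∉ l ∧ some s ∉ l ∧
        walkWeight (I.arc A Finset.univ) (some s) l none = c) →
      I.pen s (occ A s - 1) ≤ c → I.pen s (occ A s) ≤ c) :
    I.RemovesLeastLoop (fun L => L.start = s) A A ∧ ∃ q, I.IsPrice A q := by
  obtain ⟨g, h₁, h₂, h₃, h₄, h₅⟩ := exists_outDistance_of_raise hp
  have hg : I.IsPrice A g := ⟨h₁, fun u => by
    by_cases hu : u = s
    · subst hu; exact h _ h₅ h₄
    · exact h₃ u hu, h₂⟩
  exact ⟨Or.inr ⟨fun L hL _ _ => hg.noNegativeLoop L hL, rfl⟩, g, hg⟩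

/-- A loop from `s` closed by a penalty edge costs at least `g s` minus the penalty of the last
demand node at `s`, and one closed by a transfer edge costs at least zero. The shortest walk attains
the former bound, and its arcs are tight, so that `g` remains valid after the transfers. -/
theorem removesLeastLoop_start_of_lt {p : Fin k → R} (hp : (I.raise s).IsPrice A p)
    {E : Fin k → Fin k → Fin n} (hE : I.Cheapest A E) {c : R} (hc : c < I.pen s (occ A s))
    {l : List (Option (Fin k))} (hl : l.Nodup) (hs : some s ∉ l) (hnone : none ∉ l)
    (hw : walkWeight (I.arc A Finset.univ) (some s) l none = c)
    (hmin : ∀ l, some s ∉ l → none ∉ l →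
      (c : WithTop R) ≤ walkWeight (I.arc A Finset.univ) (some s) l none) :
    I.RemovesLeastLoop (fun L => L.start = s) A
        (carryOut (walkTransfers E (some s :: (l ++ [none]))) A) ∧
      ∃ q, I.IsPrice (carryOut (walkTransfers E (some s :: (l ++ [none]))) A) q := by
  obtain ⟨g, h₁, h₂, h₃, h₄, l', hl'₁, hl'₂, hl'₃⟩ := exists_outDistance_of_raise hp
  have hpot := le_innerArc_add h₁ h₂
  have hwi : walkWeight (I.innerArc A) (some s) l none = c := by
    rw [← hw]
    exact walkWeight_congr fun u hu x => innerArc_eq_arc (by rintro rfl; simp [hnone] at hu) x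
  have hcg : c = g s := by
    have h₅ := hmin l' hl'₂ hl'₁
    rw [hl'₃] at h₅
    have h₆ := le_walkWeight_add (I.innerArc A) (fun v => v.elim 0 g) (some s) none l
      fun v _ x => hpot v x
    rw [hwi] at h₆
    simp only [Option.elim_some, Option.elim_none] at h₆
    norm_cast at h₅ h₆
    simp only [add_zero] at h₆
    exact le_antisymm h₅ h₆
  have htight := tight_of_walkWeight_le (I.innerArc A) (fun v => v.elim 0 g) (some s) none l
    (fun v _ x => hpot v x) (by rw [hwi]; simp [hcg])
  obtain ⟨l, rfl⟩ := exists_eq_map_some hnone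
  have hsn : (s :: l).Nodup :=
    List.Nodup.of_map some (l := s :: l) (List.nodup_cons.2 ⟨hs, hl⟩)
  have hwn : (some s :: (l.map some ++ [none])).Nodup := by
    rw [← List.cons_append, List.nodup_append]
    exact ⟨List.nodup_cons.2 ⟨hs, hl⟩, by simp, by simp⟩
  have hfin : walkWeight (I.arc A Finset.univ) (some s) (l.map some) none ≠ ⊤ := by simp [hw]
  have hne : ∀ u, ¬ [u, u] <:+: some s :: (l.map some ++ [none]) := not_infix_pair_of_nodup hwn
  have hsrc : ∀ u v, [some u, some v] <:+: some s :: (l.map some ++ [none]) →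
      A (E u v) = u := fun u v huv => hE.source hfin hne huv
  have hfst := walkTransfers_fst_nodup hsrc (hwn.sublist (List.dropLast_sublist _))
  set T := walkTransfers E (some s :: (l.map some ++ [none])) with hT
  have hTe : T = walkTransfers E (some s :: l.map some) := by
    rw [hT, walkTransfers_concat]; simp [arcTransfer]
  set f := l.getLastD s with hf
  have hcost : c = I.transferSum A T + I.pen f (occ A f + 1) := by
    have h₅ := hE.walkWeight_eq hsn hfin
    rw [hw, ← hTe] at h₅
    simp only [arc] at h₅
    exact_mod_cast h₅
  -- Going directly from `s` to `none` costs the penalty of a further demand node at `s`, which is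
  -- too much by monotonicity.
  have hfs : f ≠ s := by
    intro h
    have hnil : l = [] := by
      rcases l with _ | ⟨x, l⟩
      · rfl
      · rw [hf, List.getLastD_cons] at h
        exact absurd (h ▸ getLastD_mem_cons x l) (List.nodup_cons.1 hsn).1
    subst hnil
    simp only [walkWeight, List.map_nil, arc] at hw
    norm_cast at hw
    have := I.pen_mono s (Nat.le_succ (occ A s))
    simp only [Nat.succ_eq_add_one] at this
    linarith
  have hpath : IsPath A s T f := by
    rw [hTe]
    exact isPath_walkTransfers (fun u v huv => hsrc u v (huv.trans ⟨[], [none], by simp⟩)) hsn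
  have hlc : I.loopCost A ⟨s, T, f, none⟩ = c - I.pen s (occ A s) := by
    simp only [loopCost, penaltyTransfer, hcost, transferSum]
    ring
  refine ⟨Or.inl ⟨⟨s, T, f, none⟩, ⟨hpath, hfs, by simp⟩, ?_, rfl, ?_, ?_, ?_⟩, g, ?_,
    fun u => ?_, fun u => ?_⟩
  · rw [Loop.Simple, Loop.vertices, hTe, walkTransfers_snd]
    exact hsn
  · rintro ⟨a, es, f', o⟩ ⟨hes, -, ho⟩ - rfl
    rw [hlc, hcg]
    have h₅ := sub_le_transferSum hes (p := g) (I := I) fun e _ => h₁ e.1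
    cases o with
    | none =>
      have h₆ := h₂ f'
      simp only [loopCost, penaltyTransfer]
      simp only at h₅
      change _ ≤ I.transferSum A es + _
      linarith
    | some d =>
      obtain rfl : A d = f' := ho d rfl
      have h₆ := h₁ d a
      simp only [loopCost, transferCost]
      change _ ≤ I.transferSum A es + _
      simp only at h₅ hcg hc
      linarith
  · rw [hlc]; linarith
  · refine (Loop.remove_eq_carryOut _ ?_ hfst A).symm
    simp [Loop.transfers]
  · intro d
    rcases carryOut_eq_or T A d with h | h
    · exact (h₁ d).congr h
    · obtain ⟨u, v, huv, he⟩ := exists_of_mem_walkTransfers h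
      simp only [Prod.mk.injEq] at he
      have ht := htight _ _ huv
      rw [innerArc_eq_arc (by simp), (hE u v (by rintro rfl; exact hne _ huv)
        (arc_ne_top_of_infix hfin huv)).2] at ht
      refine (h₁ d).of_tight ?_
      rw [he.2, he.1, hsrc u v huv]
      simp only [Option.elim_some] at ht
      exact_mod_cast ht
  all_goals
    have htf : I.pen f (occ A f + 1) ≤ g f := by
      obtain ⟨l₄, h₄⟩ : ∃ l₄, s :: l = l₄ ++ [f] := by
        rcases List.eq_nil_or_concat (s :: l) with h | ⟨l₄, z, h⟩
        · simp at h
        · rw [List.concat_eq_append] at h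
          refine ⟨l₄, ?_⟩
          have h₅ : f = (s :: l).getLastD s := by rw [List.getLastD_cons]
          rw [h₅, h]
          simp
      have h₅ := htight (some f) none ⟨l₄.map some, [], by
        have h₆ := congrArg (fun r => r.map some ++ [none]) h₄
        simpa using h₆.symm⟩
      simp only [innerArc, arc, Option.elim_some, Option.elim_none] at h₅
      norm_cast at h₅
      simp only [add_zero] at h₅
      exact h₅.le
    -- With one demand node less at `s`, the violated lower bound has become the required upper
    -- bound.
    have hb := penalty_bounds_of_occ (I := I) hfs.symm (occ_carryOut hpath hfst) h₃ h₂
      (hcg ▸ hc.le) h₄ htf u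
  · exact hb.1
  · exact hb.2

end Problem

end LBDD

/-! ### From the Bellman–Ford tables to the two removals -/

namespace LBDD

variable {R : Type*} [CommRing R] [LinearOrder R] [IsStrictOrderedRing R] {n k : ℕ}

/-- The allotment after the transfers along the walk from `s` to `t` that is encoded in `Q`. -/
def traceAllotment (E : Fin k → Fin k → Fin n) (Q : ℕ → Option (Fin k) → Option (Option (Fin k)))
    (s : Fin k) (t : Option (Fin k)) (A : Allotment n k) : Allotment n k :=
  carryOut (walkTransfers E (some s :: (traceBack Q k t ++ [t]))) A

namespace Problem

/-- Such a walk never leaves `s`, so it cannot use `d₀`, and the old prices are a potential along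
it. The condition is doubled because in the general form, different from `some s` and from the
target, the target is here `some s`. -/
theorem closedWalk_nonneg {J : Problem R n k} {A : Allotment n k} {s : Fin k}
    {d₀ : Fin n} {p : Fin k → R} (hd₀ : A d₀ = s) (hp : ∀ d, d ≠ d₀ → J.Content A p d)
    (hle : ∀ u, J.pen u (occ A u) ≤ p u) (hge : ∀ u, p u ≤ J.pen u (occ A u + 1))
    (x : Option (Fin k)) (l : List (Option (Fin k))) (hx : x ≠ some s ∧ x ≠ some s)
    (hl : ∀ y ∈ l, y ≠ some s ∧ y ≠ some s) :
    0 ≤ walkWeight (J.arc A Finset.univ) x l x := by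
  refine walkWeight_closed_nonneg _ (fun v => v.elim 0 p) x l fun u hu y => ?_
  have hus : u ≠ some s := by
    rcases List.mem_cons.1 hu with rfl | hu
    · exact hx.1
    · exact (hl u hu).1
  rcases u with _ | u
  · exact le_arc_none (φ := fun v : Option (Fin k) => v.elim 0 p) (fun u => by simpa using hle u) y
  · refine le_arc_some (φ := fun v : Option (Fin k) => v.elim 0 p) (fun d _ hd => hp d ?_)
      (by simpa using hge u) y
    rintro rfl
    exact hus (by rw [← hd, hd₀])

theorem removesLeastLoop_of_bellmanFord {J : Problem R n k} {A : Allotment n k} {s : Fin k}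
    {d₀ : Fin n} {p : Fin k → R} (hd₀ : A d₀ = s) (hp : ∀ d, d ≠ d₀ → J.Content A p d)
    (hle : ∀ u, J.pen u (occ A u) ≤ p u) (hge : ∀ u, p u ≤ J.pen u (occ A u + 1))
    {E : Fin k → Fin k → Fin n} (hE : J.Cheapest A E) {S : ℕ → Option (Fin k) → R}
    {Q : ℕ → Option (Fin k) → Option (Option (Fin k))}
    (h : BellmanFord (J.arc A Finset.univ) (fun u => u ≠ some s ∧ u ≠ some s) (some s) k S Q)
    {B : Allotment n k} (hB : B = if S k (some s) < 0 then traceAllotment E Q s (some s) A else A) :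
    J.RemovesLeastLoop (fun L => s ∈ L.vertices) A B ∧ ∃ q, J.IsPrice B q := by
  have hU := closedWalk_nonneg hd₀ hp hle hge
  obtain ⟨h₁, -, h₂, -⟩ := h.traceBack_spec le_rfl (some s)
  have h₃ := h.traceBack_nodup hU (some s)
  have h₄ : ∀ l, some s ∉ l →
      (S k (some s) : WithTop R) ≤ walkWeight (J.arc A Finset.univ) (some s) l (some s) :=
    fun l hl => h.le_walkWeight_of_card hU (by simp) (by simp) (some s) l fun y hy => by
      have : y ≠ some s := by rintro rfl; exact hl hy
      exact ⟨this, this⟩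
  split_ifs at hB with hc
  · subst hB
    exact removesLeastLoop_of_neg hd₀ hp hle hge hE hc h₃ (fun hm => (h₁ _ hm).1 rfl) h₂ h₄
  · subst hB
    exact removesLeastLoop_of_nonneg hd₀ hp hle hge fun l hl =>
      le_trans (WithTop.coe_nonneg.2 (not_lt.1 hc)) (h₄ l hl)

/-- Only the arc from `none` to `s` can violate the potential inequality, and walks that avoid
`none` do not use it. -/
theorem IsPrice.closedWalk_nonneg_of_raise {I : Problem R n k} {A : Allotment n k} {s : Fin k}
    {p : Fin k → R} (hp : (I.raise s).IsPrice A p)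
    (x : Option (Fin k)) (l : List (Option (Fin k))) (hx : x ≠ some s ∧ x ≠ none)
    (hl : ∀ y ∈ l, y ≠ some s ∧ y ≠ none) :
    0 ≤ walkWeight (I.arc A Finset.univ) x l x := by
  have hpge : ∀ u, p u ≤ I.pen u (occ A u + 1) := fun u => by
    refine (hp.price_le u).trans ?_
    simp only [raise]
    split_ifs
    · exact I.pen_mono u (Nat.sub_le _ _)
    · exact le_rfl
  have hpc : ∀ d, I.Content A p d := fun d => hp.content d
  refine walkWeight_closed_nonneg _ (fun v => v.elim 0 p) x l fun u hu y => ?_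
  have hus : u ≠ none := by
    rcases List.mem_cons.1 hu with rfl | hu
    · exact hx.2
    · exact (hl u hu).2
  rw [← innerArc_eq_arc hus]
  exact le_innerArc_add hpc hpge u y

theorem removesLeastLoop_start_of_bellmanFord {I : Problem R n k} {A : Allotment n k} {s : Fin k}
    {p : Fin k → R} (hp : (I.raise s).IsPrice A p)
    {E : Fin k → Fin k → Fin n} (hE : I.Cheapest A E) {S : ℕ → Option (Fin k) → R}
    {Q : ℕ → Option (Fin k) → Option (Option (Fin k))}
    (h : BellmanFord (I.arc A Finset.univ) (fun u => u ≠ some s ∧ u ≠ none) (some s) k S Q)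
    {B : Allotment n k}
    (hB : B = if S k none < I.pen s (occ A s) then traceAllotment E Q s none A else A) :
    I.RemovesLeastLoop (fun L => L.start = s) A B ∧ ∃ q, I.IsPrice B q := by
  have hU := hp.closedWalk_nonneg_of_raise
  obtain ⟨h₁, -, h₂, -⟩ := h.traceBack_spec le_rfl none
  have h₃ := h.traceBack_nodup hU none
  have h₄ : ∀ l, some s ∉ l → none ∉ l →
      (S k none : WithTop R) ≤ walkWeight (I.arc A Finset.univ) (some s) l none :=
    fun l hl hl' => h.le_walkWeight_of_card hU (by simp) (by simp) none l fun y hy =>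
      ⟨by rintro rfl; exact hl hy, by rintro rfl; exact hl' hy⟩
  split_ifs at hB with hc
  · subst hB
    exact removesLeastLoop_start_of_lt hp hE hc h₃ (fun hm => (h₁ _ hm).1 rfl)
      (fun hm => (h₁ _ hm).2 rfl) h₂ h₄
  · subst hB
    refine removesLeastLoop_start_of_le hp fun c hc' _ => ?_
    obtain ⟨l, hl, hl', hw⟩ := hc'
    have := h₄ l hl' hl
    rw [hw, WithTop.coe_le_coe] at this
    exact (not_lt.1 hc).trans this

/-- At an empty center the truncated `occ A s - 1` equals `occ A s`, so restoring the penalties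
breaks no bound. -/
theorem removesLeastLoop_start_of_occ_eq_zero {I : Problem R n k} {A : Allotment n k} {s : Fin k}
    {p : Fin k → R} (hp : (I.raise s).IsPrice A p) (h : occ A s = 0) :
    I.RemovesLeastLoop (fun L => L.start = s) A A ∧ ∃ q, I.IsPrice A q :=
  removesLeastLoop_start_of_le hp fun c _ hc => by simpa [h] using hc

theorem occ_snoc (A : Allotment n k) (s u : Fin k) :
    occ (Fin.snoc A s : Allotment (n + 1) k) u = occ A u + if u = s then 1 else 0 := by
  rw [occ_eq_sum, occ_eq_sum, Fin.sum_univ_castSucc]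
  simp [eq_comm]

theorem content_snoc {I : Problem R (n + 1) k} {A : Allotment n k} {p : Fin k → R}
    (hp : I.dropLast.IsPrice A p) (s : Fin k) {d : Fin (n + 1)} (hd : d ≠ Fin.last n) :
    (I.raise s).Content (Fin.snoc A s) p d := by
  obtain ⟨e, rfl⟩ := Fin.exists_castSucc_eq.2 hd
  intro x
  have := hp.content e x
  simpa [raise, dropLast] using this

/-- The shift of the penalties at `s` cancels the additional demand node. Hence the prices of the
old allotment keep their penalty bounds. -/
theorem pen_snoc (I : Problem R (n + 1) k) (A : Allotment n k) (s u : Fin k) :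
    (I.raise s).pen u (occ (Fin.snoc A s : Allotment (n + 1) k) u) = I.pen u (occ A u) ∧
      (I.raise s).pen u (occ (Fin.snoc A s : Allotment (n + 1) k) u + 1) =
        I.pen u (occ A u + 1) := by
  simp only [raise, occ_snoc]
  split_ifs <;> simp

end Problem

end LBDD

namespace LBDD

/-! ### Reasoning about programs -/

infixr:60 " ;; " => Cmd.seq

/-- The arrays of natural numbers to which a program may write. -/
def Cmd.natWrites : Cmd → List ℕ
  | skip => []
  | setN a _ _ _ _ => [a]
  | setV _ _ _ _ _ => []
  | seq c d => c.natWrites ++ d.natWrites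
  | cond _ c d => c.natWrites ++ d.natWrites
  | loop _ c => c.natWrites

/-- The arrays of ring elements to which a program may write. -/
def Cmd.valWrites : Cmd → List ℕ
  | skip => []
  | setN _ _ _ _ _ => []
  | setV a _ _ _ _ => [a]
  | seq c d => c.valWrites ++ d.valWrites
  | cond _ c d => c.valWrites ++ d.valWrites
  | loop _ c => c.valWrites

/-- The program contains no loop. -/
def Cmd.Straight : Cmd → Prop
  | skip => True
  | setN _ _ _ _ _ => True
  | setV _ _ _ _ _ => True
  | seq c d => c.Straight ∧ d.Straight
  | cond _ c d => c.Straight ∧ d.Straight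
  | loop _ _ => False

/-- A bound on the number of steps of a program without loops. -/
def Cmd.size : Cmd → ℕ
  | skip => 1
  | setN _ _ _ _ _ => 1
  | setV _ _ _ _ _ => 1
  | seq c d => c.size + d.size
  | cond _ c d => c.size + d.size + 1
  | loop _ c => c.size

/-- The scalar variable that is stored in the first cell of an array. -/
def NExp.var (a : ℕ) : NExp := .get a (.lit 0) (.lit 0) (.lit 0)

/-- Assignment to a scalar variable. -/
def Cmd.assign (a : ℕ) (x : NExp) : Cmd := .setN a (.lit 0) (.lit 0) (.lit 0) x

/-- Execution of `c` for the values `0, 1, …` of the variable `a` below the value of `b`. -/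
def Cmd.forUp (a b : ℕ) (c : Cmd) : Cmd :=
  Cmd.assign a (.lit 0) ;;
    Cmd.loop (.ltN (.var a) (.var b)) (c ;; Cmd.assign a (.add (.var a) (.lit 1)))

variable {R : Type*}

namespace Mem

/-- The value of a scalar variable. -/
def var (σ : Mem R) (a : ℕ) : ℕ := σ.nat a 0 0 0

theorem setNat_nat_of_ne (σ : Mem R) {a a' : ℕ} (h : a' ≠ a) (i j l x : ℕ) :
    (σ.setNat a i j l x).nat a' = σ.nat a' := by
  funext i' j' l'
  simp [setNat, h]

theorem setNat_nat_self (σ : Mem R) (a i j l x i' j' l' : ℕ) :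
    (σ.setNat a i j l x).nat a i' j' l' =
      if i' = i ∧ j' = j ∧ l' = l then x else σ.nat a i' j' l' := by
  simp [setNat]

theorem setNat_var_self (σ : Mem R) (a x : ℕ) : (σ.setNat a 0 0 0 x).var a = x := by
  simp [setNat, var]

theorem setNat_var_of_ne (σ : Mem R) {a a' : ℕ} (h : a' ≠ a) (i j l x : ℕ) :
    (σ.setNat a i j l x).var a' = σ.var a' := by
  simp [setNat, var, h]

theorem setNat_val (σ : Mem R) (a i j l x : ℕ) : (σ.setNat a i j l x).val = σ.val := rfl

theorem setVal_nat (σ : Mem R) (a i j l : ℕ) (x : R) : (σ.setVal a i j l x).nat = σ.nat := rfl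

theorem setVal_var (σ : Mem R) (a i j l : ℕ) (x : R) (b : ℕ) :
    (σ.setVal a i j l x).var b = σ.var b := rfl

theorem setVal_val_of_ne (σ : Mem R) {a a' : ℕ} (h : a' ≠ a) (i j l : ℕ) (x : R) :
    (σ.setVal a i j l x).val a' = σ.val a' := by
  funext i' j' l'
  simp [setVal, h]

theorem setVal_val_self (σ : Mem R) (a i j l : ℕ) (x : R) (i' j' l' : ℕ) :
    (σ.setVal a i j l x).val a i' j' l' =
      if i' = i ∧ j' = j ∧ l' = l then x else σ.val a i' j' l' := by
  simp [setVal]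

theorem var_eq_of_nat_eq {σ τ : Mem R} {a : ℕ} (h : τ.nat a = σ.nat a) : τ.var a = σ.var a := by
  simp [var, h]

end Mem

variable [CommRing R] [LinearOrder R] {n k : ℕ}

open Classical in
/-- The memory after the execution of a program without loops. -/
noncomputable def Cmd.result (I : Problem R n k) : Cmd → Mem R → Mem R
  | skip, σ => σ
  | setN a i j l x, σ => σ.setNat a (i.eval σ) (j.eval σ) (l.eval σ) (x.eval σ)
  | setV a i j l x, σ => σ.setVal a (i.eval σ) (j.eval σ) (l.eval σ) (x.eval I σ)
  | seq c d, σ => d.result I (c.result I σ)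
  | cond b c d, σ => if b.eval I σ then c.result I σ else d.result I σ
  | loop _ _, σ => σ

/-- Started in `σ`, the program `c` halts after at most `T` steps in a memory that satisfies
`Q`. -/
def Run (I : Problem R n k) (c : Cmd) (σ : Mem R) (T : ℕ) (Q : Mem R → Prop) : Prop :=
  ∃ τ t, Exec I c σ τ t ∧ t ≤ T ∧ Q τ

/-- The program `c` does not distinguish `τ` from `σ` outside the arrays to which it writes. -/
def Cmd.Frame (c : Cmd) (σ τ : Mem R) : Prop :=
  (∀ a, a ∉ c.natWrites → τ.nat a = σ.nat a) ∧ ∀ a, a ∉ c.valWrites → τ.val a = σ.val a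

section Rules

variable {I : Problem R n k} {σ τ υ : Mem R} {c d : Cmd} {b : BExp} {T T' t : ℕ}
  {P Q : Mem R → Prop}

theorem NExp.eval_var (σ : Mem R) (a : ℕ) : (NExp.var a).eval σ = σ.var a := rfl

theorem Cmd.result_assign (I : Problem R n k) (a : ℕ) (x : NExp) (σ : Mem R) :
    (Cmd.assign a x).result I σ = σ.setNat a 0 0 0 (x.eval σ) := rfl

theorem Cmd.Frame.refl (c : Cmd) (σ : Mem R) : c.Frame σ σ := ⟨fun _ _ => rfl, fun _ _ => rfl⟩

theorem Cmd.Frame.trans (h : c.Frame σ τ) (h' : c.Frame τ υ) : c.Frame σ υ :=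
  ⟨fun a ha => (h'.1 a ha).trans (h.1 a ha), fun a ha => (h'.2 a ha).trans (h.2 a ha)⟩

theorem Cmd.Frame.mono (h : c.Frame σ τ) (h₁ : c.natWrites ⊆ d.natWrites)
    (h₂ : c.valWrites ⊆ d.valWrites) : d.Frame σ τ :=
  ⟨fun a ha => h.1 a fun h => ha (h₁ h), fun a ha => h.2 a fun h => ha (h₂ h)⟩

theorem Cmd.Frame.var_eq (h : c.Frame σ τ) {a : ℕ} (ha : a ∉ c.natWrites) :
    τ.var a = σ.var a := Mem.var_eq_of_nat_eq (h.1 a ha)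

theorem Exec.frame (h : Exec I c σ τ t) : c.Frame σ τ := by
  induction h with
  | skip σ => exact Cmd.Frame.refl _ _
  | setN σ a i j l x =>
    refine ⟨fun a' ha => Mem.setNat_nat_of_ne σ (by simpa [Cmd.natWrites] using ha) _ _ _ _,
      fun _ _ => rfl⟩
  | setV σ a i j l x =>
    refine ⟨fun _ _ => rfl,
      fun a' ha => Mem.setVal_val_of_ne σ (by simpa [Cmd.valWrites] using ha) _ _ _ _⟩
  | seq _ _ h₁ h₂ =>
    exact (h₁.mono (List.subset_append_left _ _) (List.subset_append_left _ _)).trans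
      (h₂.mono (List.subset_append_right _ _) (List.subset_append_right _ _))
  | condTrue _ _ h => exact h.mono (List.subset_append_left _ _) (List.subset_append_left _ _)
  | condFalse _ _ h => exact h.mono (List.subset_append_right _ _) (List.subset_append_right _ _)
  | loopTrue _ _ _ h₁ h₂ =>
    exact (h₁.mono (List.Subset.refl _) (List.Subset.refl _)).trans h₂
  | loopFalse _ => exact Cmd.Frame.refl _ _

theorem Run.mono (h : Run I c σ T P) (hT : T ≤ T') (hQ : ∀ τ, c.Frame σ τ → P τ → Q τ) :
    Run I c σ T' Q := by
  obtain ⟨τ, t, h₁, h₂, h₃⟩ := h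
  exact ⟨τ, t, h₁, h₂.trans hT, hQ τ h₁.frame h₃⟩

theorem Run.seq (h : Run I c σ T P) (h' : ∀ τ, c.Frame σ τ → P τ → Run I d τ T' Q) :
    Run I (c ;; d) σ (T + T') Q := by
  obtain ⟨τ, t, h₁, h₂, h₃⟩ := h
  obtain ⟨υ, t', h₄, h₅, h₆⟩ := h' τ h₁.frame h₃
  exact ⟨υ, t + t', h₁.seq h₄, add_le_add h₂ h₅, h₆⟩

theorem Run.cond (h : b.eval I σ → Run I c σ T Q) (h' : ¬ b.eval I σ → Run I d σ T Q) :
    Run I (Cmd.cond b c d) σ (T + 1) Q := by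
  by_cases hb : b.eval I σ
  · obtain ⟨τ, t, h₁, h₂, h₃⟩ := h hb
    exact ⟨τ, t + 1, h₁.condTrue hb, by omega, h₃⟩
  · obtain ⟨τ, t, h₁, h₂, h₃⟩ := h' hb
    exact ⟨τ, t + 1, h₁.condFalse hb, by omega, h₃⟩

/-- Reduces loop-free code to a computation with `Cmd.result`; both branches of a conditional are
counted in the bound. -/
theorem Run.straight (hc : c.Straight) (hQ : Q (c.result I σ)) : Run I c σ c.size Q := by
  suffices ∃ t, Exec I c σ (c.result I σ) t ∧ t ≤ c.size by
    obtain ⟨t, h₁, h₂⟩ := this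
    exact ⟨_, t, h₁, h₂, hQ⟩
  clear hQ
  induction c generalizing σ with
  | skip => exact ⟨1, Exec.skip σ, le_rfl⟩
  | setN a i j l x => exact ⟨1, Exec.setN σ a i j l x, le_rfl⟩
  | setV a i j l x => exact ⟨1, Exec.setV σ a i j l x, le_rfl⟩
  | seq c d ihc ihd =>
    obtain ⟨t, h₁, h₂⟩ := ihc (σ := σ) hc.1
    obtain ⟨t', h₃, h₄⟩ := ihd (σ := c.result I σ) hc.2
    exact ⟨t + t', h₁.seq h₃, add_le_add h₂ h₄⟩
  | cond b c d ihc ihd =>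
    by_cases hb : b.eval I σ
    · obtain ⟨t, h₁, h₂⟩ := ihc (σ := σ) hc.1
      refine ⟨t + 1, ?_, by simp only [Cmd.size]; omega⟩
      simpa only [Cmd.result, if_pos hb] using h₁.condTrue hb
    · obtain ⟨t, h₁, h₂⟩ := ihd (σ := σ) hc.2
      refine ⟨t + 1, ?_, by simp only [Cmd.size]; omega⟩
      simpa only [Cmd.result, if_neg hb] using h₁.condFalse hb
  | loop b c => exact hc.elim

/-- The index of `Inv` bounds the number of iterations that remain; it has to drop, but not
necessarily by one. -/
theorem Run.loop (Inv : ℕ → Mem R → Prop)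
    (hstep : ∀ f τ, Inv f τ → b.eval I τ → ∃ g < f, Run I c τ T (Inv g))
    (hexit : ∀ f τ, Inv f τ → ¬ b.eval I τ → Q τ) {f : ℕ} (h : Inv f σ) :
    Run I (Cmd.loop b c) σ (f * (T + 1) + 1) Q := by
  induction f using Nat.strong_induction_on generalizing σ with
  | _ f ih =>
    by_cases hb : b.eval I σ
    · obtain ⟨g, hg, τ, t, h₁, h₂, h₃⟩ := hstep f σ h hb
      obtain ⟨υ, t', h₄, h₅, h₆⟩ := ih g hg h₃
      refine ⟨υ, t + t' + 1, h₁.loopTrue hb h₄, ?_, h₆⟩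
      have := Nat.mul_le_mul_right (T + 1) (Nat.succ_le_of_lt hg)
      rw [Nat.succ_mul] at this
      omega
    · exact ⟨σ, 1, Exec.loopFalse hb, by omega, hexit f σ h hb⟩

/-- Besides the body, an iteration costs a test and an increment; the initialization and the last
test cost two more steps. The frame passed to `hstep` keeps untouched data out of the invariants. -/
theorem Run.forUp {a e N : ℕ} (Inv : ℕ → Mem R → Prop) (hae : e ≠ a) (ha : a ∉ c.natWrites)
    (he : e ∉ c.natWrites) (hN : σ.var e = N) (h₀ : Inv 0 (σ.setNat a 0 0 0 0))
    (hstep : ∀ j < N, ∀ τ, (Cmd.forUp a e c).Frame σ τ → τ.var a = j → Inv j τ →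
      Run I c τ T fun υ => Inv (j + 1) (υ.setNat a 0 0 0 (j + 1))) :
    Run I (Cmd.forUp a e c) σ (N * (T + 2) + 2) (Inv N) := by
  have hfr : (Cmd.forUp a e c).natWrites = a :: (c.natWrites ++ [a]) := rfl
  have hfr' : (Cmd.forUp a e c).valWrites = c.valWrites ++ [] := rfl
  have h₁ : Run I (Cmd.assign a (.lit 0)) σ 1 fun τ => τ = σ.setNat a 0 0 0 0 :=
    Run.straight (c := Cmd.assign a (.lit 0)) trivial rfl
  have h₂ : Run I (Cmd.loop (.ltN (.var a) (.var e))
      (c ;; Cmd.assign a (.add (.var a) (.lit 1)))) (σ.setNat a 0 0 0 0)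
      (N * (T + 1 + 1) + 1) (Inv N) := by
    refine Run.loop (fun f τ => ∃ j, j + f = N ∧ τ.var a = j ∧ Inv j τ ∧
      (Cmd.forUp a e c).Frame σ τ) ?_ ?_ (f := N) ?_
    · rintro f τ ⟨j, hj, hτ, hInv, hF⟩ hb
      have heN : τ.var e = N := by
        rw [hF.var_eq (by rw [hfr]; simp [hae, he]), hN]
      simp only [BExp.eval, NExp.eval_var, heN, hτ] at hb
      refine ⟨f - 1, by omega, ?_⟩
      refine (hstep j hb τ hF hτ hInv).seq fun υ hυ hI => ?_
      refine Run.straight (c := Cmd.assign a (.add (.var a) (.lit 1))) trivial ?_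
      have hυa : υ.var a = j := by rw [hυ.var_eq ha, hτ]
      have hres : (Cmd.assign a (.add (.var a) (.lit 1))).result I υ =
          υ.setNat a 0 0 0 (j + 1) := by
        simp only [Cmd.result_assign, NExp.eval, NExp.eval_var, hυa]
      rw [hres]
      refine ⟨j + 1, by omega, Mem.setNat_var_self _ _ _, hI, hF.trans ⟨fun x hx => ?_,
        fun x hx => ?_⟩⟩
      · rw [hfr] at hx
        simp only [List.mem_cons, List.mem_append, List.not_mem_nil, or_false, not_or] at hx
        rw [Mem.setNat_nat_of_ne _ hx.1, hυ.1 x hx.2.1]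
      · rw [hfr'] at hx
        rw [Mem.setNat_val, hυ.2 x (by simpa using hx)]
    · rintro f τ ⟨j, hj, hτ, hInv, hF⟩ hb
      have heN : τ.var e = N := by
        rw [hF.var_eq (by rw [hfr]; simp [hae, he]), hN]
      simp only [BExp.eval, NExp.eval_var, heN, hτ] at hb
      obtain rfl : j = N := by omega
      exact hInv
    · refine ⟨0, by omega, Mem.setNat_var_self _ _ _, h₀, fun x hx => ?_, fun x _ => rfl⟩
      rw [hfr] at hx
      simp only [List.mem_cons, not_or] at hx
      exact Mem.setNat_nat_of_ne _ hx.1 _ _ _ _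
  have h₃ := h₁.seq (d := Cmd.loop (.ltN (.var a) (.var e))
      (c ;; Cmd.assign a (.add (.var a) (.lit 1)))) (T' := N * (T + 1 + 1) + 1) (Q := Inv N)
      fun τ _ hτ => hτ ▸ h₂
  exact h₃.mono (by rw [show T + 1 + 1 = T + 2 from rfl]; omega) fun _ _ h => h

end Rules

end LBDD

namespace LBDD

/-! ### Binary heaps -/

/-- The first cells of `H` hold the elements of `X`, and `P` gives their positions. -/
structure Indexed (X : Finset ℕ) (H P : ℕ → ℕ) : Prop where
  lt : ∀ d ∈ X, P d < X.card
  eq : ∀ d ∈ X, H (P d) = d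

/-- `P` is injective because `H` inverts it, and an injection between finite sets of equal size is
onto. -/
theorem Indexed.mem {X : Finset ℕ} {H P : ℕ → ℕ} (h : Indexed X H P) {p : ℕ} (hp : p < X.card) :
    H p ∈ X ∧ P (H p) = p := by
  have hinj : Set.InjOn P X := fun a ha b hb hab => by rw [← h.eq a ha, ← h.eq b hb, hab]
  have himg : X.image P = Finset.range X.card :=
    Finset.eq_of_subset_of_card_le
      (fun q hq => by
        obtain ⟨d, hd, rfl⟩ := Finset.mem_image.1 hq
        exact Finset.mem_range.2 (h.lt d hd))
      (by rw [Finset.card_image_of_injOn hinj, Finset.card_range])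
  obtain ⟨d, hd, rfl⟩ := Finset.mem_image.1 (himg ▸ Finset.mem_range.2 hp)
  rw [h.eq d hd]
  exact ⟨hd, rfl⟩

theorem Indexed.swap {X : Finset ℕ} {H P H' P' : ℕ → ℕ} (h : Indexed X H P) {p q : ℕ}
    (hp : p < X.card) (hq : q < X.card)
    (hH : ∀ r, H' r = if r = q then H p else if r = p then H q else H r)
    (hP : ∀ d, P' d = if d = H p then q else if d = H q then p else P d) : Indexed X H' P' := by
  have h₁ := (h.mem hp).2
  have h₂ := (h.mem hq).2
  refine ⟨fun d hd => ?_, fun d hd => ?_⟩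
  · rw [hP]
    split_ifs
    exacts [hq, hp, h.lt d hd]
  · have h₃ := h.eq d hd
    rw [hH, hP]
    by_cases hd₁ : d = H p
    · simp [hd₁]
    · by_cases hd₂ : d = H q
      · subst hd₂
        simp only [if_neg hd₁, if_true]
        split_ifs with h
        · rw [h]
        · rfl
      · simp only [if_neg hd₁, if_neg hd₂]
        rw [if_neg, if_neg, h₃]
        · rintro h; rw [h] at h₃; exact hd₁ h₃.symm
        · rintro h; rw [h] at h₃; exact hd₂ h₃.symm

/-! ### The heap order under exchanges -/

section Order

variable {R : Type*} [LinearOrder R] {key : ℕ → R} {H H' : ℕ → ℕ} {m p q : ℕ}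

/-- The heap order. -/
def Ordered (key : ℕ → R) (H : ℕ → ℕ) (m : ℕ) : Prop :=
  ∀ q, 0 < q → q < m → key (H ((q - 1) / 2)) ≤ key (H q)

/-- The heap order, the element at position `p` being ignored. -/
def OrderedExcept (key : ℕ → R) (H : ℕ → ℕ) (m p : ℕ) : Prop :=
  (∀ q, 0 < q → q < m → q ≠ p → (q - 1) / 2 ≠ p → key (H ((q - 1) / 2)) ≤ key (H q)) ∧
    ∀ q, 0 < q → q < m → (q - 1) / 2 = p → 0 < p → key (H ((p - 1) / 2)) ≤ key (H q)

/-- The second clause of `OrderedExcept` compares the children of the ignored position with its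
parent. It is needed since that parent moves down and becomes their new parent. -/
theorem OrderedExcept.swap_up (h : OrderedExcept key H m p) (hp : 0 < p) (hpm : p < m)
    (hlt : key (H p) < key (H ((p - 1) / 2)))
    (hH : ∀ r, H' r = if r = (p - 1) / 2 then H p else if r = p then H ((p - 1) / 2) else H r) :
    OrderedExcept key H' m ((p - 1) / 2) := by
  have hH₁ : H' ((p - 1) / 2) = H p := by rw [hH]; simp
  have hH₂ : H' p = H ((p - 1) / 2) := by rw [hH, if_neg (by omega), if_pos rfl]
  have hH₃ : ∀ r, r ≠ p → r ≠ (p - 1) / 2 → H' r = H r := fun r h₁ h₂ => by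
    rw [hH, if_neg h₂, if_neg h₁]
  constructor
  · intro q hq hqm hqp hpar
    have hqp' : q ≠ p := by rintro rfl; exact hpar rfl
    rw [hH₃ q hqp' hqp]
    by_cases hpp : (q - 1) / 2 = p
    · rw [hpp, hH₂]; exact h.2 q hq hqm hpp hp
    · rw [hH₃ _ hpp hpar]; exact h.1 q hq hqm hqp' hpp
  · intro q hq hqm hqp hpos
    rw [hH₃ (((p - 1) / 2 - 1) / 2) (by omega) (by omega)]
    have hgp := h.1 ((p - 1) / 2) hpos (by omega) (by omega) (by omega)
    by_cases hqp' : q = p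
    · rw [hqp', hH₂]; exact hgp
    · rw [hH₃ q hqp' (by omega)]
      have := h.1 q hq hqm hqp' (by omega)
      rw [hqp] at this
      exact hgp.trans this

/-- The heap order, the children of the position `p` being ignored. -/
def OrderedAbove (key : ℕ → R) (H : ℕ → ℕ) (m p : ℕ) : Prop :=
  (∀ q, 0 < q → q < m → (q - 1) / 2 ≠ p → key (H ((q - 1) / 2)) ≤ key (H q)) ∧
    ∀ q, 0 < q → q < m → (q - 1) / 2 = p → 0 < p → key (H ((p - 1) / 2)) ≤ key (H q)

theorem OrderedExcept.orderedAbove (h : OrderedExcept key H m p)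
    (hp : ¬ (0 < p ∧ key (H p) < key (H ((p - 1) / 2)))) : OrderedAbove key H m p := by
  refine ⟨fun q hq hqm hpar => ?_, h.2⟩
  by_cases hqp : q = p
  · subst hqp
    by_contra h'
    exact hp ⟨hq, not_le.1 h'⟩
  · exact h.1 q hq hqm hqp hpar

/-- The child moved up must be a least one, since it becomes the parent of its sibling. -/
theorem OrderedAbove.swap_down (h : OrderedAbove key H m p) (hq : (q - 1) / 2 = p) (hq₀ : 0 < q)
    (hqm : q < m) (hlt : key (H q) < key (H p))
    (hmin : ∀ r, 0 < r → r < m → (r - 1) / 2 = p → key (H q) ≤ key (H r))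
    (hH : ∀ r, H' r = if r = q then H p else if r = p then H q else H r) :
    OrderedAbove key H' m q := by
  have hH₁ : H' q = H p := by rw [hH]; simp
  have hH₂ : H' p = H q := by rw [hH, if_neg (by omega), if_pos rfl]
  have hH₃ : ∀ r, r ≠ p → r ≠ q → H' r = H r := fun r h₁ h₂ => by
    rw [hH, if_neg h₂, if_neg h₁]
  constructor
  · intro r hr hrm hpar
    by_cases hrp : r = p
    · rw [hrp, hH₂, hH₃ _ (by omega) (by omega)]
      exact h.2 q hq₀ hqm hq (by omega)
    · by_cases hrq : r = q
      · rw [hrq, hq, hH₁, hH₂]; exact hlt.le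
      · rw [hH₃ r hrp hrq]
        by_cases hpp : (r - 1) / 2 = p
        · rw [hpp, hH₂]; exact hmin r hr hrm hpp
        · rw [hH₃ _ hpp hpar]; exact h.1 r hr hrm hpp
  · intro r hr hrm hrq _
    rw [hq, hH₂, hH₃ r (by omega) (by omega)]
    have := h.1 r hr hrm (by omega)
    rwa [hrq] at this

theorem OrderedAbove.ordered (h : OrderedAbove key H m p)
    (hp : ∀ q, 0 < q → q < m → (q - 1) / 2 = p → key (H p) ≤ key (H q)) : Ordered key H m := by
  intro q hq hqm
  by_cases hpar : (q - 1) / 2 = p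
  · rw [hpar]; exact hp q hq hqm hpar
  · exact h.1 q hq hqm hpar

theorem Ordered.min (h : Ordered key H m) {q : ℕ} (hq : q < m) : key (H 0) ≤ key (H q) := by
  induction q using Nat.strong_induction_on with
  | _ q ih =>
    rcases Nat.eq_zero_or_pos q with rfl | hpos
    · exact le_rfl
    · exact (ih ((q - 1) / 2) (by omega) (by omega)).trans (h q hpos hq)

end Order

/-! ### Heap operations in memory

The row `i` and the column `j` of the heap are in the variables 10 and 11, the current position is
in 12, the size in 13. -/

/-- The cell at position `p` of the current heap. -/
def heapCell (p : NExp) : NExp := .get 4 (.var 10) (.var 11) p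

/-- The key of a demand node in the current heap. -/
def heapKey (d : NExp) : VExp := .sub (.cost d (.var 11)) (.cost d (.var 10))

/-- Exchange of the elements at the positions in the variables 12 and 14. -/
def heapSwap : Cmd :=
  Cmd.assign 15 (heapCell (.var 12)) ;;
  Cmd.assign 16 (heapCell (.var 14)) ;;
  Cmd.setN 4 (.var 10) (.var 11) (.var 12) (.var 16) ;;
  Cmd.setN 4 (.var 10) (.var 11) (.var 14) (.var 15) ;;
  Cmd.setN 5 (.var 11) (.var 16) (.lit 0) (.var 12) ;;
  Cmd.setN 5 (.var 11) (.var 15) (.lit 0) (.var 14) ;;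
  Cmd.assign 12 (.var 14)

def siftUp : Cmd :=
  Cmd.loop
    (.and (.ltN (.lit 0) (.var 12))
      (.ltV (heapKey (heapCell (.var 12)))
        (heapKey (heapCell (.half (.sub (.var 12) (.lit 1)))))))
    (Cmd.assign 14 (.half (.sub (.var 12) (.lit 1))) ;; heapSwap)

/-- The position of the least child is put into the variable 14. -/
def pickChild : Cmd :=
  Cmd.assign 14 (.add (.add (.var 12) (.var 12)) (.lit 1)) ;;
  Cmd.cond
    (.and (.ltN (.add (.var 14) (.lit 1)) (.var 13))
      (.ltV (heapKey (heapCell (.add (.var 14) (.lit 1)))) (heapKey (heapCell (.var 14)))))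
    (Cmd.assign 14 (.add (.var 14) (.lit 1))) Cmd.skip

def siftDown : Cmd :=
  pickChild ;;
  Cmd.loop
    (.and (.ltN (.var 14) (.var 13))
      (.ltV (heapKey (heapCell (.var 14))) (heapKey (heapCell (.var 12)))))
    (heapSwap ;; pickChild)

/-- The heap order is restored where only the element in the current position violates it. -/
def heapRepair : Cmd := siftUp ;; siftDown

/-! ### Correctness and cost of sifting -/

section Memory

variable {R : Type*} [CommRing R] [LinearOrder R] {n k : ℕ} {I : Problem R n k}

/-- The key of the demand node number `d` in the heaps of the pair `(i, j)`. -/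
def Problem.keyAt (I : Problem R n k) (i j d : ℕ) : R := I.costAt d j - I.costAt d i

/-- Only the heap `(i, j)` with the elements `X` has changed. -/
def HeapFrame (X : Finset ℕ) (i j : ℕ) (σ τ : Mem R) : Prop :=
  (∀ i' j', i' ≠ i ∨ j' ≠ j → τ.nat 4 i' j' = σ.nat 4 i' j') ∧
    ∀ j' d l, j' ≠ j ∨ d ∉ X → τ.nat 5 j' d l = σ.nat 5 j' d l

theorem HeapFrame.refl (X : Finset ℕ) (i j : ℕ) (σ : Mem R) : HeapFrame X i j σ σ :=
  ⟨fun _ _ _ => rfl, fun _ _ _ _ => rfl⟩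

theorem HeapFrame.trans {X : Finset ℕ} {i j : ℕ} {σ τ υ : Mem R} (h : HeapFrame X i j σ τ)
    (h' : HeapFrame X i j τ υ) : HeapFrame X i j σ υ :=
  ⟨fun i' j' hn => (h'.1 i' j' hn).trans (h.1 i' j' hn),
    fun j' d l hn => (h'.2 j' d l hn).trans (h.2 j' d l hn)⟩

/-- The current heap is `(i, j)` and has the elements `X`; compared to `σ`, nothing else has
changed. -/
structure Sifting (X : Finset ℕ) (i j : ℕ) (σ τ : Mem R) : Prop where
  row : τ.var 10 = i
  col : τ.var 11 = j
  size : τ.var 13 = X.card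
  indexed : Indexed X (τ.nat 4 i j) fun d => τ.nat 5 j d 0
  frame : HeapFrame X i j σ τ

theorem heapSwap_var (σ : Mem R) : (heapSwap.result I σ).var 12 = σ.var 14 ∧
    (heapSwap.result I σ).var 10 = σ.var 10 ∧ (heapSwap.result I σ).var 11 = σ.var 11 ∧
    (heapSwap.result I σ).var 13 = σ.var 13 := by
  simp [heapSwap, Cmd.result, Cmd.assign, NExp.eval, NExp.var, Mem.setNat, Mem.var]

theorem heapSwap_heap (σ : Mem R) (i j l : ℕ) : (heapSwap.result I σ).nat 4 i j l =
    if i = σ.var 10 ∧ j = σ.var 11 ∧ l = σ.var 14 then σ.nat 4 (σ.var 10) (σ.var 11) (σ.var 12)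
    else if i = σ.var 10 ∧ j = σ.var 11 ∧ l = σ.var 12 then
      σ.nat 4 (σ.var 10) (σ.var 11) (σ.var 14)
    else σ.nat 4 i j l := by
  simp [heapSwap, Cmd.result, Cmd.assign, NExp.eval, NExp.var, Mem.setNat, Mem.var, heapCell]
  rfl

theorem heapSwap_position (σ : Mem R) (j d l : ℕ) : (heapSwap.result I σ).nat 5 j d l =
    if j = σ.var 11 ∧ d = σ.nat 4 (σ.var 10) (σ.var 11) (σ.var 12) ∧ l = 0 then σ.var 14
    else if j = σ.var 11 ∧ d = σ.nat 4 (σ.var 10) (σ.var 11) (σ.var 14) ∧ l = 0 then σ.var 12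
    else σ.nat 5 j d l := by
  simp [heapSwap, Cmd.result, Cmd.assign, NExp.eval, NExp.var, Mem.setNat, Mem.var, heapCell]
  rfl

theorem Sifting.setNat {X : Finset ℕ} {i j : ℕ} {σ τ : Mem R} (h : Sifting X i j σ τ) {a : ℕ}
    (ha : a ∉ [4, 5, 10, 11, 13]) (x : ℕ) : Sifting X i j σ (τ.setNat a 0 0 0 x) := by
  simp only [List.mem_cons, List.not_mem_nil, or_false, not_or] at ha
  obtain ⟨h₁, h₂, h₃, h₄, h₅⟩ := ha
  refine ⟨?_, ?_, ?_, ?_, ⟨fun i' j' hn => ?_, fun j' d l hn => ?_⟩⟩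
  · rw [Mem.setNat_var_of_ne _ (Ne.symm h₃), h.row]
  · rw [Mem.setNat_var_of_ne _ (Ne.symm h₄), h.col]
  · rw [Mem.setNat_var_of_ne _ (Ne.symm h₅), h.size]
  · rw [Mem.setNat_nat_of_ne _ (Ne.symm h₁), Mem.setNat_nat_of_ne _ (Ne.symm h₂)]
    exact h.indexed
  · rw [Mem.setNat_nat_of_ne _ (Ne.symm h₁)]; exact h.frame.1 i' j' hn
  · rw [Mem.setNat_nat_of_ne _ (Ne.symm h₂)]; exact h.frame.2 j' d l hn

theorem Sifting.swap_heap {X : Finset ℕ} {i j : ℕ} {σ τ : Mem R} (h : Sifting X i j σ τ) (r : ℕ) :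
    (heapSwap.result I τ).nat 4 i j r =
      if r = τ.var 14 then τ.nat 4 i j (τ.var 12)
      else if r = τ.var 12 then τ.nat 4 i j (τ.var 14) else τ.nat 4 i j r := by
  rw [heapSwap_heap, h.row, h.col]
  simp

theorem Sifting.swap {X : Finset ℕ} {i j : ℕ} {σ τ : Mem R} (h : Sifting X i j σ τ)
    (hp : τ.var 12 < X.card) (hq : τ.var 14 < X.card) :
    Sifting X i j σ (heapSwap.result I τ) := by
  obtain ⟨-, hv₁, hv₂, hv₃⟩ := heapSwap_var (I := I) τ
  refine ⟨hv₁.trans h.row, hv₂.trans h.col, hv₃.trans h.size, ?_, h.frame.trans ⟨?_, ?_⟩⟩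
  · refine h.indexed.swap hp hq h.swap_heap fun d => ?_
    rw [heapSwap_position, h.row, h.col]
    simp
  · intro i' j' hn
    funext l
    rw [heapSwap_heap, h.row, h.col, if_neg (by tauto), if_neg (by tauto)]
  · intro j' d l hn
    rw [heapSwap_position, h.row, h.col]
    have h₁ := (h.indexed.mem hp).1
    have h₂ := (h.indexed.mem hq).1
    rw [if_neg, if_neg]
    · rintro ⟨rfl, rfl, -⟩; simp [h₂] at hn
    · rintro ⟨rfl, rfl, -⟩; simp [h₁] at hn

/-- The measure is the binary logarithm of the position plus one, which the step to the parent
lowers by exactly one. -/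
theorem siftUp_run {X : Finset ℕ} {i j : ℕ} {σ₀ σ : Mem R} (h : Sifting X i j σ₀ σ)
    (hp : σ.var 12 < X.card)
    (ho : OrderedExcept (I.keyAt i j) (σ.nat 4 i j) X.card (σ.var 12)) :
    Run I siftUp σ (Nat.log 2 X.card * 9 + 1) fun τ => Sifting X i j σ₀ τ ∧ τ.var 12 < X.card ∧
      OrderedAbove (I.keyAt i j) (τ.nat 4 i j) X.card (τ.var 12) := by
  refine (Run.loop (T := 8) (fun f τ => Nat.log 2 (τ.var 12 + 1) ≤ f ∧ Sifting X i j σ₀ τ ∧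
    τ.var 12 < X.card ∧ OrderedExcept (I.keyAt i j) (τ.nat 4 i j) X.card (τ.var 12)) ?_ ?_
    (f := Nat.log 2 X.card) ⟨Nat.log_mono_right hp, h, hp, ho⟩)
  · rintro f τ ⟨hf, h, hp, ho⟩ hb
    simp only [BExp.eval, VExp.eval, NExp.eval, heapKey, heapCell, NExp.eval_var, h.row,
      h.col] at hb
    obtain ⟨hb₁, hb₂⟩ := hb
    have hlog : Nat.log 2 ((τ.var 12 - 1) / 2 + 1) + 1 ≤ f := by
      refine le_trans (le_of_eq ?_) hf
      rw [Nat.log_of_one_lt_of_le (n := τ.var 12 + 1) (by norm_num) (by omega)]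
      congr 2
      omega
    refine ⟨f - 1, by omega, Run.straight (c := Cmd.assign 14 _ ;; heapSwap) ⟨trivial, by
      simp [heapSwap, Cmd.Straight, Cmd.assign]⟩ ?_⟩
    have hres : (Cmd.assign 14 (.half (.sub (.var 12) (.lit 1))) ;; heapSwap).result I τ =
        heapSwap.result I (τ.setNat 14 0 0 0 ((τ.var 12 - 1) / 2)) := rfl
    rw [hres]
    have h' := h.setNat (a := 14) (by decide) ((τ.var 12 - 1) / 2)
    have hv₁ : (τ.setNat 14 0 0 0 ((τ.var 12 - 1) / 2)).var 12 = τ.var 12 :=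
      Mem.setNat_var_of_ne _ (by decide) _ _ _ _
    have hv₂ : (τ.setNat 14 0 0 0 ((τ.var 12 - 1) / 2)).var 14 = (τ.var 12 - 1) / 2 :=
      Mem.setNat_var_self _ _ _
    have hsw := h'.swap_heap (I := I)
    rw [hv₁, hv₂, Mem.setNat_nat_of_ne _ (by decide)] at hsw
    refine ⟨?_, h'.swap (by rwa [hv₁]) (by rw [hv₂]; omega), ?_, ?_⟩
    all_goals rw [(heapSwap_var _).1, hv₂]
    · omega
    · omega
    · exact ho.swap_up hb₁ hp hb₂ hsw
  · rintro f τ ⟨hf, h, hp, ho⟩ hb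
    simp only [BExp.eval, VExp.eval, NExp.eval, heapKey, heapCell, NExp.eval_var, h.row,
      h.col] at hb
    exact ⟨h, hp, ho.orderedAbove hb⟩

/-- The variable 14 contains the position of the least child, if there is a child. -/
def LeastChild (key : ℕ → R) (H : ℕ → ℕ) (m p q : ℕ) : Prop :=
  0 < q ∧ (q - 1) / 2 = p ∧ (m ≤ q → m ≤ 2 * p + 1) ∧
    ∀ r, 0 < r → r < m → (r - 1) / 2 = p → key (H q) ≤ key (H r)

theorem pickChild_result {X : Finset ℕ} {i j : ℕ} {σ τ : Mem R} (h : Sifting X i j σ τ) :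
    Sifting X i j σ (pickChild.result I τ) ∧ (pickChild.result I τ).var 12 = τ.var 12 ∧
      (pickChild.result I τ).nat 4 = τ.nat 4 ∧
      LeastChild (I.keyAt i j) (τ.nat 4 i j) X.card (τ.var 12) ((pickChild.result I τ).var 14) := by
  set υ := τ.setNat 14 0 0 0 (τ.var 12 + τ.var 12 + 1) with hυ
  have hres : pickChild.result I τ = (Cmd.cond
    (.and (.ltN (.add (.var 14) (.lit 1)) (.var 13))
      (.ltV (heapKey (heapCell (.add (.var 14) (.lit 1)))) (heapKey (heapCell (.var 14)))))
    (Cmd.assign 14 (.add (.var 14) (.lit 1))) Cmd.skip).result I υ := rfl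
  have h' : Sifting X i j σ υ := h.setNat (a := 14) (by decide) _
  have hv₁ : υ.var 12 = τ.var 12 := Mem.setNat_var_of_ne _ (by decide) _ _ _ _
  have hv₂ : υ.var 14 = τ.var 12 + τ.var 12 + 1 := Mem.setNat_var_self _ _ _
  have hn : υ.nat 4 = τ.nat 4 := Mem.setNat_nat_of_ne _ (by decide) _ _ _ _
  rw [hres, Cmd.result]
  simp only [BExp.eval, VExp.eval, NExp.eval, heapKey, heapCell, NExp.eval_var, h'.row,
      h'.col, h'.size, hv₂, hn]
  split_ifs with hb
  · rw [Cmd.result_assign]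
    simp only [NExp.eval, NExp.eval_var, hv₂]
    refine ⟨h'.setNat (by decide) _, ?_, ?_, ?_⟩
    · rw [Mem.setNat_var_of_ne _ (by decide), hv₁]
    · rw [Mem.setNat_nat_of_ne _ (by decide), hn]
    · rw [Mem.setNat_var_self]
      refine ⟨by omega, by omega, by omega, fun r hr hrm hrp => ?_⟩
      obtain rfl | rfl : r = τ.var 12 + τ.var 12 + 1 ∨ r = τ.var 12 + τ.var 12 + 1 + 1 := by omega
      · exact hb.2.le
      · exact le_rfl
  · rw [Cmd.result]
    refine ⟨h', hv₁, hn, ?_⟩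
    rw [hv₂]
    refine ⟨by omega, by omega, by omega, fun r hr hrm hrp => ?_⟩
    obtain rfl | rfl : r = τ.var 12 + τ.var 12 + 1 ∨ r = τ.var 12 + τ.var 12 + 1 + 1 := by omega
    · exact le_rfl
    · exact not_lt.1 fun h => hb ⟨hrm, h⟩

/-- The measure is the binary logarithm of the heap size divided by the position plus one; the step
to a child at least doubles the divisor. -/
theorem siftDown_run {X : Finset ℕ} {i j : ℕ} {σ₀ σ : Mem R} (h : Sifting X i j σ₀ σ)
    (hp : σ.var 12 < X.card)
    (ho : OrderedAbove (I.keyAt i j) (σ.nat 4 i j) X.card (σ.var 12)) :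
    Run I siftDown σ (Nat.log 2 X.card * 12 + 5) fun τ => Sifting X i j σ₀ τ ∧
      Ordered (I.keyAt i j) (τ.nat 4 i j) X.card := by
  have hpick : pickChild.Straight := by simp [pickChild, Cmd.Straight, Cmd.assign]
  have h₁ := pickChild_result (I := I) h
  have h₂ : Run I pickChild σ 4 fun τ => Sifting X i j σ₀ τ ∧ τ.var 12 < X.card ∧
      OrderedAbove (I.keyAt i j) (τ.nat 4 i j) X.card (τ.var 12) ∧
      LeastChild (I.keyAt i j) (τ.nat 4 i j) X.card (τ.var 12) (τ.var 14) := by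
    refine Run.straight hpick ⟨h₁.1, ?_, ?_, ?_⟩
    · rw [h₁.2.1]; exact hp
    · rw [h₁.2.1, h₁.2.2.1]; exact ho
    · rw [h₁.2.1, h₁.2.2.1]; exact h₁.2.2.2
  refine (h₂.seq (T' := Nat.log 2 X.card * (11 + 1) + 1) fun τ _ hτ => ?_).mono (by omega)
    fun _ _ h => h
  clear h₁ h₂ h hp ho
  obtain ⟨h, hp, ho, hl⟩ := hτ
  refine (Run.loop (T := 11) (fun f τ => Nat.log 2 (X.card / (τ.var 12 + 1)) ≤ f ∧
    Sifting X i j σ₀ τ ∧ τ.var 12 < X.card ∧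
    OrderedAbove (I.keyAt i j) (τ.nat 4 i j) X.card (τ.var 12) ∧
    LeastChild (I.keyAt i j) (τ.nat 4 i j) X.card (τ.var 12) (τ.var 14)) ?_ ?_
    (f := Nat.log 2 X.card) ⟨Nat.log_mono_right (Nat.div_le_self _ _), h, hp, ho, hl⟩)
  · clear h hp ho hl
    rintro f τ ⟨hf, h, hp, ho, hl₁, hl₂, hl₃, hl₄⟩ hb
    simp only [BExp.eval, VExp.eval, NExp.eval, heapKey, heapCell, NExp.eval_var, h.row,
      h.col, h.size] at hb
    obtain ⟨hb₁, hb₂⟩ := hb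
    have hlog : Nat.log 2 (X.card / (τ.var 14 + 1)) + 1 ≤ f := by
      refine le_trans ?_ hf
      have h₁ : 2 ≤ X.card / (τ.var 12 + 1) := by
        rw [Nat.le_div_iff_mul_le (by omega)]; omega
      rw [Nat.log_of_one_lt_of_le (n := X.card / (τ.var 12 + 1)) (by norm_num) h₁,
        Nat.div_div_eq_div_mul]
      exact Nat.succ_le_succ (Nat.log_mono_right (Nat.div_le_div_left (by omega) (by omega)))
    refine ⟨f - 1, by omega, Run.straight (c := heapSwap ;; pickChild) ⟨by
      simp [heapSwap, Cmd.Straight, Cmd.assign], hpick⟩ ?_⟩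
    have hsw := h.swap_heap (I := I)
    have h₁ := pickChild_result (I := I) (h.swap (I := I) hp hb₁)
    rw [Cmd.result]
    refine ⟨?_, h₁.1, ?_, ?_, ?_⟩
    all_goals rw [h₁.2.1]
    · rw [(heapSwap_var _).1]; omega
    · rw [(heapSwap_var _).1]; exact hb₁
    · rw [(heapSwap_var _).1, h₁.2.2.1]
      exact ho.swap_down hl₂ hl₁ hb₁ hb₂ hl₄ hsw
    · rw [h₁.2.2.1]; exact h₁.2.2.2
  · clear h hp ho hl
    rintro f τ ⟨hf, h, hp, ho, hl₁, hl₂, hl₃, hl₄⟩ hb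
    simp only [BExp.eval, VExp.eval, NExp.eval, heapKey, heapCell, NExp.eval_var, h.row,
      h.col, h.size] at hb
    refine ⟨h, ho.ordered fun q hq hqm hqp => ?_⟩
    by_cases hm : X.card ≤ τ.var 14
    · have := hl₃ hm
      omega
    · exact (not_lt.1 fun h' => hb ⟨not_le.1 hm, h'⟩).trans (hl₄ q hq hqm hqp)

theorem heapRepair_run {X : Finset ℕ} {i j : ℕ} {σ₀ σ : Mem R} (h : Sifting X i j σ₀ σ)
    (hp : σ.var 12 < X.card)
    (ho : OrderedExcept (I.keyAt i j) (σ.nat 4 i j) X.card (σ.var 12)) :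
    Run I heapRepair σ (Nat.log 2 X.card * 21 + 6) fun τ => Sifting X i j σ₀ τ ∧
      Ordered (I.keyAt i j) (τ.nat 4 i j) X.card := by
  refine ((siftUp_run h hp ho).seq fun τ _ hτ => siftDown_run hτ.1 hτ.2.1 hτ.2.2).mono
    (by omega) fun _ _ h => h

end Memory

end LBDD

namespace LBDD

/-! ### Insertion into and deletion from the heaps -/

/-- The two expressions have different values. -/
def BExp.ne (x y : NExp) : BExp := .not (.and (.not (.ltN x y)) (.not (.ltN y x)))

/-- Deletion of the demand node in the variable 20 from the current heap. -/
def heapDelete : Cmd :=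
  (Cmd.assign 13 (.sub (.get 3 (.var 10) (.lit 0) (.lit 0)) (.lit 1)) ;;
  Cmd.assign 12 (.get 5 (.var 11) (.var 20) (.lit 0)) ;;
  Cmd.assign 15 (heapCell (.var 13)) ;;
  Cmd.setN 4 (.var 10) (.var 11) (.var 12) (.var 15) ;;
  Cmd.setN 5 (.var 11) (.var 15) (.lit 0) (.var 12)) ;;
  Cmd.cond (.ltN (.var 12) (.var 13)) heapRepair Cmd.skip

/-- Insertion of the demand node in the variable 20 into the current heap. -/
def heapInsert : Cmd :=
  (Cmd.assign 12 (.get 3 (.var 10) (.lit 0) (.lit 0)) ;;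
  Cmd.assign 13 (.add (.var 12) (.lit 1)) ;;
  Cmd.setN 4 (.var 10) (.var 11) (.var 12) (.var 20) ;;
  Cmd.setN 5 (.var 11) (.var 20) (.lit 0) (.var 12)) ;;
  heapRepair

variable {R : Type*} [CommRing R] [LinearOrder R] {n k : ℕ} {I : Problem R n k}

theorem BExp.eval_ne (σ : Mem R) (x y : NExp) :
    (BExp.ne x y).eval I σ ↔ x.eval σ ≠ y.eval σ := by
  simp only [BExp.ne, BExp.eval]
  omega

/-- The heap `(i, j)` holds the demand nodes in `X`. -/
structure IsHeap (I : Problem R n k) (X : Finset ℕ) (i j : ℕ) (σ : Mem R) : Prop where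
  indexed : Indexed X (σ.nat 4 i j) fun d => σ.nat 5 j d 0
  ordered : Ordered (I.keyAt i j) (σ.nat 4 i j) X.card

theorem IsHeap.congr {X : Finset ℕ} {i j : ℕ} {σ τ : Mem R} (h : IsHeap I X i j σ)
    (h₁ : τ.nat 4 i j = σ.nat 4 i j) (h₂ : ∀ d ∈ X, τ.nat 5 j d 0 = σ.nat 5 j d 0) :
    IsHeap I X i j τ := by
  refine ⟨⟨fun d hd => ?_, fun d hd => ?_⟩, h₁ ▸ h.ordered⟩
  · rw [h₂ d hd]; exact h.indexed.lt d hd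
  · rw [h₂ d hd, h₁]; exact h.indexed.eq d hd

/-- The last element fills the gap. If `d` itself is last, it is written onto itself, which is
harmless since the new size excludes its cell. -/
theorem Indexed.delete {X : Finset ℕ} {H P H' P' : ℕ → ℕ} (h : Indexed X H P) {d : ℕ} (hd : d ∈ X)
    (hH : ∀ r, H' r = if r = P d then H (X.card - 1) else H r)
    (hP : ∀ e, P' e = if e = H (X.card - 1) then P d else P e) : Indexed (X.erase d) H' P' := by
  have hc : 0 < X.card := Finset.card_pos.2 ⟨d, hd⟩
  obtain ⟨h₁, h₂⟩ := h.mem (p := X.card - 1) (by omega)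
  have key : ∀ e ∈ X.erase d, P' e < X.card - 1 ∧ H' (P' e) = e := by
    intro e he
    obtain ⟨hne, he⟩ := Finset.mem_erase.1 he
    have h₃ := h.lt e he
    have h₄ := h.eq e he
    have h₅ := h.lt d hd
    have h₆ := h.eq d hd
    rw [hP]
    split_ifs with hy
    · refine ⟨?_, by rw [hH, if_pos rfl, hy]⟩
      have : P d ≠ X.card - 1 := fun h' => hne (by rw [hy, ← h', h₆])
      omega
    · have h₇ : P e ≠ X.card - 1 := fun h' => hy (by rw [← h', h₄])
      have h₈ : P e ≠ P d := fun h' => hne (by rw [← h₄, h', h₆])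
      exact ⟨by omega, by rw [hH, if_neg h₈, h₄]⟩
  refine ⟨fun e he => ?_, fun e he => (key e he).2⟩
  rw [Finset.card_erase_of_mem hd]
  exact (key e he).1

/-- The element that fills the gap comes from another branch and may be too small or too large
there, so repair in both directions must be allowed for. -/
theorem heapDelete_run {X : Finset ℕ} {i j d : ℕ} {σ : Mem R} (h : IsHeap I X i j σ) (hd : d ∈ X)
    (h₁₀ : σ.var 10 = i) (h₁₁ : σ.var 11 = j) (h₂₀ : σ.var 20 = d)
    (hocc : σ.nat 3 i 0 0 = X.card) :
    Run I heapDelete σ (Nat.log 2 X.card * 21 + 12) fun τ =>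
      IsHeap I (X.erase d) i j τ ∧ HeapFrame X i j σ τ := by
  have hc : 0 < X.card := Finset.card_pos.2 ⟨d, hd⟩
  have hcard := Finset.card_erase_of_mem hd
  have hm := h.indexed.mem (p := X.card - 1) (by omega)
  have hPd := h.indexed.lt d hd
  have hHd := h.indexed.eq d hd
  have h₁ : Run I (Cmd.assign 13 (.sub (.get 3 (.var 10) (.lit 0) (.lit 0)) (.lit 1)) ;;
      Cmd.assign 12 (.get 5 (.var 11) (.var 20) (.lit 0)) ;;
      Cmd.assign 15 (heapCell (.var 13)) ;;
      Cmd.setN 4 (.var 10) (.var 11) (.var 12) (.var 15) ;;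
      Cmd.setN 5 (.var 11) (.var 15) (.lit 0) (.var 12)) σ 5 fun τ =>
      τ.var 10 = i ∧ τ.var 11 = j ∧ τ.var 13 = X.card - 1 ∧ τ.var 12 = σ.nat 5 j d 0 ∧
      (∀ i' j' l, τ.nat 4 i' j' l = if i' = i ∧ j' = j ∧ l = σ.nat 5 j d 0 then
        σ.nat 4 i j (X.card - 1) else σ.nat 4 i' j' l) ∧
      (∀ j' e l, τ.nat 5 j' e l = if j' = j ∧ e = σ.nat 4 i j (X.card - 1) ∧ l = 0 then
        σ.nat 5 j d 0 else σ.nat 5 j' e l) := by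
    refine Run.straight (by simp [Cmd.Straight, Cmd.assign]) ?_
    have e₁₀ : σ.nat 10 0 0 0 = i := h₁₀
    have e₁₁ : σ.nat 11 0 0 0 = j := h₁₁
    have e₂₀ : σ.nat 20 0 0 0 = d := h₂₀
    simp [Cmd.result, Cmd.assign, NExp.eval, NExp.var, Mem.setNat, Mem.var, heapCell, e₁₀, e₁₁,
      e₂₀, hocc]
  refine (h₁.seq (T' := Nat.log 2 (X.erase d).card * 21 + 6 + 1) fun τ _ hτ => ?_).mono
    (by
      have := Nat.log_mono_right (b := 2) (Finset.card_erase_le (s := X) (a := d))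
      omega) fun _ _ h => h
  obtain ⟨h₂, h₃, h₄, h₅, h₆, h₇⟩ := hτ
  have hrow : ∀ r, τ.nat 4 i j r = if r = σ.nat 5 j d 0 then σ.nat 4 i j (X.card - 1)
      else σ.nat 4 i j r := fun r => by
    simp [h₆]
  have hind : Indexed (X.erase d) (τ.nat 4 i j) fun e => τ.nat 5 j e 0 :=
    h.indexed.delete hd hrow fun e => by simp [h₇]
  have hframe : HeapFrame X i j σ τ := by
    refine ⟨fun i' j' hn => ?_, fun j' e l hn => ?_⟩
    · funext l
      rw [h₆, if_neg (by tauto)]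
    · rw [h₇, if_neg]
      rintro ⟨rfl, rfl, -⟩
      simp [hm.1] at hn
  refine Run.cond (fun hb => ?_) fun hb => ?_
  all_goals simp only [BExp.eval, NExp.eval_var, h₄, h₅] at hb
  · refine (heapRepair_run (X := X.erase d)
      ⟨h₂, h₃, by rw [h₄, hcard], hind, HeapFrame.refl _ _ _ _⟩ (by rw [h₅, hcard]; exact hb)
      ?_).mono le_rfl fun υ _ hυ => ⟨⟨hυ.1.indexed, hυ.2⟩, hframe.trans
        ⟨hυ.1.frame.1, fun j' e l hn => hυ.1.frame.2 j' e l
          (hn.imp id fun h h' => h (Finset.mem_of_mem_erase h'))⟩⟩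
    rw [h₅]
    constructor
    · intro q hq hqm hqp hpar
      rw [hrow, hrow, if_neg hpar, if_neg hqp]
      exact h.ordered q hq (by omega)
    · intro q hq hqm hqp hpos
      rw [hrow, hrow, if_neg (by omega), if_neg (by omega)]
      have hqo := h.ordered q hq (by omega)
      rw [hqp] at hqo
      exact (h.ordered _ hpos hPd).trans hqo
  -- The deleted element was the last one, and the others have kept their places.
  · refine (Run.straight (c := Cmd.skip) trivial ?_).mono
      (show 1 ≤ _ by omega) fun _ _ h => h
    refine ⟨⟨hind, fun q hq hqm => ?_⟩, hframe⟩
    change I.keyAt i j (τ.nat 4 i j _) ≤ I.keyAt i j (τ.nat 4 i j q)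
    rw [hrow, hrow, if_neg (by omega), if_neg (by omega)]
    exact h.ordered q hq (by omega)

theorem Indexed.insert {X : Finset ℕ} {H P H' P' : ℕ → ℕ} (h : Indexed X H P) {d : ℕ} (hd : d ∉ X)
    (hH : ∀ r, H' r = if r = X.card then d else H r)
    (hP : ∀ e, P' e = if e = d then X.card else P e) : Indexed (insert d X) H' P' := by
  have hcard := Finset.card_insert_of_notMem hd
  refine ⟨fun e he => ?_, fun e he => ?_⟩
  · rw [hP]
    split_ifs with hed
    · omega
    · have := h.lt e ((Finset.mem_insert.1 he).resolve_left hed)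
      omega
  · rw [hP]
    split_ifs with hed
    · rw [hH, if_pos rfl, hed]
    · have he' := (Finset.mem_insert.1 he).resolve_left hed
      have := h.lt e he'
      rw [hH, if_neg (by omega), h.eq e he']

theorem heapInsert_run {X : Finset ℕ} {i j d : ℕ} {σ : Mem R} (h : IsHeap I X i j σ) (hd : d ∉ X)
    (h₁₀ : σ.var 10 = i) (h₁₁ : σ.var 11 = j) (h₂₀ : σ.var 20 = d)
    (hocc : σ.nat 3 i 0 0 = X.card) :
    Run I heapInsert σ (Nat.log 2 (X.card + 1) * 21 + 10) fun τ =>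
      IsHeap I (insert d X) i j τ ∧ HeapFrame (insert d X) i j σ τ := by
  have hcard := Finset.card_insert_of_notMem hd
  have h₁ : Run I (Cmd.assign 12 (.get 3 (.var 10) (.lit 0) (.lit 0)) ;;
      Cmd.assign 13 (.add (.var 12) (.lit 1)) ;;
      Cmd.setN 4 (.var 10) (.var 11) (.var 12) (.var 20) ;;
      Cmd.setN 5 (.var 11) (.var 20) (.lit 0) (.var 12)) σ 4 fun τ =>
      τ.var 10 = i ∧ τ.var 11 = j ∧ τ.var 13 = X.card + 1 ∧ τ.var 12 = X.card ∧
      (∀ i' j' l, τ.nat 4 i' j' l = if i' = i ∧ j' = j ∧ l = X.card then d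
        else σ.nat 4 i' j' l) ∧
      (∀ j' e l, τ.nat 5 j' e l = if j' = j ∧ e = d ∧ l = 0 then X.card
        else σ.nat 5 j' e l) := by
    refine Run.straight (by simp [Cmd.Straight, Cmd.assign]) ?_
    have e₁₀ : σ.nat 10 0 0 0 = i := h₁₀
    have e₁₁ : σ.nat 11 0 0 0 = j := h₁₁
    have e₂₀ : σ.nat 20 0 0 0 = d := h₂₀
    simp [Cmd.result, Cmd.assign, NExp.eval, NExp.var, Mem.setNat, Mem.var, e₁₀, e₁₁,
      e₂₀, hocc]
  refine (h₁.seq (T' := Nat.log 2 (insert d X).card * 21 + 6) fun τ _ hτ => ?_).mono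
    (by rw [hcard]; omega) fun _ _ h => h
  obtain ⟨h₂, h₃, h₄, h₅, h₆, h₇⟩ := hτ
  have hrow : ∀ r, τ.nat 4 i j r = if r = X.card then d else σ.nat 4 i j r := fun r => by
    simp [h₆]
  have hs : Sifting (insert d X) i j σ τ := by
    refine ⟨h₂, h₃, by rw [h₄, hcard], ?_, ⟨fun i' j' hn => ?_, fun j' e l hn => ?_⟩⟩
    · exact h.indexed.insert hd hrow fun e => by simp [h₇]
    · funext l
      rw [h₆, if_neg (by tauto)]
    · rw [h₇, if_neg]
      rintro ⟨rfl, rfl, -⟩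
      simp at hn
  refine (heapRepair_run hs (by rw [h₅, hcard]; omega) ?_).mono le_rfl
    fun υ _ hυ => ⟨⟨hυ.1.indexed, hυ.2⟩, hυ.1.frame⟩
  rw [h₅]
  constructor
  · intro q hq hqm hqp hpar
    rw [hrow, hrow, if_neg hpar, if_neg hqp]
    exact h.ordered q hq (by omega)
  · intro q hq hqm hqp hpos
    omega

end LBDD

namespace LBDD

/-! ### Moving a demand node -/

/-- Deletion of the demand node in the variable 20 from the heap of the pair `(22, 11)`. -/
def columnDelete : Cmd :=
  Cmd.cond (.ne (.var 22) (.var 11)) (Cmd.assign 10 (.var 22) ;; heapDelete) Cmd.skip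

/-- Insertion of the demand node in the variable 20 into the heap of the pair `(21, 11)`. -/
def columnInsert : Cmd :=
  Cmd.cond (.ne (.var 21) (.var 11)) (Cmd.assign 10 (.var 21) ;; heapInsert) Cmd.skip

/-- The demand node in the variable 20 is moved from the service center in 22 to that in 21. -/
def moveNode : Cmd :=
  Cmd.forUp 11 0 (columnDelete ;; columnInsert) ;;
  Cmd.setN 2 (.var 20) (.lit 0) (.lit 0) (.var 21) ;;
  Cmd.setN 3 (.var 22) (.lit 0) (.lit 0) (.sub (.get 3 (.var 22) (.lit 0) (.lit 0)) (.lit 1)) ;;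
  Cmd.setN 3 (.var 21) (.lit 0) (.lit 0) (.add (.get 3 (.var 21) (.lit 0) (.lit 0)) (.lit 1))

/-- A new demand node is put into the service center in the variable 6. -/
def insertNode : Cmd :=
  (Cmd.assign 20 (.var 1) ;; Cmd.assign 21 (.var 6)) ;;
  Cmd.forUp 11 0 columnInsert ;;
  Cmd.setN 2 (.var 20) (.lit 0) (.lit 0) (.var 21) ;;
  Cmd.setN 3 (.var 21) (.lit 0) (.lit 0) (.add (.get 3 (.var 21) (.lit 0) (.lit 0)) (.lit 1)) ;;
  Cmd.assign 1 (.add (.var 1) (.lit 1))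

/-- The numbers of the demand nodes at the service center `i`. -/
def nodeSet {n k : ℕ} (A : Allotment n k) (i : Fin k) : Finset ℕ :=
  (Finset.univ.filter (A · = i)).map Fin.valEmbedding

section Nodes

variable {n k : ℕ} {A : Allotment n k}

theorem card_nodeSet (A : Allotment n k) (i : Fin k) : (nodeSet A i).card = occ A i := by
  simp [nodeSet, occ]

theorem mem_nodeSet {i : Fin k} {e : ℕ} : e ∈ nodeSet A i ↔ ∃ d : Fin n, A d = i ∧ (d : ℕ) = e := by
  simp [nodeSet]

theorem val_mem_nodeSet {i : Fin k} {d : Fin n} : (d : ℕ) ∈ nodeSet A i ↔ A d = i := by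
  simp [mem_nodeSet, Fin.val_inj]

theorem nodeSet_disjoint (A : Allotment n k) {i i' : Fin k} (h : i ≠ i') :
    Disjoint (nodeSet A i) (nodeSet A i') := by
  rw [Finset.disjoint_left]
  rintro e he he'
  obtain ⟨d, rfl, rfl⟩ := mem_nodeSet.1 he
  exact h (val_mem_nodeSet.1 he')

theorem nodeSet_update (A : Allotment n k) {d : Fin n} {w : Fin k} (hw : A d ≠ w) :
    nodeSet (Function.update A d w) =
      Function.update (Function.update (nodeSet A) (A d) ((nodeSet A (A d)).erase d)) w
        (insert (d : ℕ) (nodeSet A w)) := by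
  funext i
  ext e
  by_cases he : e < n
  · obtain ⟨f, rfl⟩ : ∃ f : Fin n, (f : ℕ) = e := ⟨⟨e, he⟩, rfl⟩
    rw [val_mem_nodeSet]
    by_cases hi : i = w
    · subst hi
      rw [Function.update_self, Finset.mem_insert, val_mem_nodeSet, Fin.val_inj]
      by_cases hf : f = d
      · subst hf; simp
      · simp [hf]
    · rw [Function.update_of_ne hi]
      by_cases hi' : i = A d
      · subst hi'
        rw [Function.update_self, Finset.mem_erase, val_mem_nodeSet, Ne, Fin.val_inj]
        by_cases hf : f = d
        · subst hf; simp [Ne.symm hw]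
        · simp [hf]
      · rw [Function.update_of_ne hi', val_mem_nodeSet]
        by_cases hf : f = d
        · subst hf
          simp [Ne.symm hi, Ne.symm hi']
        · rw [Function.update_of_ne hf]
  · have hall : ∀ (B : Allotment n k) i, e ∉ nodeSet B i := fun B i h => by
      obtain ⟨f, -, rfl⟩ := mem_nodeSet.1 h
      exact he f.2
    have hed : e ≠ d := fun h => he (h ▸ d.2)
    simp only [hall, false_iff, Function.update_apply]
    split_ifs <;> simp [hall, hed]

theorem nodeSet_snoc (A : Allotment n k) (s : Fin k) :
    nodeSet (Fin.snoc A s : Allotment (n + 1) k) =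
      Function.update (nodeSet A) s (insert n (nodeSet A s)) := by
  funext i
  ext e
  rw [mem_nodeSet, Function.update_apply]
  simp only [Fin.exists_fin_succ', Fin.snoc_castSucc, Fin.snoc_last, Fin.val_castSucc, Fin.val_last]
  split_ifs with hi
  · rw [Finset.mem_insert, mem_nodeSet, hi, or_comm, eq_comm (a := n)]; simp
  · rw [mem_nodeSet]
    simp [Ne.symm hi]

end Nodes

variable {R : Type*} [CommRing R] [LinearOrder R] {n k : ℕ} {I : Problem R n k}

/-- The heaps of the pairs `(i, j)` hold the demand nodes in `X i`. -/
def IsColumn (I : Problem R n k) (X : Fin k → Finset ℕ) (j : Fin k) (σ : Mem R) : Prop :=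
  ∀ i, i ≠ j → IsHeap I (X i) i j σ

/-- Only heaps in the column `j` have changed. -/
def ColumnFrame (j : ℕ) (σ τ : Mem R) : Prop :=
  (∀ i' j', j' ≠ j → τ.nat 4 i' j' = σ.nat 4 i' j') ∧ ∀ j', j' ≠ j → τ.nat 5 j' = σ.nat 5 j'

theorem ColumnFrame.trans {j : ℕ} {σ τ υ : Mem R} (h : ColumnFrame j σ τ)
    (h' : ColumnFrame j τ υ) : ColumnFrame j σ υ :=
  ⟨fun i' j' hj => (h'.1 i' j' hj).trans (h.1 i' j' hj),
    fun j' hj => (h'.2 j' hj).trans (h.2 j' hj)⟩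

theorem HeapFrame.columnFrame {X : Finset ℕ} {i j : ℕ} {σ τ : Mem R} (h : HeapFrame X i j σ τ) :
    ColumnFrame j σ τ :=
  ⟨fun i' j' hj => h.1 i' j' (Or.inr hj), fun j' hj => by
    funext d l
    exact h.2 j' d l (Or.inl hj)⟩

theorem IsColumn.of_frame {X : Fin k → Finset ℕ} {j j' : Fin k} {σ τ : Mem R}
    (h : IsColumn I X j' σ) (hf : ColumnFrame j σ τ) (hj : j' ≠ j) : IsColumn I X j' τ :=
  fun i hi => (h i hi).congr (hf.1 i j' (by simpa [Fin.val_inj] using hj))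
    fun d _ => by rw [hf.2 j' (by simpa [Fin.val_inj] using hj)]

theorem IsColumn.congr {X : Fin k → Finset ℕ} {j : Fin k} {σ τ : Mem R} (h : IsColumn I X j σ)
    (h₄ : τ.nat 4 = σ.nat 4) (h₅ : τ.nat 5 = σ.nat 5) : IsColumn I X j τ :=
  fun i hi => (h i hi).congr (by rw [h₄]) fun d _ => by rw [h₅]

/-- The heaps of a column share the position array, and disjointness of their elements protects the
other heaps. If `u = j` there is no heap to change. -/
theorem columnDelete_run {X : Fin k → Finset ℕ} {j u : Fin k} {d N : ℕ} {σ : Mem R}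
    (h : IsColumn I X j σ) (hX : ∀ i i', i ≠ i' → Disjoint (X i) (X i')) (hd : d ∈ X u)
    (h₁₁ : σ.var 11 = j) (h₂₀ : σ.var 20 = d) (h₂₂ : σ.var 22 = u)
    (hocc : σ.nat 3 u 0 0 = (X u).card) (hN : (X u).card ≤ N) :
    Run I columnDelete σ (Nat.log 2 N * 21 + 14) fun τ =>
      IsColumn I (Function.update X u ((X u).erase d)) j τ ∧ ColumnFrame j σ τ := by
  refine Run.cond (T := Nat.log 2 N * 21 + 13) (fun hb => ?_) fun hb => ?_
  all_goals simp only [BExp.eval_ne, NExp.eval_var, h₁₁, h₂₂, ne_eq, Fin.val_inj, not_not] at hb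
  · have h₁ : Run I (Cmd.assign 10 (.var 22)) σ 1 fun τ => τ = σ.setNat 10 0 0 0 u :=
      Run.straight (c := Cmd.assign 10 (.var 22)) trivial
        (by rw [Cmd.result_assign, NExp.eval_var, h₂₂])
    refine (h₁.seq (T' := Nat.log 2 (X u).card * 21 + 12) fun τ _ hτ => ?_).mono
      (by have := Nat.log_mono_right (b := 2) hN; omega) fun _ _ h => h
    subst hτ
    have h4 : (σ.setNat 10 0 0 0 u).nat 4 = σ.nat 4 := Mem.setNat_nat_of_ne _ (by decide) _ _ _ _
    have h5 : (σ.setNat 10 0 0 0 u).nat 5 = σ.nat 5 := Mem.setNat_nat_of_ne _ (by decide) _ _ _ _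
    have h3 : (σ.setNat 10 0 0 0 u).nat 3 = σ.nat 3 := Mem.setNat_nat_of_ne _ (by decide) _ _ _ _
    have hc := h.congr (τ := σ.setNat 10 0 0 0 u) h4 h5
    refine (heapDelete_run (hc u hb) hd (Mem.setNat_var_self _ _ _)
      (by rw [Mem.setNat_var_of_ne _ (by decide), h₁₁])
      (by rw [Mem.setNat_var_of_ne _ (by decide), h₂₀]) (by rw [h3, hocc])).mono le_rfl
      fun τ _ hτ => ⟨fun i hi => ?_, ?_⟩
    · by_cases hiu : i = u
      · subst hiu; rw [Function.update_self]; exact hτ.1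
      · rw [Function.update_of_ne hiu]
        refine (hc i hi).congr (hτ.2.1 _ _ (Or.inl (by simpa [Fin.val_inj] using hiu)))
          fun e he => hτ.2.2 _ _ _ (Or.inr (Finset.disjoint_left.1 (hX i u hiu) he))
    · have := hτ.2.columnFrame
      rwa [ColumnFrame, h4, h5] at this
  · subst hb
    refine (Run.straight (c := Cmd.skip) trivial ⟨fun i hi => ?_, ?_⟩).mono
      (show 1 ≤ _ by omega) fun _ _ h => h
    · rw [Function.update_of_ne hi]; exact h i hi
    · exact ⟨fun _ _ _ => rfl, fun _ _ => rfl⟩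

/-- A demand node has one position cell per column, so it must be absent from every heap of the
column before it is inserted. -/
theorem columnInsert_run {X : Fin k → Finset ℕ} {j w : Fin k} {d N : ℕ} {σ : Mem R}
    (h : IsColumn I X j σ) (hX : ∀ i i', i ≠ i' → Disjoint (X i) (X i')) (hd : ∀ i, d ∉ X i)
    (h₁₁ : σ.var 11 = j) (h₂₀ : σ.var 20 = d) (h₂₁ : σ.var 21 = w)
    (hocc : σ.nat 3 w 0 0 = (X w).card) (hN : (X w).card + 1 ≤ N) :
    Run I columnInsert σ (Nat.log 2 N * 21 + 12) fun τ =>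
      IsColumn I (Function.update X w (insert d (X w))) j τ ∧ ColumnFrame j σ τ := by
  refine Run.cond (T := Nat.log 2 N * 21 + 11) (fun hb => ?_) fun hb => ?_
  all_goals simp only [BExp.eval_ne, NExp.eval_var, h₁₁, h₂₁, ne_eq, Fin.val_inj, not_not] at hb
  · have h₁ : Run I (Cmd.assign 10 (.var 21)) σ 1 fun τ => τ = σ.setNat 10 0 0 0 w :=
      Run.straight (c := Cmd.assign 10 (.var 21)) trivial
        (by rw [Cmd.result_assign, NExp.eval_var, h₂₁])
    refine (h₁.seq (T' := Nat.log 2 ((X w).card + 1) * 21 + 10) fun τ _ hτ => ?_).mono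
      (by have := Nat.log_mono_right (b := 2) hN; omega) fun _ _ h => h
    subst hτ
    have h4 : (σ.setNat 10 0 0 0 w).nat 4 = σ.nat 4 := Mem.setNat_nat_of_ne _ (by decide) _ _ _ _
    have h5 : (σ.setNat 10 0 0 0 w).nat 5 = σ.nat 5 := Mem.setNat_nat_of_ne _ (by decide) _ _ _ _
    have h3 : (σ.setNat 10 0 0 0 w).nat 3 = σ.nat 3 := Mem.setNat_nat_of_ne _ (by decide) _ _ _ _
    have hc := h.congr (τ := σ.setNat 10 0 0 0 w) h4 h5
    refine (heapInsert_run (hc w hb) (hd w) (Mem.setNat_var_self _ _ _)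
      (by rw [Mem.setNat_var_of_ne _ (by decide), h₁₁])
      (by rw [Mem.setNat_var_of_ne _ (by decide), h₂₀]) (by rw [h3, hocc])).mono le_rfl
      fun τ _ hτ => ⟨fun i hi => ?_, ?_⟩
    · by_cases hiu : i = w
      · subst hiu; rw [Function.update_self]; exact hτ.1
      · rw [Function.update_of_ne hiu]
        refine (hc i hi).congr (hτ.2.1 _ _ (Or.inl (by simpa [Fin.val_inj] using hiu)))
          fun e he => hτ.2.2 _ _ _ (Or.inr fun h' => ?_)
        rcases Finset.mem_insert.1 h' with rfl | h'
        · exact hd i he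
        · exact Finset.disjoint_left.1 (hX i w hiu) he h'
    · have := hτ.2.columnFrame
      rwa [ColumnFrame, h4, h5] at this
  · subst hb
    refine (Run.straight (c := Cmd.skip) trivial ⟨fun i hi => ?_, ?_⟩).mono
      (show 1 ≤ _ by omega) fun _ _ h => h
    · rw [Function.update_of_ne hi]; exact h i hi
    · exact ⟨fun _ _ _ => rfl, fun _ _ => rfl⟩

theorem Problem.costAt_val (I : Problem R n k) (d : Fin n) (i : Fin k) :
    I.costAt d i = I.cost d i := by
  simp [Problem.costAt]

/-- Two instances are allowed so that the heaps of the instance without the new demand node count as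
heaps for the full instance. -/
theorem Stores.isColumn {n' : ℕ} {I' : Problem R n' k} {A : Allotment n' k} {σ : Mem R}
    (h : Stores I' A σ) (hI : ∀ (d : Fin n') (i : Fin k), I.costAt d i = I'.cost d i) (j : Fin k) :
    IsColumn I (nodeSet A) j σ := by
  intro i hij
  have hind : Indexed (nodeSet A i) (σ.nat 4 i j) fun d => σ.nat 5 j d 0 := by
    constructor
    all_goals
      intro e he
      obtain ⟨d, rfl, rfl⟩ := mem_nodeSet.1 he
      have := h.position d j hij.symm
    · rw [card_nodeSet]; exact this.1
    · exact this.2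
  refine ⟨hind, fun q hq hqm => ?_⟩
  obtain ⟨h₁, h₂⟩ := hind.mem hqm
  obtain ⟨h₃, h₄⟩ := hind.mem (p := (q - 1) / 2) (by omega)
  obtain ⟨e, he, he'⟩ := mem_nodeSet.1 h₁
  obtain ⟨d, hd, hd'⟩ := mem_nodeSet.1 h₃
  rw [← he'] at h₂ ⊢
  rw [← hd'] at h₄ ⊢
  have := h.ordered d e j (hd.trans he.symm) (he ▸ hij.symm) (h₂ ▸ hq) (by rw [h₂, h₄])
  simpa only [Problem.keyAt, hI, Problem.transferCost, hd, he] using this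

theorem stores_of_isColumn {A : Allotment n k} {σ : Mem R} (h₀ : σ.var 0 = k) (h₁ : σ.var 1 = n)
    (h₂ : ∀ d : Fin n, σ.nat 2 d 0 0 = A d) (h₃ : ∀ i : Fin k, σ.nat 3 i 0 0 = occ A i)
    (h : ∀ j, IsColumn I (nodeSet A) j σ) : Stores I A σ := by
  refine ⟨h₀, h₁, h₂, h₃, fun d j hj => ?_, fun d e j hde hj hpos hpar => ?_⟩
  · have hd : (d : ℕ) ∈ nodeSet A (A d) := val_mem_nodeSet.2 rfl
    have := (h j (A d) hj.symm).indexed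
    exact ⟨card_nodeSet A _ ▸ this.lt d hd, this.eq d hd⟩
  · have hh := h j (A e) hj.symm
    have hd : (d : ℕ) ∈ nodeSet A (A e) := val_mem_nodeSet.2 hde
    have he : (e : ℕ) ∈ nodeSet A (A e) := val_mem_nodeSet.2 rfl
    have := hh.ordered _ hpos (hh.indexed.lt e he)
    rw [hh.indexed.eq e he, ← hpar, hh.indexed.eq d hd] at this
    simpa only [Problem.keyAt, Problem.costAt_val, Problem.transferCost, hde] using this

end LBDD

/-! ### Correctness and cost of moving and of inserting a demand node -/

namespace LBDD

variable {R : Type*} [CommRing R] [LinearOrder R] {n k : ℕ} {I : Problem R n k}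

theorem occ_lt_of_ne (A : Allotment n k) {d : Fin n} {w : Fin k} (h : A d ≠ w) :
    occ A w + 1 ≤ n := by
  have : (Finset.univ.filter fun e => A e = w) ⊂ Finset.univ := by
    refine Finset.ssubset_univ_iff.2 fun h' => h ?_
    have := h' ▸ Finset.mem_univ d
    exact (Finset.mem_filter.1 this).2
  have := Finset.card_lt_card this
  simpa [occ] using this

theorem occ_le (A : Allotment n k) (w : Fin k) : occ A w ≤ n := by
  simpa [occ] using Finset.card_filter_le (Finset.univ : Finset (Fin n)) fun d => A d = w

/-- Different columns use disjoint parts of the heap and position arrays, so they can be treated one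
after another. -/
theorem columns_run {c : Cmd} {T : ℕ} {X Y : Fin k → Finset ℕ} {σ : Mem R} (h₀ : σ.var 0 = k)
    (h : ∀ j, IsColumn I X j σ) (hc₁ : 11 ∉ c.natWrites) (hc₀ : 0 ∉ c.natWrites)
    (hc : ∀ (j : Fin k) (τ : Mem R), (Cmd.forUp 11 0 c).Frame σ τ → τ.var 11 = j →
      IsColumn I X j τ → Run I c τ T fun υ => IsColumn I Y j υ ∧ ColumnFrame j τ υ) :
    Run I (Cmd.forUp 11 0 c) σ (k * (T + 2) + 2) fun τ => ∀ j, IsColumn I Y j τ := by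
  have h₁ : ∀ (j : Fin k) (Z : Fin k → Finset ℕ) (τ : Mem R) (x : ℕ), IsColumn I Z j τ →
      IsColumn I Z j (τ.setNat 11 0 0 0 x) := fun j Z τ x h =>
    h.congr (Mem.setNat_nat_of_ne _ (by decide) _ _ _ _) (Mem.setNat_nat_of_ne _ (by decide) _ _ _ _)
  refine (Run.forUp (N := k) (fun m τ => ∀ j : Fin k, IsColumn I (if (j : ℕ) < m then Y else X) j τ)
    (by decide) hc₁ hc₀ h₀ (fun j => by simpa using h₁ j X σ 0 (h j)) ?_).mono le_rfl
    fun τ _ hτ j => by simpa using hτ j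
  intro m hm τ hF hτ hI
  have hX : IsColumn I X ⟨m, hm⟩ τ := by simpa using hI ⟨m, hm⟩
  refine (hc ⟨m, hm⟩ τ hF hτ hX).mono le_rfl fun υ _ hυ j => h₁ _ _ _ _ ?_
  by_cases hj : j = ⟨m, hm⟩
  · subst hj
    simpa using hυ.1
  · have hjm : (j : ℕ) ≠ m := fun h => hj (Fin.ext h)
    have : ((j : ℕ) < m + 1) = ((j : ℕ) < m) := by
      apply propext; omega
    simp only [this]
    exact (hI j).of_frame hυ.2 hj

/-- During the loop the occupancies are still the old ones. These are the sizes that deletion at `A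
d` and insertion at `w ≠ A d` expect, so they are updated only afterwards. -/
theorem moveNode_run {A : Allotment n k} {σ : Mem R} (h : Stores I A σ) {d : Fin n} {w : Fin k}
    (hw : A d ≠ w) (h₂₀ : σ.var 20 = d) (h₂₁ : σ.var 21 = w) (h₂₂ : σ.var 22 = A d) :
    Run I moveNode σ (k * (Nat.log 2 n * 42 + 28) + 5) (Stores I (Function.update A d w)) := by
  have hcol := h.isColumn (I := I) fun d i => I.costAt_val d i
  have hX : ∀ i i', i ≠ i' → Disjoint (nodeSet A i) (nodeSet A i') := fun i i' =>
    nodeSet_disjoint A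
  have hd : (d : ℕ) ∈ nodeSet A (A d) := val_mem_nodeSet.2 rfl
  have hloop : Run I (Cmd.forUp 11 0 (columnDelete ;; columnInsert)) σ
      (k * (Nat.log 2 n * 42 + 26 + 2) + 2) fun τ =>
        ∀ j, IsColumn I (nodeSet (Function.update A d w)) j τ := by
    refine columns_run h.centers hcol (by decide) (by decide) fun j τ hF hτ hXj => ?_
    have h₂₀' := (hF.var_eq (a := 20) (by decide)).trans h₂₀
    have h₂₁' := (hF.var_eq (a := 21) (by decide)).trans h₂₁
    have h₂₂' := (hF.var_eq (a := 22) (by decide)).trans h₂₂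
    have h3 : τ.nat 3 = σ.nat 3 := hF.1 3 (by decide)
    refine ((columnDelete_run (N := n) hXj hX hd hτ h₂₀' h₂₂'
      (by rw [h3, h.occupancy, card_nodeSet]) (by rw [card_nodeSet]; exact occ_le A _)).seq
      (T' := Nat.log 2 n * 21 + 12) fun υ hFυ hυ => ?_).mono (by omega) fun _ _ h => h
    refine (columnInsert_run (N := n) (d := d) (w := w) hυ.1 ?_ ?_
      ((hFυ.var_eq (a := 11) (by decide)).trans hτ)
      ((hFυ.var_eq (a := 20) (by decide)).trans h₂₀')
      ((hFυ.var_eq (a := 21) (by decide)).trans h₂₁') ?_ ?_).mono le_rfl fun ω _ hω => ⟨?_, ?_⟩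
    · have hsub : ∀ i, Function.update (nodeSet A) (A d) ((nodeSet A (A d)).erase d) i ⊆
          nodeSet A i := fun i => by
        by_cases hi : i = A d
        · subst hi; rw [Function.update_self]; exact Finset.erase_subset _ _
        · rw [Function.update_of_ne hi]
      exact fun i i' hii => Finset.disjoint_of_subset_left (hsub i)
        (Finset.disjoint_of_subset_right (hsub i') (hX i i' hii))
    · intro i
      by_cases hi : i = A d
      · subst hi; rw [Function.update_self]; exact Finset.notMem_erase _ _
      · rw [Function.update_of_ne hi, val_mem_nodeSet]; exact Ne.symm hi
    · rw [hFυ.1 3 (by decide), h3, h.occupancy, Function.update_of_ne hw.symm, card_nodeSet]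
    · rw [Function.update_of_ne hw.symm, card_nodeSet]
      exact occ_lt_of_ne A hw
    · have := hω.1
      rwa [Function.update_of_ne hw.symm, ← nodeSet_update A hw] at this
    · exact hυ.2.trans hω.2
  refine (hloop.seq (T' := 3) fun τ hF hτ => ?_).mono (by ring_nf; omega) fun _ _ h => h
  have h₂₀' : τ.nat 20 0 0 0 = d := (hF.var_eq (a := 20) (by decide)).trans h₂₀
  have h₂₁' : τ.nat 21 0 0 0 = w := (hF.var_eq (a := 21) (by decide)).trans h₂₁
  have h₂₂' : τ.nat 22 0 0 0 = A d := (hF.var_eq (a := 22) (by decide)).trans h₂₂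
  have h₀ : τ.nat 0 0 0 0 = k := (hF.var_eq (a := 0) (by decide)).trans h.centers
  have h₁ : τ.nat 1 0 0 0 = n := (hF.var_eq (a := 1) (by decide)).trans h.nodes
  have h₂ : ∀ e : Fin n, τ.nat 2 e 0 0 = A e := fun e => by
    rw [hF.1 2 (by decide), h.assigned]
  have h₃ : ∀ i : Fin k, τ.nat 3 i 0 0 = occ A i := fun e => by
    rw [hF.1 3 (by decide), h.occupancy]
  have hne : (A d : ℕ) ≠ w := by simpa [Fin.val_inj] using hw
  refine Run.straight (by simp [Cmd.Straight]) ?_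
  refine stores_of_isColumn ?_ ?_ (fun e => ?_) (fun i => ?_) fun j => (hτ j).congr ?_ ?_
  · simpa [Cmd.result, NExp.eval, NExp.var, Mem.setNat, Mem.var] using h₀
  · simpa [Cmd.result, NExp.eval, NExp.var, Mem.setNat, Mem.var] using h₁
  · simp only [Cmd.result, NExp.eval, NExp.var, Mem.setNat]
    simp only [h₂₀', h₂₁', h₂, Function.update_apply]
    by_cases he : e = d <;> simp [he, Fin.val_inj]
  · have hocc := occ_update A d w i
    simp only [Cmd.result, NExp.eval, NExp.var, Mem.setNat]
    simp [h₂₁', h₂₂', h₃, Fin.val_inj, hw.symm]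
    by_cases hi : i = w
    · subst hi
      simp [hw.symm] at hocc ⊢
      exact hocc.symm
    · by_cases hi' : i = A d
      · subst hi'
        simp [hw] at hocc ⊢
        omega
      · simp [hi, hi'] at hocc ⊢
        exact hocc.symm
  · funext i' j' l
    simp [Cmd.result, NExp.eval, NExp.var, Mem.setNat]
  · funext i' j' l
    simp [Cmd.result, NExp.eval, NExp.var, Mem.setNat]

theorem insertNode_run {I : Problem R (n + 1) k} {A : Allotment n k} {σ : Mem R}
    (h : Stores I.dropLast A σ) {s : Fin k} (hs : σ.var 6 = s) :
    Run I insertNode σ (k * (Nat.log 2 (n + 1) * 21 + 14) + 7) fun τ =>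
      Stores I (Fin.snoc A s : Allotment (n + 1) k) τ ∧ τ.var 6 = s := by
  have h₁ : Run I (Cmd.assign 20 (.var 1) ;; Cmd.assign 21 (.var 6)) σ 2 fun τ =>
      τ.var 20 = n ∧ τ.var 21 = s := by
    refine Run.straight (by simp [Cmd.Straight, Cmd.assign]) ?_
    have e₁ : σ.nat 1 0 0 0 = n := h.nodes
    have e₂ : σ.nat 6 0 0 0 = s := hs
    simp [Cmd.result, Cmd.assign, NExp.eval, NExp.var, Mem.setNat, Mem.var, e₁, e₂]
  refine (h₁.seq (T' := k * (Nat.log 2 (n + 1) * 21 + 12 + 2) + 2 + 3) fun σ₁ hF₁ hσ₁ => ?_).mono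
    (by ring_nf; omega) fun _ _ h => h
  have hcol : ∀ j, IsColumn I (nodeSet A) j σ₁ := fun j =>
    (h.isColumn (I := I) (fun d i => by
      rw [← Fin.val_castSucc, I.costAt_val]; rfl) j).congr (hF₁.1 4 (by decide))
      (hF₁.1 5 (by decide))
  have hloop : Run I (Cmd.forUp 11 0 columnInsert) σ₁
      (k * (Nat.log 2 (n + 1) * 21 + 12 + 2) + 2) fun τ =>
        ∀ j, IsColumn I (nodeSet (Fin.snoc A s : Allotment (n + 1) k)) j τ := by
    refine columns_run ((hF₁.var_eq (a := 0) (by decide)).trans h.centers) hcol (by decide)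
      (by decide) fun j τ hF hτ hXj => ?_
    rw [nodeSet_snoc]
    refine columnInsert_run hXj (fun i i' => nodeSet_disjoint A) (fun i hi => ?_) hτ
      ((hF.var_eq (a := 20) (by decide)).trans hσ₁.1)
      ((hF.var_eq (a := 21) (by decide)).trans hσ₁.2) ?_ ?_
    · obtain ⟨d, -, hd⟩ := mem_nodeSet.1 hi
      exact absurd d.2 (by omega)
    · rw [hF.1 3 (by decide), hF₁.1 3 (by decide), h.occupancy, card_nodeSet]
    · rw [card_nodeSet]; exact Nat.succ_le_succ (occ_le A s)
  refine hloop.seq fun τ hF hτ => ?_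
  have h₂₀' : τ.nat 20 0 0 0 = n := (hF.var_eq (a := 20) (by decide)).trans hσ₁.1
  have h₂₁' : τ.nat 21 0 0 0 = s := (hF.var_eq (a := 21) (by decide)).trans hσ₁.2
  have hv : ∀ a, a ∉ (Cmd.forUp 11 0 columnInsert).natWrites →
      a ∉ (Cmd.assign 20 (.var 1) ;; Cmd.assign 21 (.var 6)).natWrites → τ.nat a = σ.nat a :=
    fun a h h' => (hF.1 a h).trans (hF₁.1 a h')
  have h₀ : τ.nat 0 0 0 0 = k := by rw [hv 0 (by decide) (by decide)]; exact h.centers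
  have h₁ : τ.nat 1 0 0 0 = n := by rw [hv 1 (by decide) (by decide)]; exact h.nodes
  have h₆ : τ.nat 6 0 0 0 = s := by rw [hv 6 (by decide) (by decide)]; exact hs
  have h₂ : ∀ e : Fin n, τ.nat 2 e 0 0 = A e := fun e => by
    rw [hv 2 (by decide) (by decide), h.assigned]
  have h₃ : ∀ i : Fin k, τ.nat 3 i 0 0 = occ A i := fun e => by
    rw [hv 3 (by decide) (by decide), h.occupancy]
  refine Run.straight (by simp [Cmd.Straight, Cmd.assign]) ⟨?_, ?_⟩
  · refine stores_of_isColumn ?_ ?_ (fun e => ?_) (fun i => ?_) fun j => (hτ j).congr ?_ ?_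
    · simpa [Cmd.result, Cmd.assign, NExp.eval, NExp.var, Mem.setNat, Mem.var] using h₀
    · simpa [Cmd.result, Cmd.assign, NExp.eval, NExp.var, Mem.setNat, Mem.var] using h₁
    · simp only [Cmd.result, Cmd.assign, NExp.eval, NExp.var, Mem.setNat]
      refine Fin.lastCases ?_ (fun e => ?_) e
      · simp [h₂₀', h₂₁']
      · have : (e : ℕ) ≠ n := e.2.ne
        simp [h₂₀', h₂, this]
    · simp only [Cmd.result, Cmd.assign, NExp.eval, NExp.var, Mem.setNat, Problem.occ_snoc]
      by_cases hi : i = s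
      · subst hi; simp [h₂₁', h₃]
      · simp [h₂₁', h₃, hi, Fin.val_inj]
    · funext i' j' l
      simp [Cmd.result, Cmd.assign, NExp.eval, NExp.var, Mem.setNat]
    · funext i' j' l
      simp [Cmd.result, Cmd.assign, NExp.eval, NExp.var, Mem.setNat]
  · simpa [Cmd.result, Cmd.assign, NExp.eval, NExp.var, Mem.setNat, Mem.var] using h₆

end LBDD

namespace LBDD

/-! ### The tables of arc weights and cheapest transfers

The vertex `some i` is represented by the number `i`, the vertex `none` by `k`. -/

/-- The number that represents a vertex in the memory. -/
def code {k : ℕ} (v : Option (Fin k)) : ℕ := v.elim k Fin.val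

/-- The amount by which the occupancy of the service center in the variable `i` is decreased: the
value `0` or `1` of the variable 34, if it is the one in the variable 6. -/
def shift (i : ℕ) : NExp :=
  .sub (.var 34) (.add (.sub (.var i) (.var 6)) (.sub (.var 6) (.var i)))

/-- Computation of the weight and the cheapest demand node of the arc from the vertex in the
variable 30 to the vertex in the variable 31. -/
def fillCell : Cmd :=
  Cmd.cond (.ne (.var 30) (.var 31))
    (Cmd.cond (.ltN (.var 30) (.var 0))
      (Cmd.cond (.ltN (.var 31) (.var 0))
        (Cmd.setN 41 (.var 30) (.var 31) (.lit 0) (.get 4 (.var 30) (.var 31) (.lit 0)) ;;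
          Cmd.setV 0 (.var 30) (.var 31) (.lit 0)
            (.sub (.cost (.get 4 (.var 30) (.var 31) (.lit 0)) (.var 31))
              (.cost (.get 4 (.var 30) (.var 31) (.lit 0)) (.var 30))))
        (Cmd.setV 0 (.var 30) (.var 31) (.lit 0)
          (.pen (.var 30)
            (.sub (.add (.get 3 (.var 30) (.lit 0) (.lit 0)) (.lit 1)) (shift 30)))))
      (Cmd.setV 0 (.var 30) (.var 31) (.lit 0)
        (.sub .zero (.pen (.var 31) (.sub (.get 3 (.var 31) (.lit 0) (.lit 0)) (shift 31))))))
    (Cmd.setV 0 (.var 30) (.var 31) (.lit 0) .zero)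

def fillTables : Cmd :=
  Cmd.assign 33 (.add (.var 0) (.lit 1)) ;;
  Cmd.forUp 30 33 (Cmd.forUp 31 33 fillCell)

theorem code_some {k : ℕ} (i : Fin k) : code (some i) = i := rfl

theorem code_none {k : ℕ} : code (none : Option (Fin k)) = k := rfl

theorem code_lt {k : ℕ} (v : Option (Fin k)) : code v < k + 1 := by
  rcases v with _ | i
  · exact Nat.lt_succ_self k
  · exact i.2.trans (Nat.lt_succ_self k)

theorem code_injective {k : ℕ} : Function.Injective (code : Option (Fin k) → ℕ) := by
  rintro (_ | i) (_ | j) h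
  · rfl
  · exact absurd h (ne_of_gt j.2)
  · exact absurd h (ne_of_lt i.2)
  · exact congrArg some (Fin.ext h)

theorem exists_code_eq {k c : ℕ} (h : c < k + 1) : ∃ v : Option (Fin k), code v = c := by
  rcases Nat.lt_succ_iff_lt_or_eq.1 h with h | rfl
  · exact ⟨some ⟨c, h⟩, rfl⟩
  · exact ⟨none, rfl⟩

variable {R : Type*} [CommRing R] [LinearOrder R] {n k : ℕ} {I J : Problem R n k}

theorem Stores.of_nat_eq {A : Allotment n k} {σ τ : Mem R} (h : Stores I A σ)
    (h' : ∀ a < 6, τ.nat a = σ.nat a) : Stores I A τ := by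
  obtain ⟨h₀, h₁, h₂, h₃, h₄, h₅⟩ := h
  constructor
  all_goals simp only [h' 0 (by decide), h' 1 (by decide), h' 2 (by decide), h' 3 (by decide),
    h' 4 (by decide), h' 5 (by decide)]
  all_goals assumption

theorem Stores.of_frame {A : Allotment n k} {σ τ : Mem R} {c : Cmd} (h : Stores I A σ)
    (hF : c.Frame σ τ) (hc : ∀ a < 6, a ∉ c.natWrites) : Stores I A τ :=
  h.of_nat_eq fun a ha => hF.1 a (hc a ha)

/-- The root of a heap is a demand node of least transfer cost. -/
theorem Stores.exists_top {A : Allotment n k} {σ : Mem R} (h : Stores I A σ) {u v : Fin k}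
    (huv : u ≠ v) (hu : 0 < occ A u) : ∃ d : Fin n, σ.nat 4 u v 0 = d ∧ A d = u ∧
      ∀ e, A e = u → I.transferCost A d v ≤ I.transferCost A e v := by
  obtain ⟨hi, ho⟩ := h.isColumn (I := I) (fun d i => I.costAt_val d i) v u huv
  rw [← card_nodeSet] at hu
  obtain ⟨d, hd, hd'⟩ := mem_nodeSet.1 (hi.mem hu).1
  refine ⟨d, hd'.symm, hd, fun e he => ?_⟩
  have hm := val_mem_nodeSet.2 he
  have := ho.min (hi.lt e hm)
  rw [hi.eq e hm, ← hd'] at this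
  simpa [Problem.keyAt, Problem.costAt_val, Problem.transferCost, hd, he] using this

theorem occ_pos {A : Allotment n k} {u : Fin k} : 0 < occ A u ↔ ∃ d, A d = u := by
  simp [occ, Finset.card_pos, Finset.filter_nonempty_iff]

/-- The tables contain the correct weight and the correct demand node of the arc from `u` to
`v`. -/
structure CellFilled (J : Problem R n k) (A : Allotment n k) (u v : Option (Fin k)) (σ : Mem R) :
    Prop where
  weight : J.arc A Finset.univ u v ≠ ⊤ →
    J.arc A Finset.univ u v = (σ.val 0 (code u) (code v) 0 : WithTop R)
  node : ∀ x y, u = some x → v = some y → x ≠ y → 0 < occ A x →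
    ∃ d : Fin n, σ.nat 41 x y 0 = d ∧ A d = x ∧
      J.arc A Finset.univ (some x) (some y) = (J.transferCost A d y : WithTop R)

theorem CellFilled.congr {A : Allotment n k} {u v : Option (Fin k)} {σ τ : Mem R}
    (h : CellFilled J A u v σ)
    (h₁ : τ.val 0 (code u) (code v) 0 = σ.val 0 (code u) (code v) 0)
    (h₂ : τ.nat 41 (code u) (code v) 0 = σ.nat 41 (code u) (code v) 0) : CellFilled J A u v τ := by
  refine ⟨h₁ ▸ h.weight, fun x y hx hy => ?_⟩
  subst hx hy
  simp only [code_some] at h₂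
  rw [h₂]
  exact h.node x y rfl rfl

theorem CellFilled.of_ne {A : Allotment n k} {u v u' v' : Option (Fin k)} {σ τ : Mem R}
    (h : CellFilled J A u v σ) (hne : ¬ (u = u' ∧ v = v'))
    (h₁ : ∀ i j, ¬ (i = code u' ∧ j = code v') → τ.val 0 i j 0 = σ.val 0 i j 0)
    (h₂ : ∀ i j, ¬ (i = code u' ∧ j = code v') → τ.nat 41 i j 0 = σ.nat 41 i j 0) :
    CellFilled J A u v τ := by
  have : ¬ (code u = code u' ∧ code v = code v') := fun h =>
    hne ⟨code_injective h.1, code_injective h.2⟩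
  exact h.congr (h₁ _ _ this) (h₂ _ _ this)

/-- The penalties of `J` at the occupancies of `A` are those of `I`, the occupancy of `s` being
decreased by `δ`. -/
structure Shifts (I J : Problem R n k) (A : Allotment n k) (s : Fin k) (δ : ℕ) : Prop where
  cost : J.cost = I.cost
  pen : ∀ u, J.pen u (occ A u) = I.pen u (occ A u - (δ - ((u - s) + (s - u) : ℕ)))
  pen_succ : ∀ u, J.pen u (occ A u + 1) = I.pen u (occ A u + 1 - (δ - ((u - s) + (s - u) : ℕ)))

theorem Problem.penAt_val (I : Problem R n k) (i : Fin k) (m : ℕ) : I.penAt i m = I.pen i m := by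
  simp [Problem.penAt]

variable [IsStrictOrderedRing R]

/-- The weight is taken from the root of the heap. If the center is empty, an arbitrary value is
stored, which `CellFilled` permits because it makes no claim about infinite arcs. -/
theorem fillCell_result {A : Allotment n k} {s : Fin k} {δ : ℕ} {σ : Mem R}
    (h : Stores I A σ) (hJ : Shifts I J A s δ) (h₆ : σ.var 6 = s) (h₃₄ : σ.var 34 = δ)
    {u v : Option (Fin k)} (hu : σ.var 30 = code u) (hv : σ.var 31 = code v) :
    CellFilled J A u v (fillCell.result I σ) ∧
      (∀ i j, ¬ (i = code u ∧ j = code v) →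
        (fillCell.result I σ).val 0 i j 0 = σ.val 0 i j 0) ∧
      ∀ i j, ¬ (i = code u ∧ j = code v) →
        (fillCell.result I σ).nat 41 i j 0 = σ.nat 41 i j 0 := by
  have h₀ : σ.var 0 = k := h.centers
  have e₁ : ∀ x, ((Cmd.setV 0 (.var 30) (.var 31) (.lit 0) x).result I σ) =
      σ.setVal 0 (code u) (code v) 0 (x.eval I σ) := fun x => by
    simp only [Cmd.result, NExp.eval_var, hu, hv, NExp.eval]
  have e₂ : ∀ c, (∀ i j, ¬ (i = code u ∧ j = code v) →
        (σ.setVal 0 (code u) (code v) 0 c).val 0 i j 0 = σ.val 0 i j 0) ∧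
      ∀ i j, ¬ (i = code u ∧ j = code v) →
        (σ.setVal 0 (code u) (code v) 0 c).nat 41 i j 0 = σ.nat 41 i j 0 := fun c =>
    ⟨fun i j hij => by simp only [Mem.setVal_val_self, and_true, if_neg hij], fun _ _ _ => rfl⟩
  rw [fillCell, Cmd.result]
  simp only [BExp.eval_ne, NExp.eval_var, hu, hv]
  split_ifs with huv
  swap
  · rw [e₁]
    obtain rfl : u = v := code_injective (not_not.1 huv)
    refine ⟨⟨fun _ => ?_, ?_⟩, e₂ _⟩
    · rw [Problem.arc_self]; simp [Mem.setVal, VExp.eval]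
    · rintro x y rfl hxy hne
      exact absurd (Option.some.inj hxy) hne
  rw [Cmd.result]
  simp only [BExp.eval, NExp.eval_var, hu, h₀]
  rcases u with _ | u
  · rw [if_neg (by simp [code_none]), e₁]
    refine ⟨⟨fun _ => ?_, by simp⟩, e₂ _⟩
    rcases v with _ | v
    · exact absurd rfl huv
    have h₃ := h.occupancy v
    simp [Problem.arc, Mem.setVal, VExp.eval, NExp.eval, shift, NExp.eval_var, hv, h₃, h₆, h₃₄,
      code_some, I.penAt_val, hJ.pen v]
  rw [if_pos (by simp [code_some])]
  rw [Cmd.result]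
  simp only [BExp.eval, NExp.eval_var, hv, h₀]
  rcases v with _ | v
  · rw [if_neg (by simp [code_none]), e₁]
    refine ⟨⟨fun _ => ?_, by simp⟩, e₂ _⟩
    have h₃ := h.occupancy u
    simp [Problem.arc, Mem.setVal, VExp.eval, NExp.eval, shift, NExp.eval_var, hu, h₃, h₆, h₃₄,
      code_some, I.penAt_val, hJ.pen_succ u]
  rw [if_pos (by simp [code_some])]
  have huv' : u ≠ v := fun h => huv (by rw [h])
  have e₃ : (Cmd.setN 41 (.var 30) (.var 31) (.lit 0) (.get 4 (.var 30) (.var 31) (.lit 0)) ;;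
          Cmd.setV 0 (.var 30) (.var 31) (.lit 0)
            (.sub (.cost (.get 4 (.var 30) (.var 31) (.lit 0)) (.var 31))
              (.cost (.get 4 (.var 30) (.var 31) (.lit 0)) (.var 30)))).result I σ =
      (σ.setNat 41 u v 0 (σ.nat 4 u v 0)).setVal 0 u v 0
        (I.costAt (σ.nat 4 u v 0) v - I.costAt (σ.nat 4 u v 0) u) := by
    have hu' : (σ.setNat 41 u v 0 (σ.nat 4 u v 0)).var 30 = u := by
      rw [Mem.setNat_var_of_ne _ (by decide), hu, code_some]
    have hv' : (σ.setNat 41 u v 0 (σ.nat 4 u v 0)).var 31 = v := by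
      rw [Mem.setNat_var_of_ne _ (by decide), hv, code_some]
    simp only [Cmd.result, NExp.eval_var, NExp.eval, VExp.eval, hu, hv, code_some, hu', hv',
      Mem.setNat_nat_of_ne _ (show 4 ≠ 41 by decide)]
  rw [e₃]
  simp only [code_some]
  refine ⟨?_, fun i j hij => ?_, fun i j hij => ?_⟩
  · have key : 0 < occ A u → ∃ d : Fin n, σ.nat 4 u v 0 = d ∧ A d = u ∧
        J.arc A Finset.univ (some u) (some v) = (J.transferCost A d v : WithTop R) := by
      intro ho
      obtain ⟨d, hd, hd', hmin⟩ := h.exists_top huv' ho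
      refine ⟨d, hd, hd', le_antisymm ?_ ?_⟩
      · exact hd' ▸ Problem.arc_le (Finset.mem_univ d) v
      · simp only [Problem.arc, if_neg huv']
        refine Finset.le_inf fun e he => WithTop.coe_le_coe.2 ?_
        have := hmin e (Finset.mem_filter.1 he).2
        simpa [Problem.transferCost, hJ.cost] using this
    refine ⟨fun hw => ?_, ?_⟩
    · obtain ⟨d, -, hd, -⟩ := Problem.exists_arc_eq huv' hw
      obtain ⟨e, he, he', hw'⟩ := key (occ_pos.2 ⟨d, hd⟩)
      rw [hw']
      simp [Mem.setVal, code_some, he, I.costAt_val, Problem.transferCost, he', hJ.cost]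
    · rintro x y hx hy - ho
      obtain rfl := Option.some.inj hx
      obtain rfl := Option.some.inj hy
      simpa [Mem.setVal, Mem.setNat] using key ho
  · simp only [Mem.setVal_val_self, and_true, if_neg hij, Mem.setNat_val]
  · simp only [Mem.setVal_nat, Mem.setNat_nat_self, and_true, if_neg hij]

theorem fillTables_run {A : Allotment n k} {s : Fin k} {δ : ℕ} {σ : Mem R}
    (h : Stores I A σ) (hJ : Shifts I J A s δ) (h₆ : σ.var 6 = s) (h₃₄ : σ.var 34 = δ) :
    Run I fillTables σ ((k + 1) * ((k + 1) * 10 + 4) + 3) fun τ =>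
      (∀ u v, CellFilled J A u v τ) ∧ τ.var 33 = k + 1 := by
  have hset : ∀ {u v : Option (Fin k)} {τ : Mem R} {a x : ℕ}, a ≠ 41 → CellFilled J A u v τ →
      CellFilled J A u v (τ.setNat a 0 0 0 x) := fun ha h =>
    h.congr rfl (by rw [Mem.setNat_nat_of_ne _ ha.symm])
  have h₁ : Run I (Cmd.assign 33 (.add (.var 0) (.lit 1))) σ 1 fun τ => τ.var 33 = k + 1 := by
    refine Run.straight (c := Cmd.assign 33 _) trivial ?_
    have : σ.var 0 = k := h.centers
    simp [Cmd.result_assign, NExp.eval, NExp.eval_var, this, Mem.setNat_var_self]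
  refine (h₁.seq (T' := (k + 1) * ((k + 1) * (8 + 2) + 2 + 2) + 2) fun τ hF hτ => ?_).mono
    (by ring_nf; omega) fun _ _ h => h
  have hS := h.of_frame hF (by decide)
  have h₆' := (hF.var_eq (a := 6) (by decide)).trans h₆
  have h₃₄' := (hF.var_eq (a := 34) (by decide)).trans h₃₄
  clear h₁ h h₆ h₃₄ hF
  refine (Run.forUp (N := k + 1)
    (fun i τ => ∀ u v : Option (Fin k), code u < i → CellFilled J A u v τ)
    (by decide) (by decide) (by decide) hτ (by simp) ?_).mono le_rfl fun υ hF hυ =>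
      ⟨fun u v => hυ u v (code_lt u), (hF.var_eq (a := 33) (by decide)).trans hτ⟩
  intro i hi υ hF hυ hI
  obtain ⟨u₀, rfl⟩ := exists_code_eq hi
  refine (Run.forUp (N := k + 1) (fun j τ => ∀ u v : Option (Fin k),
      code u < code u₀ ∨ u = u₀ ∧ code v < j → CellFilled J A u v τ)
    (by decide) (by decide) (by decide) ((hF.var_eq (a := 33) (by decide)).trans hτ)
    (fun u v h => hset (by decide) (hI u v (by simpa using h))) ?_).mono le_rfl
    fun ω _ hω u v h => hset (by decide) (hω u v ?_)
  · intro j hj ω hF' hω hI'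
    obtain ⟨v₀, rfl⟩ := exists_code_eq hj
    have hres := fillCell_result (J := J) ((hS.of_frame hF (by decide)).of_frame hF' (by decide)) hJ
      ((hF'.var_eq (a := 6) (by decide)).trans ((hF.var_eq (a := 6) (by decide)).trans h₆'))
      ((hF'.var_eq (a := 34) (by decide)).trans ((hF.var_eq (a := 34) (by decide)).trans h₃₄'))
      ((hF'.var_eq (a := 30) (by decide)).trans hυ) hω
    refine Run.straight (c := fillCell) (by simp [fillCell, Cmd.Straight]) fun u v h =>
      hset (by decide) ?_
    by_cases huv : u = u₀ ∧ v = v₀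
    · rw [huv.1, huv.2]; exact hres.1
    · refine (hI' u v ?_).of_ne huv hres.2.1 hres.2.2
      refine h.imp id fun h => ⟨h.1, ?_⟩
      have : code v ≠ code v₀ := fun h' => huv ⟨h.1, code_injective h'⟩
      omega
  · rcases Nat.lt_succ_iff_lt_or_eq.1 h with h | h
    · exact Or.inl h
    · exact Or.inr ⟨code_injective h, code_lt v⟩

/-- The demand nodes in the table are cheapest. -/
theorem exists_cheapest {A : Allotment n k} {σ : Mem R} (hn : 0 < n)
    (h : ∀ u v, CellFilled J A u v σ) : ∃ E : Fin k → Fin k → Fin n, J.Cheapest A E ∧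
      ∀ u v, u ≠ v → J.arc A Finset.univ (some u) (some v) ≠ ⊤ → σ.nat 41 u v 0 = E u v := by
  have h₁ : ∀ u v : Fin k, ∃ d : Fin n, u ≠ v → J.arc A Finset.univ (some u) (some v) ≠ ⊤ →
      σ.nat 41 u v 0 = d ∧ A d = u ∧
        J.arc A Finset.univ (some u) (some v) = (J.transferCost A d v : WithTop R) := by
    intro u v
    by_cases hh : u ≠ v ∧ J.arc A Finset.univ (some u) (some v) ≠ ⊤
    · obtain ⟨e, -, he, -⟩ := Problem.exists_arc_eq hh.1 hh.2
      obtain ⟨d, hd⟩ := (h (some u) (some v)).node u v rfl rfl hh.1 (occ_pos.2 ⟨e, he⟩)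
      exact ⟨d, fun _ _ => hd⟩
    -- An arbitrary demand node for pairs without a finite transfer arc.
    · exact ⟨⟨0, hn⟩, fun h₁ h₂ => absurd ⟨h₁, h₂⟩ hh⟩
  choose E hE using h₁
  exact ⟨E, fun u v h₁ h₂ => (hE u v h₁ h₂).2, fun u v h₁ h₂ => (hE u v h₁ h₂).1⟩

end LBDD

namespace LBDD

/-! ### The Bellman–Ford algorithm in memory -/

/-- A number that is zero exactly if there is no arc from the vertex in the variable 30 to the
vertex in the variable 31, provided that these are different. -/
def outDegree : NExp :=
  .add (.get 3 (.var 30) (.lit 0) (.lit 0))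
    (.add (.sub (.add (.var 30) (.lit 1)) (.var 0)) (.sub (.add (.var 31) (.lit 1)) (.var 0)))

/-- The value in round `m`, where `m` is in the variable 32, at the vertex in the variable 30,
plus the weight of the arc from there to the vertex in the variable 31. -/
def relaxedValue : VExp :=
  .add (.get 1 (.var 32) (.var 30) (.lit 0)) (.get 0 (.var 30) (.var 31) (.lit 0))

def relaxArc : Cmd :=
  Cmd.cond
    (.and (.and (.ne (.var 30) (.var 6)) (.ne (.var 30) (.var 35)))
      (.and (.ltN (.lit 0) outDegree)
        (.ltV relaxedValue (.get 1 (.add (.var 32) (.lit 1)) (.var 31) (.lit 0)))))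
    (Cmd.setV 1 (.add (.var 32) (.lit 1)) (.var 31) (.lit 0) relaxedValue ;;
      Cmd.setN 42 (.add (.var 32) (.lit 1)) (.var 31) (.lit 0) (.add (.var 30) (.lit 1)))
    Cmd.skip

def relaxVertex : Cmd :=
  (Cmd.setV 1 (.add (.var 32) (.lit 1)) (.var 31) (.lit 0)
      (.get 1 (.var 32) (.var 31) (.lit 0)) ;;
    Cmd.setN 42 (.add (.var 32) (.lit 1)) (.var 31) (.lit 0) (.lit 0)) ;;
  Cmd.forUp 30 33 relaxArc

/-- Array 1 holds the values and array 42 the predecessors, with one row per round. In array 42,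
zero means no change in that round, and otherwise the code of the predecessor is increased by one.
-/
def bellmanFord : Cmd :=
  Cmd.forUp 31 33
    (Cmd.setV 1 (.lit 0) (.var 31) (.lit 0) (.get 0 (.var 6) (.var 31) (.lit 0))) ;;
  Cmd.forUp 32 0 (Cmd.forUp 31 33 relaxVertex)

/-- The vertex that is represented by a number. -/
def decode (k c : ℕ) : Option (Fin k) := if h : c < k then some ⟨c, h⟩ else none

/-- The predecessor that is represented by a number. -/
def decodePred (k : ℕ) : ℕ → Option (Option (Fin k))
  | 0 => none
  | c + 1 => some (decode k c)

theorem decode_code {k : ℕ} (v : Option (Fin k)) : decode k (code v) = v := by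
  rcases v with _ | i
  · simp [decode, code_none]
  · simp [decode, code_some]

variable {R : Type*} [CommRing R] [LinearOrder R] {n k : ℕ} {I J : Problem R n k}

theorem arc_eq_top_iff [IsStrictOrderedRing R] {A : Allotment n k} {u v : Fin k} (huv : u ≠ v) :
    J.arc A Finset.univ (some u) (some v) = ⊤ ↔ occ A u = 0 := by
  constructor
  · intro h
    by_contra h₀
    obtain ⟨d, rfl⟩ := occ_pos.1 (Nat.pos_of_ne_zero h₀)
    have := Problem.arc_le (I := J) (A := A) (Finset.mem_univ d) v
    rw [h] at this
    simp at this
  · intro h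
    by_contra h'
    obtain ⟨d, -, hd, -⟩ := Problem.exists_arc_eq huv h'
    exact absurd (occ_pos.2 ⟨d, hd⟩) (by omega)

theorem arc_ne_top_of_occ_pos [IsStrictOrderedRing R] {A : Allotment n k} {u : Fin k}
    (h : 0 < occ A u) (v : Option (Fin k)) : J.arc A Finset.univ (some u) v ≠ ⊤ := by
  rcases v with _ | v
  · simp [Problem.arc]
  · by_cases huv : u = v
    · subst huv; rw [Problem.arc_self]; simp
    · rw [Ne, arc_eq_top_iff huv]; omega

/-- The cell of the vertex `v` in the round `m + 1` takes the arcs from the vertices with numbers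
below `b` into account. -/
structure Relaxed (J : Problem R n k) (A : Allotment n k) (s t : Option (Fin k)) (b m : ℕ)
    (v : Option (Fin k)) (σ : Mem R) : Prop where
  mono : σ.val 1 (m + 1) (code v) 0 ≤ σ.val 1 m (code v) 0
  relax : ∀ u, code u < b → u ≠ s ∧ u ≠ t → (σ.val 1 (m + 1) (code v) 0 : WithTop R) ≤
    σ.val 1 m (code u) 0 + J.arc A Finset.univ u v
  pred : (σ.nat 42 (m + 1) (code v) 0 = 0 ∧
      σ.val 1 (m + 1) (code v) 0 = σ.val 1 m (code v) 0) ∨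
    ∃ u, σ.nat 42 (m + 1) (code v) 0 = code u + 1 ∧ (u ≠ s ∧ u ≠ t) ∧
      (σ.val 1 (m + 1) (code v) 0 : WithTop R) =
        σ.val 1 m (code u) 0 + J.arc A Finset.univ u v ∧
      σ.val 1 (m + 1) (code v) 0 < σ.val 1 m (code v) 0

theorem Relaxed.congr {A : Allotment n k} {s t : Option (Fin k)} {b m : ℕ} {v : Option (Fin k)}
    {σ τ : Mem R} (h : Relaxed J A s t b m v σ) (h₁ : ∀ j, τ.val 1 m j 0 = σ.val 1 m j 0)
    (h₂ : τ.val 1 (m + 1) (code v) 0 = σ.val 1 (m + 1) (code v) 0)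
    (h₃ : τ.nat 42 (m + 1) (code v) 0 = σ.nat 42 (m + 1) (code v) 0) :
    Relaxed J A s t b m v τ := by
  obtain ⟨h₄, h₅, h₆⟩ := h
  constructor
  all_goals simpa only [h₁, h₂, h₃]

/-- Compared to `σ`, at most the cell of the vertex `v` in the round `m` has changed. -/
def RoundFrame (m : ℕ) (v : Option (Fin k)) (σ τ : Mem R) : Prop :=
  (∀ m' j, ¬ (m' = m ∧ j = code v) → τ.val 1 m' j 0 = σ.val 1 m' j 0) ∧
    ∀ m' j, ¬ (m' = m ∧ j = code v) → τ.nat 42 m' j 0 = σ.nat 42 m' j 0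

theorem RoundFrame.trans {m : ℕ} {v : Option (Fin k)} {σ τ υ : Mem R} (h : RoundFrame m v σ τ)
    (h' : RoundFrame m v τ υ) : RoundFrame m v σ υ :=
  ⟨fun m' j hj => (h'.1 m' j hj).trans (h.1 m' j hj),
    fun m' j hj => (h'.2 m' j hj).trans (h.2 m' j hj)⟩

theorem RoundFrame.setNat {m : ℕ} {v : Option (Fin k)} {σ τ : Mem R} (h : RoundFrame m v σ τ)
    {a : ℕ} (ha : a ≠ 42) (x : ℕ) : RoundFrame m v σ (τ.setNat a 0 0 0 x) :=
  ⟨h.1, fun m' j hj => by rw [Mem.setNat_nat_of_ne _ ha.symm]; exact h.2 m' j hj⟩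

theorem Relaxed.setNat {A : Allotment n k} {s t : Option (Fin k)} {b m : ℕ} {v : Option (Fin k)}
    {σ : Mem R} (h : Relaxed J A s t b m v σ) {a : ℕ} (ha : a ≠ 42) (x : ℕ) :
    Relaxed J A s t b m v (σ.setNat a 0 0 0 x) :=
  h.congr (fun _ => rfl) rfl (by rw [Mem.setNat_nat_of_ne _ ha.symm])

theorem Relaxed.of_roundFrame {A : Allotment n k} {s t : Option (Fin k)} {b m m' : ℕ}
    {v v' : Option (Fin k)} {σ τ : Mem R} (h : Relaxed J A s t b m v σ)
    (hF : RoundFrame (m' + 1) v' σ τ) (hm : m < m' ∨ m = m' ∧ v ≠ v') :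
    Relaxed J A s t b m v τ := by
  have : ¬ (m + 1 = m' + 1 ∧ code v = code v') := fun h => by
    rcases hm with hm | hm
    · omega
    · exact hm.2 (code_injective h.2)
  exact h.congr (fun j => hF.1 m j (by omega)) (hF.1 _ _ this) (hF.2 _ _ this)

/-- What the algorithm reads besides its own tables. -/
structure RelaxInput (J : Problem R n k) (A : Allotment n k) (s : Fin k) (t : Option (Fin k))
    (σ : Mem R) : Prop where
  filled : ∀ u v, CellFilled J A u v σ
  centers : σ.var 0 = k
  occupancy : ∀ i : Fin k, σ.nat 3 i 0 0 = occ A i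
  source : σ.var 6 = s
  bound : σ.var 33 = k + 1
  target : σ.var 35 = code t

theorem RelaxInput.of_eq {A : Allotment n k} {s : Fin k} {t : Option (Fin k)} {σ τ : Mem R}
    (h : RelaxInput J A s t σ) (h₁ : ∀ a ∈ [0, 3, 6, 33, 35, 41], τ.nat a = σ.nat a)
    (h₂ : τ.val 0 = σ.val 0) : RelaxInput J A s t τ where
  filled u v := (h.filled u v).congr (by rw [h₂]) (by rw [h₁ 41 (by decide)])
  centers := by rw [← h.centers]; exact Mem.var_eq_of_nat_eq (h₁ 0 (by decide))
  occupancy i := by rw [h₁ 3 (by decide), h.occupancy]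
  source := by rw [← h.source]; exact Mem.var_eq_of_nat_eq (h₁ 6 (by decide))
  bound := by rw [← h.bound]; exact Mem.var_eq_of_nat_eq (h₁ 33 (by decide))
  target := by rw [← h.target]; exact Mem.var_eq_of_nat_eq (h₁ 35 (by decide))

theorem RelaxInput.of_frame {A : Allotment n k} {s : Fin k} {t : Option (Fin k)} {σ τ : Mem R}
    {c : Cmd} (h : RelaxInput J A s t σ) (hF : c.Frame σ τ)
    (h₁ : ∀ a ∈ [0, 3, 6, 33, 35, 41], a ∉ c.natWrites) (h₂ : 0 ∉ c.valWrites) :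
    RelaxInput J A s t τ :=
  h.of_eq (fun a ha => hF.1 a (h₁ a ha)) (hF.2 0 h₂)

variable [IsStrictOrderedRing R]

/-- For distinct vertices the test on `outDegree` replaces infinite weights: it admits exactly the
finite arcs, for which the table is correct. -/
theorem relaxArc_result {A : Allotment n k} {s : Fin k} {t : Option (Fin k)} {m : ℕ}
    {u v : Option (Fin k)} {σ : Mem R} (h : RelaxInput J A s t σ) (h₃₂ : σ.var 32 = m)
    (h₃₁ : σ.var 31 = code v) (h₃₀ : σ.var 30 = code u)
    (hR : Relaxed J A (some s) t (code u) m v σ) :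
    Relaxed J A (some s) t (code u + 1) m v (relaxArc.result I σ) ∧
      RoundFrame (m + 1) v σ (relaxArc.result I σ) := by
  have hlt : ∀ {u'}, code u' < code u + 1 → code u' < code u ∨ u' = u := fun h =>
    (Nat.lt_succ_iff_lt_or_eq.1 h).imp id fun h => code_injective h
  have hne : (code u ≠ s ∧ code u ≠ code t) ↔ (u ≠ some s ∧ u ≠ t) := by
    rw [← code_some s, code_injective.ne_iff, code_injective.ne_iff]
  have hdeg : u ≠ v → J.arc A Finset.univ u v ≠ ⊤ → 0 < outDegree.eval σ := by
    intro huv hw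
    simp only [outDegree, NExp.eval, NExp.eval_var, h₃₀, h₃₁, h.centers]
    rcases u with _ | u
    · rw [code_none]; omega
    · rcases v with _ | v
      · rw [code_none]; omega
      · rw [Ne, arc_eq_top_iff (fun h => huv (by rw [h]))] at hw
        rw [code_some, h.occupancy]; omega
  have hdeg' : 0 < outDegree.eval σ → J.arc A Finset.univ u v ≠ ⊤ := by
    intro hd
    rcases u with _ | u
    · rcases v with _ | v <;> simp [Problem.arc]
    · rcases v with _ | v
      · simp [Problem.arc]
      · by_cases huv : u = v
        · subst huv; rw [Problem.arc_self]; simp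
        simp only [outDegree, NExp.eval, NExp.eval_var, h₃₀, h₃₁, h.centers, code_some,
          h.occupancy] at hd
        rw [Ne, arc_eq_top_iff huv]
        omega
  have hval : relaxedValue.eval I σ = σ.val 1 m (code u) 0 + σ.val 0 (code u) (code v) 0 := by
    simp only [relaxedValue, VExp.eval, NExp.eval, NExp.eval_var, h₃₀, h₃₁, h₃₂]
  rw [relaxArc, Cmd.result]
  have hb : BExp.eval I σ (.and (.and (.ne (.var 30) (.var 6)) (.ne (.var 30) (.var 35)))
      (.and (.ltN (.lit 0) outDegree)
        (.ltV relaxedValue (.get 1 (.add (.var 32) (.lit 1)) (.var 31) (.lit 0))))) ↔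
      (u ≠ some s ∧ u ≠ t) ∧ 0 < outDegree.eval σ ∧
        σ.val 1 m (code u) 0 + σ.val 0 (code u) (code v) 0 < σ.val 1 (m + 1) (code v) 0 := by
    rw [← hval, ← hne]
    simp only [BExp.eval, BExp.eval_ne, NExp.eval_var, VExp.eval, NExp.eval, h₃₀, h₃₁, h₃₂,
      h.source, h.target]
  split_ifs with hc
  · obtain ⟨hu, hd, hl⟩ := hb.1 hc
    have hw := (h.filled u v).weight (hdeg' hd)
    have hres : (Cmd.setV 1 (.add (.var 32) (.lit 1)) (.var 31) (.lit 0) relaxedValue ;;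
      Cmd.setN 42 (.add (.var 32) (.lit 1)) (.var 31) (.lit 0)
        (.add (.var 30) (.lit 1))).result I σ =
        (σ.setVal 1 (m + 1) (code v) 0
          (σ.val 1 m (code u) 0 + σ.val 0 (code u) (code v) 0)).setNat 42 (m + 1) (code v) 0
            (code u + 1) := by
      simp only [Cmd.result, NExp.eval, NExp.eval_var, Mem.setVal_var, h₃₀, h₃₁, h₃₂, hval]
    rw [hres]
    set υ := (σ.setVal 1 (m + 1) (code v) 0
          (σ.val 1 m (code u) 0 + σ.val 0 (code u) (code v) 0)).setNat 42 (m + 1) (code v) 0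
            (code u + 1) with hυ
    have e₁ : υ.val 1 (m + 1) (code v) 0 =
        σ.val 1 m (code u) 0 + σ.val 0 (code u) (code v) 0 := by
      simp [hυ, Mem.setVal, Mem.setNat]
    have e₂ : ∀ j, υ.val 1 m j 0 = σ.val 1 m j 0 := fun j => by
      simp [hυ, Mem.setVal, Mem.setNat]
    have e₃ : υ.nat 42 (m + 1) (code v) 0 = code u + 1 := by
      simp [hυ, Mem.setNat]
    refine ⟨⟨?_, fun u' hu' hU => ?_, Or.inr ⟨u, e₃, hu, ?_, ?_⟩⟩, fun m' j hj => ?_,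
      fun m' j hj => ?_⟩
    · rw [e₁, e₂]; exact hl.le.trans hR.mono
    · rw [e₁, e₂]
      rcases hlt hu' with h' | rfl
      · exact (WithTop.coe_le_coe.2 hl.le).trans (hR.relax u' h' hU)
      · rw [hw, WithTop.coe_add]
    · rw [e₁, e₂, hw, WithTop.coe_add]
    · rw [e₁, e₂]; exact hl.trans_le hR.mono
    · simp only [hυ, Mem.setNat_val, Mem.setVal_val_self, and_true, if_neg hj]
    · simp only [hυ, Mem.setNat_nat_self, and_true, if_neg hj, Mem.setVal_nat]
  · rw [Cmd.result]
    refine ⟨⟨hR.mono, fun u' hu' hU => ?_, hR.pred⟩, fun _ _ _ => rfl, fun _ _ _ => rfl⟩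
    rcases hlt hu' with h' | rfl
    · exact hR.relax u' h' hU
    -- The trivial arc may be rejected by the degree test, but it has weight zero and monotonicity
    -- covers it.
    · by_cases huv : u' = v
      · subst huv
        rw [Problem.arc_self, add_zero]
        exact WithTop.coe_le_coe.2 hR.mono
      · by_cases hw : J.arc A Finset.univ u' v = ⊤
        · rw [hw]; simp
        · rw [(h.filled u' v).weight hw, ← WithTop.coe_add, WithTop.coe_le_coe]
          exact not_lt.1 fun hl => hc (hb.2 ⟨hU, hdeg huv hw, hl⟩)

theorem relaxVertex_run {A : Allotment n k} {s : Fin k} {t : Option (Fin k)} {m : ℕ}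
    {v : Option (Fin k)} {σ : Mem R} (h : RelaxInput J A s t σ) (h₃₂ : σ.var 32 = m)
    (h₃₁ : σ.var 31 = code v) :
    Run I relaxVertex σ ((k + 1) * 6 + 4) fun τ =>
      Relaxed J A (some s) t (k + 1) m v τ ∧ RoundFrame (m + 1) v σ τ := by
  have h₁ : Run I (Cmd.setV 1 (.add (.var 32) (.lit 1)) (.var 31) (.lit 0)
      (.get 1 (.var 32) (.var 31) (.lit 0)) ;;
    Cmd.setN 42 (.add (.var 32) (.lit 1)) (.var 31) (.lit 0) (.lit 0)) σ 2 fun τ =>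
      Relaxed J A (some s) t 0 m v τ ∧ RoundFrame (m + 1) v σ τ := by
    refine Run.straight ⟨trivial, trivial⟩ ?_
    have hres : (Cmd.setV 1 (.add (.var 32) (.lit 1)) (.var 31) (.lit 0)
      (.get 1 (.var 32) (.var 31) (.lit 0)) ;;
        Cmd.setN 42 (.add (.var 32) (.lit 1)) (.var 31) (.lit 0) (.lit 0)).result I σ =
        (σ.setVal 1 (m + 1) (code v) 0 (σ.val 1 m (code v) 0)).setNat 42 (m + 1) (code v) 0 0 := by
      simp only [Cmd.result, NExp.eval, NExp.eval_var, VExp.eval, Mem.setVal_var, h₃₁, h₃₂]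
    rw [hres]
    refine ⟨⟨?_, by simp, Or.inl ⟨?_, ?_⟩⟩, fun m' j hj => ?_, fun m' j hj => ?_⟩
    · simp [Mem.setVal, Mem.setNat]
    · simp [Mem.setNat]
    · simp [Mem.setVal, Mem.setNat]
    · simp only [Mem.setNat_val, Mem.setVal_val_self, and_true, if_neg hj]
    · simp only [Mem.setNat_nat_self, and_true, if_neg hj, Mem.setVal_nat]
  refine (h₁.seq (T' := (k + 1) * (4 + 2) + 2) fun τ hF hτ => ?_).mono (by omega) fun _ _ h => h
  have hI := h.of_frame hF (by decide) (by decide)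
  refine Run.forUp (N := k + 1) (fun i υ => Relaxed J A (some s) t i m v υ ∧
    RoundFrame (m + 1) v σ υ) (by decide) (by decide) (by decide) hI.bound
    ⟨hτ.1.setNat (by decide) _, hτ.2.setNat (by decide) _⟩ fun i hi υ hF' hυ hInv => ?_
  obtain ⟨u, rfl⟩ := exists_code_eq hi
  have hres := relaxArc_result (I := I) (hI.of_frame hF' (by decide) (by decide))
    ((hF'.var_eq (a := 32) (by decide)).trans ((hF.var_eq (a := 32) (by decide)).trans h₃₂))
    ((hF'.var_eq (a := 31) (by decide)).trans ((hF.var_eq (a := 31) (by decide)).trans h₃₁))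
    hυ hInv.1
  exact Run.straight (c := relaxArc) (by simp [relaxArc, Cmd.Straight])
    ⟨hres.1.setNat (by decide) _, (hInv.2.trans hres.2).setNat (by decide) _⟩

/-- A demand node at `s` makes all arcs out of `s` finite, so round zero can be stored as ring
elements. The final clause says that the stored number of a predecessor is a genuine vertex code. -/
theorem bellmanFord_run {A : Allotment n k} {s : Fin k} {t : Option (Fin k)} {σ : Mem R}
    (h : RelaxInput J A s t σ) (hs : 0 < occ A s) :
    Run I bellmanFord σ (k * ((k + 1) * ((k + 1) * 6 + 6) + 4) + (k + 1) * 3 + 4) fun τ =>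
      BellmanFord (J.arc A Finset.univ) (fun u => u ≠ some s ∧ u ≠ t) (some s) k
        (fun m v => τ.val 1 m (code v) 0) (fun m v => decodePred k (τ.nat 42 m (code v) 0)) ∧
      ∀ m < k, ∀ v u : Option (Fin k), decodePred k (τ.nat 42 (m + 1) (code v) 0) = some u →
        τ.nat 42 (m + 1) (code v) 0 = code u + 1 := by
  have h₁ : Run I (Cmd.forUp 31 33
      (Cmd.setV 1 (.lit 0) (.var 31) (.lit 0) (.get 0 (.var 6) (.var 31) (.lit 0)))) σ
      ((k + 1) * (1 + 2) + 2) fun τ => ∀ v : Option (Fin k), code v < k + 1 →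
        (τ.val 1 0 (code v) 0 : WithTop R) = J.arc A Finset.univ (some s) v := by
    refine Run.forUp (N := k + 1) (fun j (τ : Mem R) => ∀ v : Option (Fin k), code v < j →
        (τ.val 1 0 (code v) 0 : WithTop R) = J.arc A Finset.univ (some s) v)
      (by decide) (by decide) (by decide) h.bound (by simp) fun j hj τ hF hτ hInv => ?_
    have hI := h.of_frame hF (by decide) (by decide)
    refine Run.straight (c := Cmd.setV _ _ _ _ _) trivial fun v hv => ?_
    simp only [Cmd.result, NExp.eval, NExp.eval_var, VExp.eval, Mem.setNat_val, hτ, hI.source,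
      Mem.setVal_val_self, true_and, and_true]
    split_ifs with hvj
    · rw [← hvj, ← code_some s, ← (hI.filled (some s) v).weight (arc_ne_top_of_occ_pos hs v)]
    · exact hInv v (by omega)
  refine (h₁.seq (T' := k * ((k + 1) * ((k + 1) * 6 + 4 + 2) + 2 + 2) + 2)
    fun σ₁ hF₁ h₀ => ?_).mono (by ring_nf; omega) fun _ _ h => h
  have hI := h.of_frame hF₁ (by decide) (by decide)
  clear h₁ h hF₁
  refine (Run.forUp (N := k) (fun m (τ : Mem R) =>
      (∀ v : Option (Fin k), (τ.val 1 0 (code v) 0 : WithTop R) = J.arc A Finset.univ (some s) v) ∧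
      ∀ m' < m, ∀ v, Relaxed J A (some s) t (k + 1) m' v τ)
    (by decide) (by decide) (by decide) hI.centers ⟨fun v => h₀ v (code_lt v), by simp⟩
    ?_).mono le_rfl fun τ _ hτ => ?_
  · intro m hm σ₂ hF₂ h₃₂ hInv
    have hI₂ := hI.of_frame hF₂ (by decide) (by decide)
    refine (Run.forUp (N := k + 1) (fun j (τ : Mem R) =>
      (∀ v : Option (Fin k), (τ.val 1 0 (code v) 0 : WithTop R) = J.arc A Finset.univ (some s) v) ∧
      ∀ m' v, m' < m ∨ m' = m ∧ code v < j → Relaxed J A (some s) t (k + 1) m' v τ)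
      (by decide) (by decide) (by decide) hI₂.bound
      ⟨hInv.1, fun m' v h => (hInv.2 m' (by simpa using h) v).setNat (by decide) _⟩
      ?_).mono le_rfl fun τ _ hτ => ⟨hτ.1, fun m' hm' v => (hτ.2 m' v ?_).setNat (by decide) _⟩
    · intro j hj σ₃ hF₃ h₃₁ hInv'
      obtain ⟨v₀, rfl⟩ := exists_code_eq hj
      refine (relaxVertex_run (hI₂.of_frame hF₃ (by decide) (by decide))
        ((hF₃.var_eq (a := 32) (by decide)).trans h₃₂) h₃₁).mono le_rfl fun τ _ hτ =>
          ⟨fun v => ?_, fun m' v hv => Relaxed.setNat ?_ (by decide) _⟩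
      · rw [← hInv'.1 v]
        exact congrArg _ (hτ.2.1 0 (code v) (by omega))
      · by_cases hv' : m' = m ∧ v = v₀
        · rw [hv'.1, hv'.2]; exact hτ.1
        · have : code v = code v₀ → v = v₀ := fun h => code_injective h
          refine (hInv'.2 m' v ?_).of_roundFrame hτ.2 ?_
          · rcases hv with h | ⟨h, h'⟩
            · exact Or.inl h
            · exact Or.inr ⟨h, by have : code v ≠ code v₀ := fun h'' => hv' ⟨h, this h''⟩
                                  omega⟩
          · rcases hv with h | ⟨h, h'⟩
            · exact Or.inl h
            · exact Or.inr ⟨h, fun h'' => hv' ⟨h, h''⟩⟩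
    · rcases Nat.lt_succ_iff_lt_or_eq.1 hm' with h | h
      · exact Or.inl h
      · exact Or.inr ⟨h, code_lt v⟩
  · refine ⟨⟨hτ.1, fun m hm v => (hτ.2 m hm v).mono,
      fun m hm v u hu => (hτ.2 m hm v).relax u (code_lt u) hu, fun m hm v hQ => ?_,
      fun m hm v u hQ => ?_⟩, fun m hm v u hQ => ?_⟩
    · rcases (hτ.2 m hm v).pred with h | ⟨u, h, -⟩
      · exact h.2
      · simp [h, decodePred] at hQ
    · rcases (hτ.2 m hm v).pred with h | ⟨u', h, h'⟩
      · simp [h.1, decodePred] at hQ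
      · simp only [h, decodePred, decode_code, Option.some.injEq] at hQ
        subst hQ
        exact h'
    · rcases (hτ.2 m hm v).pred with h | ⟨u', h, -⟩
      · simp [h.1, decodePred] at hQ
      · simp only [h, decodePred, decode_code, Option.some.injEq] at hQ
        rw [h, hQ]

end LBDD

namespace LBDD

/-! ### Transfers along the computed walk -/

/-- The transfer along the arc from the vertex in the variable 38 to the vertex in the
variable 37. -/
def moveAlong : Cmd :=
  Cmd.cond (.and (.ltN (.var 38) (.var 0)) (.ltN (.var 37) (.var 0)))
    ((Cmd.assign 20 (.get 41 (.var 38) (.var 37) (.lit 0)) ;;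
      Cmd.assign 21 (.var 37) ;; Cmd.assign 22 (.var 38)) ;; moveNode)
    Cmd.skip

/-- One step back along the walk; the number of the round is in the variable 36. -/
def stepBack : Cmd :=
  (Cmd.assign 38 (.get 42 (.var 36) (.var 37) (.lit 0)) ;;
    Cmd.assign 36 (.sub (.var 36) (.lit 1))) ;;
  Cmd.cond (.ltN (.lit 0) (.var 38))
    (Cmd.assign 38 (.sub (.var 38) (.lit 1)) ;; moveAlong ;; Cmd.assign 37 (.var 38))
    Cmd.skip

/-- Predecessors are discovered from the end of the walk, and the transfers are carried out in that
order; the arc out of `s` comes last, after the loop. -/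
def moveWalk : Cmd :=
  (Cmd.assign 36 (.var 0) ;; Cmd.assign 37 (.var 35)) ;;
  Cmd.loop (.ltN (.lit 0) (.var 36)) stepBack ;;
  Cmd.assign 38 (.var 6) ;; moveAlong

variable {R : Type*} [CommRing R] [LinearOrder R] {n k : ℕ} {I J : Problem R n k}

/-- The memory contains the demand nodes `E` of the arcs of the walk `w`, and each of them is at
the beginning of its arc. -/
structure Movable (A : Allotment n k) (E : Fin k → Fin k → Fin n) (w : List (Option (Fin k)))
    (σ : Mem R) : Prop where
  source : ∀ u v, [some u, some v] <:+: w → A (E u v) = u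
  node : ∀ u v, [some u, some v] <:+: w → σ.nat 41 u v 0 = E u v
  ne : ∀ u, ¬ [u, u] <:+: w
  nodup : w.dropLast.Nodup

theorem Movable.of_frame {A : Allotment n k} {E : Fin k → Fin k → Fin n}
    {w : List (Option (Fin k))} {σ τ : Mem R} {c : Cmd} (h : Movable A E w σ) (hF : c.Frame σ τ)
    (hc : 41 ∉ c.natWrites) : Movable A E w τ :=
  ⟨h.source, fun u v huv => by rw [hF.1 41 hc]; exact h.node u v huv, h.ne, h.nodup⟩

/-- The walk moves distinct demand nodes, so the transfers already made have left `E u v` at `u`.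
Arcs at `none` change occupancies only through their neighbors and need no transfer. -/
theorem moveAlong_run {A : Allotment n k} {E : Fin k → Fin k → Fin n}
    {w : List (Option (Fin k))} {σ : Mem R} (hw : Movable A E w σ)
    {l r : List (Option (Fin k))} {a b : Option (Fin k)} (hl : w = l ++ a :: b :: r)
    (h : Stores I (carryOut (walkTransfers E (b :: r)) A) σ)
    (h₃₈ : σ.var 38 = code a) (h₃₇ : σ.var 37 = code b) :
    Run I moveAlong σ (k * (Nat.log 2 n * 42 + 28) + 9)
      (Stores I (carryOut (walkTransfers E (a :: b :: r)) A)) := by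
  have h₀ : σ.var 0 = k := h.centers
  have hmem : [a, b] <:+: w := ⟨l, r, by simp [hl]⟩
  refine (Run.cond (T := 3 + (k * (Nat.log 2 n * 42 + 28) + 5)) (fun hb => ?_)
    fun hb => ?_).mono (by omega) fun _ _ h => h
  · simp only [BExp.eval, NExp.eval_var, h₀, h₃₈, h₃₇] at hb
    rcases a with _ | u
    · exact absurd hb.1 (by simp [code_none])
    rcases b with _ | v
    · exact absurd hb.2 (by simp [code_none])
    have h₄₁ := hw.node u v hmem
    refine Run.seq (P := fun τ => τ.var 20 = E u v ∧ τ.var 21 = v ∧ τ.var 22 = u)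
      (Run.straight (c := Cmd.assign 20 (.get 41 (.var 38) (.var 37) (.lit 0)) ;;
        Cmd.assign 21 (.var 37) ;; Cmd.assign 22 (.var 38))
        (by simp [Cmd.Straight, Cmd.assign]) ?_) fun τ hF hτ => ?_
    · rw [code_some] at h₃₇ h₃₈
      have e₁ : ∀ x, (σ.setNat 20 0 0 0 x).var 37 = v := fun x => by
        rw [Mem.setNat_var_of_ne _ (by decide), h₃₇]
      have e₂ : ∀ x y, ((σ.setNat 20 0 0 0 x).setNat 21 0 0 0 y).var 38 = u := fun x y => by
        rw [Mem.setNat_var_of_ne _ (by decide), Mem.setNat_var_of_ne _ (by decide), h₃₈]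
      simp only [Cmd.result, Cmd.assign, NExp.eval, NExp.eval_var, h₃₈, h₃₇, h₄₁, e₁, e₂]
      exact ⟨rfl, rfl, rfl⟩
    · have hsource := hw.source u v hmem
      have hn := walkTransfers_fst_nodup hw.source hw.nodup
      rw [hl, walkTransfers_append, walkTransfers, List.map_append, List.map_append] at hn
      have hnot : E u v ∉ (walkTransfers E (some v :: r)).map Prod.fst := fun hmem =>
        (List.nodup_append.1 (List.nodup_append.1 hn).2.1).2.2 _ (by simp [arcTransfer]) _ hmem rfl
      have hcur := carryOut_of_notMem hnot A
      rw [hsource] at hcur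
      refine (moveNode_run (h.of_frame hF (by decide)) (d := E u v) (w := v) ?_ hτ.1 hτ.2.1
        (by rw [hτ.2.2, hcur])).mono le_rfl fun υ _ hυ => hυ
      rw [hcur]
      rintro rfl
      exact hw.ne _ hmem
  · refine (Run.straight (c := Cmd.skip) trivial ?_).mono (by simp [Cmd.size]; omega)
      fun _ _ h => h
    rw [Cmd.result]
    simp only [BExp.eval, NExp.eval_var, h₀, h₃₈, h₃₇] at hb
    rcases a with _ | u
    · exact h
    rcases b with _ | v
    · exact h
    exact absurd (by simp [code_some]) hb

/-- Loop invariant: the walk is the trace of the current vertex in the current round, followed by a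
part whose transfers have all been made. A round without a predecessor leaves the vertex unchanged.
-/
theorem moveWalk_run {A : Allotment n k} {E : Fin k → Fin k → Fin n}
    {Q : ℕ → Option (Fin k) → Option (Option (Fin k))} {s : Fin k} {t : Option (Fin k)}
    {σ : Mem R} (h : Stores I A σ) (h₆ : σ.var 6 = s) (h₃₅ : σ.var 35 = code t)
    (hQ : ∀ m v, Q m v = decodePred k (σ.nat 42 m (code v) 0))
    (hU : ∀ m < k, ∀ v u, Q (m + 1) v = some u → σ.nat 42 (m + 1) (code v) 0 = code u + 1)
    (hw : Movable A E (some s :: (traceBack Q k t ++ [t])) σ) :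
    Run I moveWalk σ ((k + 1) * (k * (Nat.log 2 n * 42 + 28) + 16) + 3)
      (Stores I (traceAllotment E Q s t A)) := by
  set w := some s :: (traceBack Q k t ++ [t]) with hwdef
  set M := k * (Nat.log 2 n * 42 + 28) with hM
  have h₁ : Run I (Cmd.assign 36 (.var 0) ;; Cmd.assign 37 (.var 35)) σ 2 fun τ =>
      τ.var 36 = k ∧ τ.var 37 = code t := by
    refine Run.straight ⟨trivial, trivial⟩ ?_
    have h₀ : σ.var 0 = k := h.centers
    have e₁ : ∀ x, (σ.setNat 36 0 0 0 x).var 35 = code t := fun x => by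
      rw [Mem.setNat_var_of_ne _ (by decide), h₃₅]
    simp only [Cmd.result, Cmd.assign, NExp.eval, NExp.eval_var, h₀, e₁]
    exact ⟨rfl, rfl⟩
  refine (h₁.seq (T' := k * (M + 14 + 1) + 1 + (1 + (M + 9))) fun σ₁ hF₁ hσ₁ => ?_).mono
    (by ring_nf; omega) fun _ _ h => h
  have hloop : Run I (Cmd.loop (.ltN (.lit 0) (.var 36)) stepBack) σ₁ (k * (M + 14 + 1) + 1)
      fun τ => ∃ v r, w = some s :: v :: r ∧ τ.var 37 = code v ∧
        Stores I (carryOut (walkTransfers E (v :: r)) A) τ := by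
    refine Run.loop (fun f τ => τ.var 36 = f ∧ f ≤ k ∧ τ.nat 41 = σ.nat 41 ∧
      τ.nat 42 = σ.nat 42 ∧ ∃ v r, w = some s :: (traceBack Q f v ++ v :: r) ∧
        τ.var 37 = code v ∧ Stores I (carryOut (walkTransfers E (v :: r)) A) τ) ?_ ?_
      ⟨hσ₁.1, le_rfl, hF₁.1 41 (by decide), hF₁.1 42 (by decide), t, [], rfl, hσ₁.2, ?_⟩
    · rintro f τ ⟨h₃₆, hfk, h₄₁, h₄₂, v, r, hv, h₃₇, hS⟩ hb
      simp only [BExp.eval, NExp.eval, NExp.eval_var, h₃₆] at hb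
      obtain ⟨m, rfl⟩ : ∃ m, f = m + 1 := ⟨f - 1, by omega⟩
      refine ⟨m, Nat.lt_succ_self m, ?_⟩
      have h₂ : Run I (Cmd.assign 38 (.get 42 (.var 36) (.var 37) (.lit 0)) ;;
          Cmd.assign 36 (.sub (.var 36) (.lit 1))) τ 2 fun υ =>
          υ.var 38 = σ.nat 42 (m + 1) (code v) 0 ∧ υ.var 36 = m := by
        refine Run.straight ⟨trivial, trivial⟩ ?_
        have e₁ : ∀ x, (τ.setNat 38 0 0 0 x).var 36 = m + 1 := fun x => by
          rw [Mem.setNat_var_of_ne _ (by decide), h₃₆]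
        simp only [Cmd.result, Cmd.assign, NExp.eval, NExp.eval_var, h₃₆, h₃₇, e₁, h₄₂]
        exact ⟨rfl, rfl⟩
      refine (h₂.seq (T' := 1 + (M + 9 + 1) + 1) fun υ hF hυ => ?_).mono (by omega)
        fun _ _ h => h
      have hS' := hS.of_frame hF (by decide)
      have h₃₇' := (hF.var_eq (a := 37) (by decide)).trans h₃₇
      have h₄₁' := (hF.1 41 (by decide)).trans h₄₁
      have h₄₂' := (hF.1 42 (by decide)).trans h₄₂
      refine Run.cond (fun hb => ?_) fun hb => ?_
      · simp only [BExp.eval, NExp.eval, NExp.eval_var, hυ.1] at hb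
        obtain ⟨u, hu⟩ : ∃ u, Q (m + 1) v = some u := by
          rw [hQ]
          obtain ⟨c, hc⟩ := Nat.exists_eq_add_of_lt hb
          exact ⟨decode k c, by rw [hc, zero_add, decodePred]⟩
        have hcode := hU m (by omega) v u hu
        have htr : w = (some s :: traceBack Q m u) ++ u :: v :: r := by
          rw [hv]; simp [traceBack, hu]
        have h₃ : Run I (Cmd.assign 38 (.sub (.var 38) (.lit 1))) υ 1 fun ω =>
            ω.var 38 = code u := by
          refine Run.straight (c := Cmd.assign _ _) trivial ?_
          rw [Cmd.result_assign, Mem.setNat_var_self]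
          simp only [NExp.eval, NExp.eval_var, hυ.1, hcode, Nat.add_sub_cancel]
        refine h₃.seq fun ω hFω hω => ?_
        refine Run.seq (moveAlong_run (w := w) ?_ htr (hS'.of_frame hFω (by decide)) hω
          ((hFω.var_eq (a := 37) (by decide)).trans h₃₇')) fun ξ hFξ hξ => ?_
        · exact ⟨hw.source, fun u v huv => by
            rw [hFω.1 41 (by decide), h₄₁']; exact hw.node u v huv, hw.ne, hw.nodup⟩
        refine Run.straight (c := Cmd.assign _ _) trivial ?_
        rw [Cmd.result_assign]
        refine ⟨?_, by omega, ?_, ?_, u, v :: r, ?_, ?_, ?_⟩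
        · rw [Mem.setNat_var_of_ne _ (by decide), hFξ.var_eq (a := 36) (by decide),
            hFω.var_eq (a := 36) (by decide), hυ.2]
        · rw [Mem.setNat_nat_of_ne _ (by decide), hFξ.1 41 (by decide),
            hFω.1 41 (by decide), h₄₁']
        · rw [Mem.setNat_nat_of_ne _ (by decide), hFξ.1 42 (by decide),
            hFω.1 42 (by decide), h₄₂']
        · simp [htr]
        · rw [Mem.setNat_var_self, NExp.eval_var, hFξ.var_eq (a := 38) (by decide), hω]
        · exact hξ.of_nat_eq fun a ha => Mem.setNat_nat_of_ne _ (by omega) _ _ _ _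
      · refine (Run.straight (c := Cmd.skip) trivial ?_).mono (by simp [Cmd.size])
          fun _ _ h => h
        simp only [BExp.eval, NExp.eval, NExp.eval_var, hυ.1] at hb
        have hu : Q (m + 1) v = none := by
          rw [hQ, Nat.eq_zero_of_not_pos hb, decodePred]
        refine ⟨hυ.2, by omega, h₄₁', h₄₂', v, r, ?_, h₃₇', hS'⟩
        rw [hv]; simp [traceBack, hu]
    · rintro f τ ⟨h₃₆, -, -, -, v, r, hv, h₃₇, hS⟩ hb
      simp only [BExp.eval, NExp.eval, NExp.eval_var, h₃₆] at hb
      obtain rfl := Nat.eq_zero_of_not_pos hb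
      exact ⟨v, r, hv, h₃₇, hS⟩
    · exact h.of_frame hF₁ (by decide)
  refine hloop.seq fun σ₂ hF₂ hσ₂ => ?_
  obtain ⟨v, r, hv, h₃₇, hS⟩ := hσ₂
  have h₃ : Run I (Cmd.assign 38 (.var 6)) σ₂ 1 fun τ => τ.var 38 = code (some s) := by
    refine Run.straight (c := Cmd.assign _ _) trivial ?_
    rw [Cmd.result_assign, Mem.setNat_var_self, NExp.eval_var, hF₂.var_eq (a := 6) (by decide),
      hF₁.var_eq (a := 6) (by decide), h₆, code_some]
  refine h₃.seq fun τ hF hτ => ?_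
  refine (moveAlong_run (((hw.of_frame hF₁ (by decide)).of_frame hF₂ (by decide)).of_frame hF
    (by decide)) (l := []) hv (hS.of_frame hF (by decide)) hτ
    ((hF.var_eq (a := 37) (by decide)).trans h₃₇)).mono le_rfl fun _ _ h => ?_
  rwa [traceAllotment, ← hwdef, hv]

end LBDD

namespace LBDD

/-! ### The insertion -/

/-- Removal of a loop of least cost through the service center in the variable 6, the vertex in
the variable 35 being the end of the shortest walk. -/
def removeLoop : Cmd :=
  Cmd.cond (.ltN (.lit 0) (.get 3 (.var 6) (.lit 0) (.lit 0)))
    (fillTables ;; bellmanFord ;;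
      Cmd.cond (.ltV (.get 1 (.var 0) (.var 35) (.lit 0))
          (.get 2 (.lit 0) (.lit 0) (.lit 0))) moveWalk Cmd.skip)
    Cmd.skip

/-- Both removals run the same code. Variable 34 is the shift of the penalties at `s`, variable 35
the target (`s`, then `none`), and the stored threshold is zero, then the penalty of the last demand
node at `s`. -/
def insertBalanced : Cmd :=
  insertNode ;;
  (Cmd.assign 34 (.lit 1) ;; Cmd.assign 35 (.var 6) ;;
    Cmd.setV 2 (.lit 0) (.lit 0) (.lit 0) .zero) ;;
  removeLoop ;;
  (Cmd.assign 34 (.lit 0) ;; Cmd.assign 35 (.var 0) ;;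
    Cmd.setV 2 (.lit 0) (.lit 0) (.lit 0)
      (.pen (.var 6) (.get 3 (.var 6) (.lit 0) (.lit 0)))) ;;
  removeLoop

variable {R : Type*} [CommRing R] [LinearOrder R] [IsStrictOrderedRing R] {n k : ℕ}
  {I J : Problem R n k}

theorem occ_pos_lt {A : Allotment n k} {u : Fin k} (h : 0 < occ A u) : 0 < n := by
  obtain ⟨d, -⟩ := occ_pos.1 h
  exact d.pos

/-- The traced walk is duplicate-free apart from a possible return to `s`. The hypothesis `ht`
excludes the empty closed walk, whose only arc would go from `s` to itself. -/
theorem BellmanFord.movable {A : Allotment n k} {s : Fin k} {t : Option (Fin k)}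
    {S : ℕ → Option (Fin k) → R} {Q : ℕ → Option (Fin k) → Option (Option (Fin k))}
    (h : BellmanFord (J.arc A Finset.univ) (fun u => u ≠ some s ∧ u ≠ t) (some s) k S Q)
    (hU : ∀ x l, (x ≠ some s ∧ x ≠ t) → (∀ y ∈ l, y ≠ some s ∧ y ≠ t) →
      0 ≤ walkWeight (J.arc A Finset.univ) x l x)
    (ht : t = some s → S k t < 0) {E : Fin k → Fin k → Fin n} (hE : J.Cheapest A E) {σ : Mem R}
    (hσ : ∀ u v, u ≠ v → J.arc A Finset.univ (some u) (some v) ≠ ⊤ → σ.nat 41 u v 0 = E u v) :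
    Movable A E (some s :: (traceBack Q k t ++ [t])) σ := by
  obtain ⟨h₁, -, h₂, -⟩ := h.traceBack_spec le_rfl t
  have h₃ := h.traceBack_nodup hU t
  have hn : (some s :: traceBack Q k t).Nodup :=
    List.nodup_cons.2 ⟨fun hm => (h₁ _ hm).1 rfl, h₃⟩
  have hw : walkWeight (J.arc A Finset.univ) (some s) (traceBack Q k t) t ≠ ⊤ := by
    rw [h₂]; exact WithTop.coe_ne_top
  have hne : ∀ u, ¬ [u, u] <:+: some s :: (traceBack Q k t ++ [t]) := by
    intro u hu
    by_cases hts : t = some s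
    · subst hts
      cases hl : traceBack Q k (some s) with
      | nil =>
        rw [hl, walkWeight, Problem.arc_self] at h₂
        exact absurd (WithTop.coe_eq_zero.1 h₂.symm) (ht rfl).ne
      | cons x l =>
        rw [hl] at hu hn h₁
        rcases List.infix_cons_iff.1 hu with h' | h'
        · obtain ⟨r, hr⟩ := h'
          simp only [List.cons_append, List.nil_append, List.cons.injEq] at hr
          exact (h₁ x (by simp)).1 (hr.2.1.symm.trans hr.1)
        · refine not_infix_pair_of_nodup ?_ u h'
          exact (List.perm_append_singleton _ _).nodup_iff.2 hn
    · refine not_infix_pair_of_nodup ?_ u hu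
      rw [← List.cons_append]
      refine (List.perm_append_singleton _ _).nodup_iff.2 (List.nodup_cons.2 ⟨fun hm => ?_, hn⟩)
      rcases List.mem_cons.1 hm with hm | hm
      · exact hts hm
      · exact (h₁ _ hm).2 rfl
  refine ⟨fun u v huv => hE.source hw hne huv, fun u v huv => hσ u v ?_
    (arc_ne_top_of_infix hw huv), hne, ?_⟩
  · rintro rfl
    exact hne _ huv
  · rwa [← List.cons_append, List.dropLast_concat]

/-- The conclusion only exposes the tables and the resulting allotment, so that the two removal
theorems, which differ in their optimality arguments, can both be applied to it. -/
theorem removeLoop_run {A : Allotment n k} {s : Fin k} {t : Option (Fin k)} {δ : ℕ} {σ : Mem R}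
    (h : Stores I A σ) (hJ : Shifts I J A s δ) (h₆ : σ.var 6 = s) (h₃₄ : σ.var 34 = δ)
    (h₃₅ : σ.var 35 = code t) (ht : t = some s → σ.val 2 0 0 0 ≤ 0)
    (hU : ∀ x l, (x ≠ some s ∧ x ≠ t) → (∀ y ∈ l, y ≠ some s ∧ y ≠ t) →
      0 ≤ walkWeight (J.arc A Finset.univ) x l x) :
    Run I removeLoop σ ((k + 1) ^ 3 * 6 + (k + 1) ^ 2 * 30 + (k + 1) * 40 + 20 +
        (k + 1) * (k * (Nat.log 2 n * 42 + 28))) fun τ =>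
      ∃ B, Stores I B τ ∧ ((occ A s = 0 ∧ B = A) ∨ 0 < occ A s ∧ ∃ E S Q, J.Cheapest A E ∧
        BellmanFord (J.arc A Finset.univ) (fun u => u ≠ some s ∧ u ≠ t) (some s) k S Q ∧
        B = if S k t < σ.val 2 0 0 0 then traceAllotment E Q s t A else A) := by
  have hocc : σ.nat 3 s 0 0 = occ A s := h.occupancy s
  refine (Run.cond (T := ((k + 1) * ((k + 1) * 10 + 4) + 3) +
    ((k * ((k + 1) * ((k + 1) * 6 + 6) + 4) + (k + 1) * 3 + 4) +
      (((k + 1) * (k * (Nat.log 2 n * 42 + 28) + 16) + 3) + 1))) (fun hb => ?_)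
    fun hb => ?_).mono ?_ fun _ _ h => h
  · simp only [BExp.eval, NExp.eval, NExp.eval_var, h₆, hocc] at hb
    refine (fillTables_run h hJ h₆ h₃₄).seq fun σ₁ hF₁ hσ₁ => ?_
    have hin : RelaxInput J A s t σ₁ := by
      refine ⟨hσ₁.1, (hF₁.var_eq (by decide)).trans h.centers, fun i => ?_,
        (hF₁.var_eq (by decide)).trans h₆, hσ₁.2, (hF₁.var_eq (by decide)).trans h₃₅⟩
      rw [hF₁.1 3 (by decide), h.occupancy]
    refine (bellmanFord_run hin hb).seq fun σ₂ hF₂ hσ₂ => ?_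
    obtain ⟨E, hE, hE'⟩ := exists_cheapest (J := J) (occ_pos_lt hb) hσ₁.1
    have hS := (h.of_frame hF₁ (by decide)).of_frame hF₂ (by decide)
    have h₀ : σ₂.var 0 = k := hS.centers
    have h₃₅' : σ₂.var 35 = code t :=
      (hF₂.var_eq (by decide)).trans ((hF₁.var_eq (by decide)).trans h₃₅)
    have h₆' : σ₂.var 6 = s :=
      (hF₂.var_eq (by decide)).trans ((hF₁.var_eq (by decide)).trans h₆)
    have hthr : σ₂.val 2 0 0 0 = σ.val 2 0 0 0 := by
      rw [hF₂.2 2 (by decide), hF₁.2 2 (by decide)]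
    have key : ∀ {c : Cmd} {T : ℕ}, Run I c σ₂ T (Stores I (if σ₂.val 1 k (code t) 0 <
        σ.val 2 0 0 0 then traceAllotment E (fun m v => decodePred k (σ₂.nat 42 m (code v) 0)) s t A
        else A)) → Run I c σ₂ T fun τ =>
      ∃ B, Stores I B τ ∧ ((occ A s = 0 ∧ B = A) ∨ 0 < occ A s ∧ ∃ E S Q, J.Cheapest A E ∧
        BellmanFord (J.arc A Finset.univ) (fun u => u ≠ some s ∧ u ≠ t) (some s) k S Q ∧
        B = if S k t < σ.val 2 0 0 0 then traceAllotment E Q s t A else A) := fun hr =>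
      hr.mono le_rfl fun τ _ hτ => ⟨_, hτ, Or.inr ⟨hb, E, _, _, hE, hσ₂.1, rfl⟩⟩
    refine key (Run.cond (fun hc => ?_) fun hc => ?_)
    · simp only [BExp.eval, VExp.eval, NExp.eval, NExp.eval_var, h₀, h₃₅', hthr] at hc
      rw [if_pos hc]
      refine moveWalk_run hS h₆' h₃₅' (fun _ _ => rfl) hσ₂.2 ?_
      refine hσ₂.1.movable hU (fun hts => hc.trans_le (ht hts)) hE fun u v huv hw => ?_
      rw [hF₂.1 41 (by decide)]
      exact hE' u v huv hw
    · simp only [BExp.eval, VExp.eval, NExp.eval, NExp.eval_var, h₀, h₃₅', hthr] at hc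
      rw [if_neg hc]
      exact (Run.straight (c := Cmd.skip) trivial hS).mono (by simp [Cmd.size]) fun _ _ h => h
  · simp only [BExp.eval, NExp.eval, NExp.eval_var, h₆, hocc] at hb
    exact (Run.straight (c := Cmd.skip) trivial
      ⟨A, h, Or.inl ⟨Nat.eq_zero_of_not_pos hb, rfl⟩⟩).mono (by simp only [Cmd.size]; omega)
      fun _ _ h => h
  · ring_nf; omega

theorem shifts_raise {A : Allotment n k} (I : Problem R n k) (s : Fin k) (h : 0 < occ A s) :
    Shifts I (I.raise s) A s 1 := by
  refine ⟨rfl, fun u => ?_, fun u => ?_⟩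
  all_goals
    simp only [Problem.raise]
    split_ifs with hu
    · subst hu; congr 1; omega
    · have : (u : ℕ) ≠ s := fun h => hu (Fin.ext h)
      congr 1
      omega

theorem shifts_self {A : Allotment n k} (I : Problem R n k) (s : Fin k) : Shifts I I A s 0 :=
  ⟨rfl, fun u => by simp, fun u => by simp⟩

/-- Prices are passed from stage to stage: those of the old allotment justify the first removal,
which yields prices for the raised instance, and these justify the second. -/
theorem insertBalanced_run {I : Problem R (n + 1) k} {A : Allotment n k} {s : Fin k} {σ : Mem R}
    (hA : I.dropLast.NoNegativeLoop A) (h : Stores I.dropLast A σ) (hs : σ.var 6 = s) :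
    Run I insertBalanced σ ((k * (Nat.log 2 (n + 1) * 21 + 14) + 7) + 6 +
      2 * ((k + 1) ^ 3 * 6 + (k + 1) ^ 2 * 30 + (k + 1) * 40 + 20 +
        (k + 1) * (k * (Nat.log 2 (n + 1) * 42 + 28)))) fun τ =>
      ∃ B, Stores I B τ ∧ I.TwoStepInsertion s A B ∧ I.NoNegativeLoop B := by
  set T := (k + 1) ^ 3 * 6 + (k + 1) ^ 2 * 30 + (k + 1) * 40 + 20 +
        (k + 1) * (k * (Nat.log 2 (n + 1) * 42 + 28)) with hT
  obtain ⟨p, hp⟩ := hA.exists_isPrice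
  set A₁ : Allotment (n + 1) k := Fin.snoc A s with hA₁
  have hlast : A₁ (Fin.last n) = s := by simp [hA₁]
  have hocc : 0 < occ A₁ s := occ_pos.2 ⟨_, hlast⟩
  have hcon : ∀ d, d ≠ Fin.last n → (I.raise s).Content A₁ p d := fun d hd =>
    Problem.content_snoc hp s hd
  have hle : ∀ u, (I.raise s).pen u (occ A₁ u) ≤ p u := fun u => by
    rw [(Problem.pen_snoc I A s u).1]; exact hp.le_price u
  have hge : ∀ u, p u ≤ (I.raise s).pen u (occ A₁ u + 1) := fun u => by
    rw [(Problem.pen_snoc I A s u).2]; exact hp.price_le u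
  refine ((insertNode_run h hs).seq (T' := 3 + (T + (3 + T))) fun σ₁ _ hσ₁ => ?_).mono
    (by ring_nf; omega) fun _ _ h => h
  refine Run.seq (P := fun τ => Stores I A₁ τ ∧ τ.var 6 = s ∧ τ.var 34 = 1 ∧ τ.var 35 = s ∧
    τ.val 2 0 0 0 = 0) (Run.straight (c := Cmd.assign 34 (.lit 1) ;; Cmd.assign 35 (.var 6) ;;
    Cmd.setV 2 (.lit 0) (.lit 0) (.lit 0) .zero) (by simp [Cmd.Straight, Cmd.assign]) ?_)
    fun σ₂ _ hσ₂ => ?_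
  · have e : ((Cmd.assign 34 (.lit 1) ;; Cmd.assign 35 (.var 6) ;;
        Cmd.setV 2 (.lit 0) (.lit 0) (.lit 0) .zero).result I σ₁) =
        ((σ₁.setNat 34 0 0 0 1).setNat 35 0 0 0 s).setVal 2 0 0 0 0 := by
      simp only [Cmd.result, Cmd.assign, NExp.eval, VExp.eval, NExp.eval_var,
        Mem.setNat_var_of_ne _ (show 6 ≠ 34 by decide), hσ₁.2]
    rw [e]
    refine ⟨hσ₁.1.of_nat_eq fun a ha => ?_, ?_, rfl, rfl, by simp [Mem.setVal]⟩
    · rw [Mem.setVal_nat, Mem.setNat_nat_of_ne _ (by omega), Mem.setNat_nat_of_ne _ (by omega)]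
    · rw [Mem.setVal_var, Mem.setNat_var_of_ne _ (by decide), Mem.setNat_var_of_ne _ (by decide),
        hσ₁.2]
  obtain ⟨hS₂, h₆, h₃₄, h₃₅, hthr⟩ := hσ₂
  refine Run.seq (removeLoop_run (J := I.raise s) (t := some s) hS₂ (shifts_raise I s hocc) h₆ h₃₄
    h₃₅ (fun _ => hthr.le) (Problem.closedWalk_nonneg hlast hcon hle hge)) fun σ₃ hF₃ hσ₃ => ?_
  obtain ⟨A₂, hS₃, hA₂⟩ := hσ₃
  obtain ⟨hstep, q, hq⟩ : (I.raise s).RemovesLeastLoop (fun L => s ∈ L.vertices) A₁ A₂ ∧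
      ∃ q, (I.raise s).IsPrice A₂ q := by
    rcases hA₂ with ⟨h0, -⟩ | ⟨-, E, S, Q, hE, hBF, hB⟩
    · omega
    · rw [hthr] at hB
      exact Problem.removesLeastLoop_of_bellmanFord hlast hcon hle hge hE hBF hB
  have h₆' := (hF₃.var_eq (a := 6) (by decide)).trans h₆
  refine Run.seq (P := fun τ => Stores I A₂ τ ∧ τ.var 6 = s ∧ τ.var 34 = 0 ∧ τ.var 35 = k ∧
    τ.val 2 0 0 0 = I.pen s (occ A₂ s)) (Run.straight (c := Cmd.assign 34 (.lit 0) ;;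
    Cmd.assign 35 (.var 0) ;; Cmd.setV 2 (.lit 0) (.lit 0) (.lit 0)
      (.pen (.var 6) (.get 3 (.var 6) (.lit 0) (.lit 0))))
    (by simp [Cmd.Straight, Cmd.assign]) ?_) fun σ₄ _ hσ₄ => ?_
  · have h₀ : σ₃.var 0 = k := hS₃.centers
    have h₃ : σ₃.nat 3 s 0 0 = occ A₂ s := hS₃.occupancy s
    have e : ((Cmd.assign 34 (.lit 0) ;; Cmd.assign 35 (.var 0) ;;
        Cmd.setV 2 (.lit 0) (.lit 0) (.lit 0)
          (.pen (.var 6) (.get 3 (.var 6) (.lit 0) (.lit 0)))).result I σ₃) =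
        ((σ₃.setNat 34 0 0 0 0).setNat 35 0 0 0 k).setVal 2 0 0 0 (I.pen s (occ A₂ s)) := by
      simp only [Cmd.result, Cmd.assign, NExp.eval, VExp.eval, NExp.eval_var,
        Mem.setNat_var_of_ne _ (show 6 ≠ 34 by decide), Mem.setNat_var_of_ne _
        (show 6 ≠ 35 by decide), Mem.setNat_var_of_ne _ (show 0 ≠ 34 by decide), h₆', h₀,
        Mem.setNat_nat_of_ne _ (show 3 ≠ 34 by decide), Mem.setNat_nat_of_ne _
        (show 3 ≠ 35 by decide), h₃, I.penAt_val]
    rw [e]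
    refine ⟨hS₃.of_nat_eq fun a ha => ?_, ?_, rfl, rfl, by simp [Mem.setVal]⟩
    · rw [Mem.setVal_nat, Mem.setNat_nat_of_ne _ (by omega), Mem.setNat_nat_of_ne _ (by omega)]
    · rw [Mem.setVal_var, Mem.setNat_var_of_ne _ (by decide), Mem.setNat_var_of_ne _ (by decide),
        h₆']
  obtain ⟨hS₄, h₆, h₃₄, h₃₅, hthr⟩ := hσ₄
  refine (removeLoop_run (J := I) (t := none) hS₄ (shifts_self I s) h₆ h₃₄ h₃₅ (by simp)
    hq.closedWalk_nonneg_of_raise).mono le_rfl fun τ _ hτ => ?_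
  obtain ⟨B, hS, hB⟩ := hτ
  refine ⟨B, hS, ?_⟩
  obtain ⟨hstep', r, hr⟩ : I.RemovesLeastLoop (fun L => L.start = s) A₂ B ∧ ∃ r, I.IsPrice B r := by
    rcases hB with ⟨h0, rfl⟩ | ⟨-, E, S, Q, hE, hBF, hB⟩
    · exact Problem.removesLeastLoop_start_of_occ_eq_zero hq h0
    · rw [hthr] at hB
      exact Problem.removesLeastLoop_start_of_bellmanFord hq hE hBF hB
  exact ⟨⟨A₂, hstep, hstep'⟩, hr.noNegativeLoop⟩

/-- The number of steps of the insertion. -/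
theorem insertion_time_le {k : ℕ} (hk : 0 < k) (n : ℕ) :
    (k * (Nat.log 2 (n + 1) * 21 + 14) + 7) + 6 +
      2 * ((k + 1) ^ 3 * 6 + (k + 1) ^ 2 * 30 + (k + 1) * 40 + 20 +
        (k + 1) * (k * (Nat.log 2 (n + 1) * 42 + 28))) ≤
      1000 * (k ^ 3 + k ^ 2 * Nat.log 2 n) := by
  have hlog : Nat.log 2 (n + 1) ≤ Nat.log 2 n + 1 := by
    rcases Nat.eq_zero_or_pos n with rfl | hn
    · simp
    · calc Nat.log 2 (n + 1) ≤ Nat.log 2 (n * 2) := Nat.log_mono_right (by omega)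
        _ = Nat.log 2 n + 1 := Nat.log_mul_base (by norm_num) (by omega)
  generalize Nat.log 2 (n + 1) = L' at *
  generalize Nat.log 2 n = L at *
  -- Since `k` is positive, all lower-order terms can be absorbed into `k ^ 3` and `k ^ 2 * L`.
  have h₁ : k + 1 ≤ 2 * k := by omega
  have h₂ : k ≤ k ^ 2 := by nlinarith
  have h₃ : k ^ 2 ≤ k ^ 3 := Nat.pow_le_pow_right hk (by norm_num)
  have h₄ : k * L ≤ k ^ 2 * L := Nat.mul_le_mul_right _ h₂
  calc _ ≤ (k * ((L + 1) * 21 + 14) + 7) + 6 +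
      2 * ((2 * k) ^ 3 * 6 + (2 * k) ^ 2 * 30 + (2 * k) * 40 + 20 +
        (2 * k) * (k * ((L + 1) * 42 + 28))) := by gcongr
    _ ≤ 1000 * (k ^ 3 + k ^ 2 * L) := by ring_nf at *; omega

end LBDD

theorem mainTheorem3 :
    ∃ (insert : LBDD.Cmd) (C : ℕ),
      ∀ (R : Type*) [CommRing R] [LinearOrder R] [IsStrictOrderedRing R] (n k : ℕ)
        (I : LBDD.Problem R (n + 1) k) (A : LBDD.Allotment n k) (s : Fin k) (σ : LBDD.Mem R),
        I.dropLast.NoNegativeLoop A →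
        LBDD.Stores I.dropLast A σ →
        σ.nat 6 0 0 0 = s →
        ∃ (B : LBDD.Allotment (n + 1) k) (σ' : LBDD.Mem R) (t : ℕ),
          LBDD.Exec I insert σ σ' t ∧
          t ≤ C * (k ^ 3 + k ^ 2 * Nat.log 2 n) ∧
          LBDD.Stores I B σ' ∧
          I.TwoStepInsertion s A B ∧
          I.NoNegativeLoop B := by
  refine ⟨LBDD.insertBalanced, 1000, fun R _ _ _ n k I A s σ hA h hs => ?_⟩
  obtain ⟨σ', t, hE, ht, B, hB⟩ := LBDD.insertBalanced_run hA h hs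
  exact ⟨B, σ', t, hE, ht.trans (LBDD.insertion_time_le s.pos n), hB⟩
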